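/- Let $\mathbb{R}^{2n}$ carry coordinates $(q,p)$, the Euclidean inner product, the symplectic form $\omega=\sum_i dp_i\wedge dq_i$ and $J(q,p)=(p,-q)$. Let $K\subset\mathbb{R}^{2n}$ be a convex body (compact, convex, with non-empty interior). For $x\in\partial K$ let $N_K(x)=\{v:\langle v,x-y\rangle\ge 0\ \forall y\in K\}$ be the normal cone, and for $E\subset\partial K$ put $N_K(E)=\bigcap_{x\in E}N_K(x)$. A closed characteristic on $\partial K$ is a non-constant curve $\gamma\in W^{1,2}([0,T],\partial K)$, $T>0$, with $\gamma(0)=\gamma(T)$ and $-J\dot\gamma(t)\in N_K(\gamma(t))$ for almost every $t$; its action is $\frac12\int_0^T\sum_i(p_i\dot q_i-q_i\dot p_i)\,dt$, and it is action-minimizing if no closed characteristic on $\partial K$ (of any period) has smaller action. An extreme face of $N_K(x)$ is a set $F=L\cap N_K(x)$, with $L$ a linear subspace, that is an extreme subset of $N_K(x)$ (if a point of $F$ lies in an open segment with endpoints in $N_K(x)$, then the endpoints lie in $F$); its dimension is that of its linear span, it is isotropic if $\omega$ vanishes on its span, and it is an extreme ray if it is one-dimensional. A coisotropic face of $\partial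 K$ is an extreme convex subset $E$ of $\partial K$ such that $\mathrm{span}(E-E)$ is coisotropic, i.e. contains its $\omega$-orthogonal complement. The curve $\gamma$ moves along the coisotropic face $E$ at time $t$ if there is an open interval $(t_0,t_1)\ni t$ of times such that $\gamma(s)\in E$ for all $s\in(t_0,t_1)$ and $\dot\gamma(s)\in J N_K(E)$ for almost every $s\in(t_0,t_1)$. An isotropic gliding set of $\gamma$ is a measurable set $A\subset(0,T)$ of positive measure such that for every $t\in A$ the vector $-J\dot\gamma(t)$ lies in the relative interior of an isotropic extreme face of $N_K(\gamma(t))$ of dimension greater than one, and $\gamma$ does not move along any coisotropic face of $\partial K$ at time $t$. Theorem (Classification of systoles dynamics). Let $\gamma$ be an action-minimizing closed characteristic on $\partial K$. Then for almost every $t\in[0,T]$ at least one of the following holds: (i) $-J\dot\gamma(t)$ lies on an extreme ray of the normal cone $N_K(\gamma(t))$; (ii) $\gamma$ moves along some coisotropic face of $\partial K$ at time $t$; (iii) $\gamma$ exhibits isotropic gliding at time $t$, i.e. $t$ belongs to an isotropic gliding set of $\gamma$. -/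

import Mathlib

open MeasureTheory Set

/-- The phase space `ℝ²ⁿ` with its Euclidean structure; the coordinates `Sum.inl i` are the
positions `q i` and the coordinates `Sum.inr i` are the momenta `p i`. -/
abbrev PhaseSpace (n : ℕ) : Type := EuclideanSpace ℝ (Fin n ⊕ Fin n)

namespace PhaseSpace

/-- The complex structure `J (q, p) = (p, -q)`, so that `x' = J ∇H(x)` is Hamilton's equation
`q' = ∂H/∂p`, `p' = -∂H/∂q`. -/
def J {n : ℕ} : PhaseSpace n →ₗ[ℝ] PhaseSpace n where
  toFun x := WithLp.toLp 2 (Sum.elim (fun i => x (Sum.inr i)) (fun i => -x (Sum.inl i)))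
  map_add' x y := by
    ext k
    rcases k with i | i
    · simp
    · simp [add_comm]
  map_smul' c x := by
    ext k
    rcases k with i | i <;> simp

/-- The standard symplectic form `ω = ∑ dpᵢ ∧ dqᵢ`. -/
def omega {n : ℕ} (u v : PhaseSpace n) : ℝ :=
  ∑ i : Fin n, (u (Sum.inr i) * v (Sum.inl i) - u (Sum.inl i) * v (Sum.inr i))

/-- `W` is isotropic: `ω` vanishes on `W`. -/
def IsIsotropic {n : ℕ} (W : Submodule ℝ (PhaseSpace n)) : Prop :=
  ∀ u ∈ W, ∀ v ∈ W, omega u v = 0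

/-- `W` is coisotropic: it contains its `ω`-orthogonal complement. -/
def IsCoisotropic {n : ℕ} (W : Submodule ℝ (PhaseSpace n)) : Prop :=
  ∀ u, (∀ w ∈ W, omega u w = 0) → u ∈ W

/-- The normal cone `N_K(x)` of `K` at `x`. -/
def normalCone {n : ℕ} (K : Set (PhaseSpace n)) (x : PhaseSpace n) : Set (PhaseSpace n) :=
  {v | ∀ y ∈ K, 0 ≤ inner ℝ v (x - y)}

/-- The normal cone `N_K(E) = ⋂ x ∈ E, N_K(x)` of `K` along a set `E`. -/
def normalConeAlong {n : ℕ} (K E : Set (PhaseSpace n)) : Set (PhaseSpace n) :=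
  ⋂ x ∈ E, normalCone K x

/-- The action `½ ∫₀ᵀ ∑ (pᵢ qᵢ' - qᵢ pᵢ') dt` of a curve on `[0, T]`. -/
noncomputable def action {n : ℕ} (T : ℝ) (γ : ℝ → PhaseSpace n) : ℝ :=
  (1 / 2) * ∫ t in (0 : ℝ)..T, omega (γ t) (deriv γ t)

/-- A (generalized, non-constant) closed characteristic on `∂K`: a closed curve
`γ ∈ W^{1,2}([0, T], ∂K)` with `-J γ'(t) ∈ N_K(γ(t))` for almost every `t`.
Only the values of `γ` on `[0, T]` matter. -/
structure IsClosedCharacteristic {n : ℕ} (K : Set (PhaseSpace n)) (T : ℝ)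
    (γ : ℝ → PhaseSpace n) : Prop where
  period_pos : 0 < T
  absolutelyContinuous : AbsolutelyContinuousOnInterval γ 0 T
  deriv_memLp : MemLp (deriv γ) 2 (volume.restrict (Icc 0 T))
  closed : γ 0 = γ T
  mem_boundary : ∀ t ∈ Icc 0 T, γ t ∈ frontier K
  velocity : ∀ᵐ t ∂volume.restrict (Icc 0 T), -J (deriv γ t) ∈ normalCone K (γ t)
  nonconstant : ∃ t ∈ Icc 0 T, γ t ≠ γ 0

/-- A closed characteristic whose action is minimal among all closed characteristics on `∂K`. -/
def IsActionMinimizing {n : ℕ} (K : Set (PhaseSpace n)) (T : ℝ) (γ : ℝ → PhaseSpace n) : Prop :=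
  IsClosedCharacteristic K T γ ∧
    ∀ (T' : ℝ) (γ' : ℝ → PhaseSpace n), IsClosedCharacteristic K T' γ' → action T γ ≤ action T' γ'

/-- `F` is an extreme face of the convex cone `N`: the intersection of `N` with a linear subspace
that is an extreme subset of `N`. Its dimension is the dimension of its linear span. -/
def IsExtremeFace {n : ℕ} (N F : Set (PhaseSpace n)) : Prop :=
  (∃ L : Submodule ℝ (PhaseSpace n), F = (L : Set (PhaseSpace n)) ∩ N) ∧ IsExtreme ℝ N F

/-- An extreme ray is a one-dimensional extreme face. -/
def IsExtremeRay {n : ℕ} (N R : Set (PhaseSpace n)) : Prop :=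
  IsExtremeFace N R ∧ Module.finrank ℝ (Submodule.span ℝ R) = 1

/-- A coisotropic face of `∂K`: an extreme convex subset `E` of `∂K` such that
`TE = span (E - E)` is coisotropic. -/
def IsCoisotropicFace {n : ℕ} (K E : Set (PhaseSpace n)) : Prop :=
  Convex ℝ E ∧ IsExtreme ℝ (frontier K) E ∧ IsCoisotropic (vectorSpan ℝ E)

/-- `γ` moves along `E` at time `t`: on an open interval around `t`, the curve stays in `E` and
`γ'(s) ∈ J N_K(E)` for almost every `s`. -/
def MovesAlong {n : ℕ} (K : Set (PhaseSpace n)) (T : ℝ) (γ : ℝ → PhaseSpace n)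
    (E : Set (PhaseSpace n)) (t : ℝ) : Prop :=
  ∃ t₀ t₁ : ℝ, t ∈ Ioo t₀ t₁ ∧ Ioo t₀ t₁ ⊆ Icc 0 T ∧ (∀ s ∈ Ioo t₀ t₁, γ s ∈ E) ∧
    ∀ᵐ s ∂volume.restrict (Ioo t₀ t₁), deriv γ s ∈ J '' normalConeAlong K E

/-- An isotropic gliding set of `γ`: a (Lebesgue measurable) set of times of positive measure
such that, at each of its times, `-J γ'(t)` lies in the relative interior of an isotropic extreme
face of `N_K(γ(t))` of dimension greater than one, and `γ` moves along no coisotropic face.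
(On the circle `ℝ / Tℤ` the time `0 = T` is disregarded; it has measure zero.) -/
structure IsIsotropicGlidingSet {n : ℕ} (K : Set (PhaseSpace n)) (T : ℝ) (γ : ℝ → PhaseSpace n)
    (A : Set ℝ) : Prop where
  subset : A ⊆ Ioo 0 T
  measurable : NullMeasurableSet A volume
  pos : 0 < volume A
  isotropic : ∀ t ∈ A, ∃ F, IsExtremeFace (normalCone K (γ t)) F ∧
    IsIsotropic (Submodule.span ℝ F) ∧ 1 < Module.finrank ℝ (Submodule.span ℝ F) ∧
    -J (deriv γ t) ∈ intrinsicInterior ℝ F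
  not_movesAlong : ∀ t ∈ A, ∀ E, IsCoisotropicFace K E → ¬ MovesAlong K T γ E t

end PhaseSpace

namespace PhaseSpace

open Filter Topology

variable {n : ℕ}

/-! ### The complex structure -/

/-! Write `γ' = J v` with `v ∈ N_K(γ)`. The heart of the proof is that at almost every time the
minimal face of `N_K(γ(t))` containing `v(t)` is isotropic. Granted this, if the face is a line the
velocity lies on an extreme ray. If not, the time either belongs to the open set of times at which
`γ` moves along a coisotropic face, or to a measurable remainder, which is an isotropic gliding set
when it has positive measure and can be discarded when it is null.

Isotropy comes from a second variation. Let `δ` satisfy `v + δ ∈ N_K(γ)`, `∫ δ = 0` and `∫ ⟨γ, δ⟩ =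
0`. Then `v + δ` generates a closed loop of the same `K`-length `a = 2 · action γ`, and its area
form is `a + Q(δ)`, where `Q(δ) = areaForm T δ δ`. Clarke duality
(`exists_isClosedCharacteristic_action_le`) turns a loop of length `L` and positive area form `A`
into a closed characteristic of action at most `L² / (2A)`. Minimality of `γ` therefore forces `Q(δ)
≤ 0` (`IsActionMinimizing.areaForm_nonpos`).

For Clarke duality, fix the length density `ρ` and maximise the area by Arzelà–Ascoli. A Lagrange
multiplier for closedness (`exists_multiplier`) makes the optimality condition pointwise: the
velocity of the translated maximiser is normal to the level sets of the gauge of `K`. The gauge is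
then constant along the curve, and rescaling puts the curve on `∂K`.

To contradict `Q ≤ 0`, suppose bounded measurable face directions `p`, `q` have `ω(p, q) < 0` on a
set of positive measure. At `2n + 2` Lebesgue points insert tiny loops in the directions `p`, `q`,
each of definite positive area. There are `2n + 1` linear constraints, so some nontrivial
combination of the loops is admissible, and interactions between the loops are too small to destroy
positivity (`IsActionMinimizing.ae_omega_nonneg`). Exchanging `p` and `q`, and using measurable
selections dense in the face directions, gives `ω = 0` on the whole face. -/

theorem inner_eq_sum (x y : PhaseSpace n) :
    inner ℝ x y = ∑ i : Fin n, (x (Sum.inl i) * y (Sum.inl i) + x (Sum.inr i) * y (Sum.inr i)) := by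
  simp [PiLp.inner_apply, Fintype.sum_sum_type, Finset.sum_add_distrib, mul_comm]

theorem J_inl (x : PhaseSpace n) (i : Fin n) : J x (Sum.inl i) = x (Sum.inr i) := rfl

theorem J_inr (x : PhaseSpace n) (i : Fin n) : J x (Sum.inr i) = -x (Sum.inl i) := rfl

theorem J_J (x : PhaseSpace n) : J (J x) = -x := by
  ext k
  rcases k with i | i <;> simp [J_inl, J_inr]

theorem inner_J_J (x y : PhaseSpace n) : inner ℝ (J x) (J y) = inner ℝ x y := by
  simp only [inner_eq_sum, J_inl, J_inr]
  exact Finset.sum_congr rfl fun i _ => by ring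

theorem inner_J_left (x y : PhaseSpace n) : inner ℝ (J x) y = -inner ℝ x (J y) := by
  rw [← inner_J_J x (J y), J_J, inner_neg_right, neg_neg]

theorem inner_J_comm (x y : PhaseSpace n) : inner ℝ (J x) y = -inner ℝ (J y) x := by
  rw [inner_J_left, real_inner_comm]

theorem omega_eq_inner (u v : PhaseSpace n) : omega u v = inner ℝ (J u) v := by
  simp only [omega, inner_eq_sum, J_inl, J_inr]
  exact Finset.sum_congr rfl fun i _ => by ring

theorem norm_J (x : PhaseSpace n) : ‖J x‖ = ‖x‖ := by
  rw [norm_eq_sqrt_real_inner, inner_J_J, ← norm_eq_sqrt_real_inner]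

/-- `J` as a continuous linear map. -/
noncomputable def JL : PhaseSpace n →L[ℝ] PhaseSpace n := LinearMap.toContinuousLinearMap J

theorem continuous_J : Continuous (J : PhaseSpace n → PhaseSpace n) :=
  (JL : PhaseSpace n →L[ℝ] PhaseSpace n).continuous

/-! ### Absolutely continuous curves -/

/-- The variation sums of `f` are at most `C` times those of `R`. In this way vector-valued curves
inherit absolute continuity from a scalar primitive that dominates their increments. -/
theorem _root_.AbsolutelyContinuousOnInterval.of_dist_le {X Y : Type*} [PseudoMetricSpace X]
    [PseudoMetricSpace Y] {f : ℝ → X} {R : ℝ → Y} {a b C : ℝ}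
    (hR : AbsolutelyContinuousOnInterval R a b)
    (h : ∀ s ∈ uIcc a b, ∀ t ∈ uIcc a b, dist (f s) (f t) ≤ C * dist (R s) (R t)) :
    AbsolutelyContinuousOnInterval f a b := by
  unfold AbsolutelyContinuousOnInterval at hR ⊢
  apply squeeze_zero' ?_ ?_ (by simpa using hR.const_mul C)
  · exact Filter.Eventually.of_forall fun _ ↦ Finset.sum_nonneg (fun i hi ↦ dist_nonneg)
  rw [eventually_inf_principal]
  filter_upwards with (m, I) hnI
  rw [Finset.mul_sum]
  refine Finset.sum_le_sum fun i hi => h _ (hnI.1 i hi).1 _ (hnI.1 i hi).2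

theorem _root_.LipschitzWith.comp_absolutelyContinuousOnInterval {X Y : Type*}
    [PseudoMetricSpace X] [PseudoMetricSpace Y] {f : ℝ → X} {g : X → Y} {a b : ℝ} {C : NNReal}
    (hg : LipschitzWith C g) (hf : AbsolutelyContinuousOnInterval f a b) :
    AbsolutelyContinuousOnInterval (fun t => g (f t)) a b :=
  hf.of_dist_le fun _ _ _ _ => hg.dist_le_mul _ _

theorem _root_.AbsolutelyContinuousOnInterval.fun_inner {F : Type*} [NormedAddCommGroup F]
    [InnerProductSpace ℝ F] {f g : ℝ → F} {a b : ℝ}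
    (hf : AbsolutelyContinuousOnInterval f a b) (hg : AbsolutelyContinuousOnInterval g a b) :
    AbsolutelyContinuousOnInterval (fun t => inner ℝ (f t) (g t)) a b := by
  obtain ⟨C, hC⟩ := hf.exists_bound
  obtain ⟨D, hD⟩ := hg.exists_bound
  unfold AbsolutelyContinuousOnInterval at hf hg
  apply squeeze_zero' ?_ ?_ (by simpa using (hg.const_mul C).add (hf.const_mul D))
  · exact Filter.Eventually.of_forall fun _ ↦ Finset.sum_nonneg (fun i hi ↦ dist_nonneg)
  rw [eventually_inf_principal]
  filter_upwards with (m, I) hnI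
  simp only [Finset.mul_sum, ← Finset.sum_add_distrib]
  refine Finset.sum_le_sum fun i hi => ?_
  have h1 := hC _ (hnI.1 i hi).1
  have h2 := hD _ (hnI.1 i hi).2
  set x := (I i).1
  set y := (I i).2
  have : inner ℝ (f x) (g x) - inner ℝ (f y) (g y)
      = inner ℝ (f x) (g x - g y) + inner ℝ (f x - f y) (g y) := by
    rw [inner_sub_right, inner_sub_left]; ring
  rw [Real.dist_eq, this, dist_eq_norm, dist_eq_norm]
  refine (abs_add_le _ _).trans (add_le_add ?_ ?_)
  · exact (abs_real_inner_le_norm _ _).trans (by gcongr)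
  · exact (abs_real_inner_le_norm _ _).trans (by rw [mul_comm]; gcongr)

/-- The fundamental theorem of calculus for absolutely continuous curves in finite dimension. -/
theorem _root_.AbsolutelyContinuousOnInterval.eq_add_integral {F : Type*} [NormedAddCommGroup F]
    [NormedSpace ℝ F] [FiniteDimensional ℝ F] {f u : ℝ → F} {a b : ℝ}
    (hf : AbsolutelyContinuousOnInterval f a b) (hu : IntervalIntegrable u volume a b)
    (hac : AbsolutelyContinuousOnInterval (fun t => ∫ s in a..t, u s) a b)
    (hd : ∀ᵐ t, t ∈ uIcc a b → HasDerivAt f (u t) t) {t : ℝ} (ht : t ∈ uIcc a b) :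
    f t = f a + ∫ s in a..t, u s := by
  have : CompleteSpace F := FiniteDimensional.complete ℝ F
  have h0 : ∀ᵐ x, x ∈ uIcc a b → HasDerivAt (fun t => f t - ∫ s in a..t, u s) 0 x := by
    filter_upwards [hd, hu.ae_hasDerivAt_integral] with x h1 h2 hx
    simpa using (h1 hx).fun_sub (h2 hx a left_mem_uIcc)
  obtain ⟨C, hC⟩ := (hf.fun_sub hac).const_of_ae_hasDerivAt_zero h0
  have h1 := hC a left_mem_uIcc
  have h2 := hC t ht
  simp only [intervalIntegral.integral_same, sub_zero] at h1
  rw [h1, ← h2]; abel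

/-! ### Primitives and the area form -/

/-- The primitive of `u` vanishing at `0`. -/
noncomputable def prim {F : Type*} [NormedAddCommGroup F] [NormedSpace ℝ F] (u : ℝ → F) (t : ℝ) :
    F := ∫ s in (0 : ℝ)..t, u s

section prim

variable {F : Type*} [NormedAddCommGroup F] [NormedSpace ℝ F] {u u' : ℝ → F}

theorem prim_zero (u : ℝ → F) : prim u 0 = 0 := by simp [prim]

theorem prim_add (hu : Integrable u) (hu' : Integrable u') (t : ℝ) :
    prim (fun s => u s + u' s) t = prim u t + prim u' t :=
  intervalIntegral.integral_add hu.intervalIntegrable hu'.intervalIntegrable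

theorem prim_smul (c : ℝ) (u : ℝ → F) (t : ℝ) : prim (fun s => c • u s) t = c • prim u t :=
  intervalIntegral.integral_smul _ _

theorem prim_sub_prim (hu : Integrable u) (s t : ℝ) : prim u t - prim u s = ∫ x in s..t, u x :=
  intervalIntegral.integral_interval_sub_left hu.intervalIntegrable hu.intervalIntegrable

theorem continuous_prim (hu : Integrable u) : Continuous (prim u) :=
  intervalIntegral.continuous_primitive (fun _ _ => hu.intervalIntegrable) 0

theorem norm_prim_sub_le {ρ : ℝ → ℝ} (hu : Integrable u) (hρ : Integrable ρ) {s t : ℝ}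
    (hst : s ≤ t) (h : ∀ᵐ x, x ∈ Ioc s t → ‖u x‖ ≤ ρ x) :
    ‖prim u t - prim u s‖ ≤ prim ρ t - prim ρ s := by
  rw [prim_sub_prim hu, prim_sub_prim hρ]
  exact intervalIntegral.norm_integral_le_of_norm_le hst h hρ.intervalIntegrable

theorem absolutelyContinuous_prim (hu : Integrable u) (a b : ℝ) :
    AbsolutelyContinuousOnInterval (prim u) a b := by
  have hac : AbsolutelyContinuousOnInterval (prim fun t => ‖u t‖) a b := by
    have h := (hu.norm.intervalIntegrable (a := a)
      (b := b)).absolutelyContinuousOnInterval_intervalIntegral (c := a) left_mem_uIcc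
    refine h.of_dist_le (C := 1) fun s _ t _ => ?_
    rw [one_mul, dist_comm, Real.dist_eq, dist_comm, Real.dist_eq, prim_sub_prim hu.norm,
      intervalIntegral.integral_interval_sub_left hu.norm.intervalIntegrable
        hu.norm.intervalIntegrable]
  refine hac.of_dist_le (C := 1) fun s _ t _ => ?_
  wlog hst : s ≤ t generalizing s t
  · have := this t ‹_› s ‹_› (by linarith)
    rwa [dist_comm, dist_comm (prim (fun t => ‖u t‖) s)]
  rw [one_mul, dist_comm, dist_eq_norm, dist_comm, Real.dist_eq]
  exact (norm_prim_sub_le hu hu.norm hst (ae_of_all _ fun _ _ => le_rfl)).trans (le_abs_self _)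

theorem ae_hasDerivAt_prim [CompleteSpace F] (hu : Integrable u) :
    ∀ᵐ t, HasDerivAt (prim u) (u t) t := by
  filter_upwards [LocallyIntegrable.ae_hasDerivAt_integral hu.locallyIntegrable] with t ht using ht 0

end prim

theorem integrable_inner_of_bounded {F : Type*} [NormedAddCommGroup F] [InnerProductSpace ℝ F]
    {f g : ℝ → F} {s : Set ℝ} (hs : MeasurableSet s) {C : ℝ}
    (hf : AEStronglyMeasurable f (volume.restrict s)) (hC : ∀ t ∈ s, ‖f t‖ ≤ C)
    (hg : IntegrableOn g s) : IntegrableOn (fun t => inner ℝ (f t) (g t)) s := by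
  refine (hg.norm.const_mul C).mono' (hf.inner hg.1) ?_
  refine (ae_restrict_iff' hs).2 (ae_of_all _ fun t ht => ?_)
  exact (norm_inner_le_norm _ _).trans (by gcongr; exact hC t ht)

theorem intervalIntegrable_inner {F : Type*} [NormedAddCommGroup F] [InnerProductSpace ℝ F]
    {f g : ℝ → F} (hf : Continuous f) (hg : Integrable g) (a b : ℝ) :
    IntervalIntegrable (fun t => inner ℝ (f t) (g t)) volume a b := by
  obtain ⟨C, hC⟩ := isCompact_uIcc.exists_bound_of_continuousOn (s := uIcc a b) hf.continuousOn
  rw [intervalIntegrable_iff]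
  exact integrable_inner_of_bounded measurableSet_uIoc hf.aestronglyMeasurable
    (fun t ht => hC t (uIoc_subset_uIcc ht)) hg.integrableOn

/-- Twice the action of the loop with velocity `J u`, polarised. -/
noncomputable def areaForm (T : ℝ) (u u' : ℝ → PhaseSpace n) : ℝ :=
  ∫ t in (0 : ℝ)..T, inner ℝ (J (prim u t)) (u' t)

section areaForm

variable {T : ℝ} {u u' w : ℝ → PhaseSpace n}

theorem intervalIntegrable_areaForm (hu : Integrable u) (hu' : Integrable u') (a b : ℝ) :
    IntervalIntegrable (fun t => inner ℝ (J (prim u t)) (u' t)) volume a b :=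
  intervalIntegrable_inner (continuous_J.comp (continuous_prim hu)) hu' a b

theorem areaForm_add_right (hu : Integrable u) (hu' : Integrable u') (hw : Integrable w) :
    areaForm T u (fun t => u' t + w t) = areaForm T u u' + areaForm T u w := by
  simp only [areaForm, inner_add_right]
  exact intervalIntegral.integral_add (intervalIntegrable_areaForm hu hu' _ _)
    (intervalIntegrable_areaForm hu hw _ _)

theorem areaForm_add_left (hu : Integrable u) (hu' : Integrable u') (hw : Integrable w) :
    areaForm T (fun t => u t + u' t) w = areaForm T u w + areaForm T u' w := by
  simp only [areaForm, prim_add hu hu', map_add, inner_add_left]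
  exact intervalIntegral.integral_add (intervalIntegrable_areaForm hu hw _ _)
    (intervalIntegrable_areaForm hu' hw _ _)

theorem areaForm_smul_right (c : ℝ) : areaForm T u (fun t => c • u' t) = c * areaForm T u u' := by
  simp only [areaForm, inner_smul_right]
  exact intervalIntegral.integral_const_mul _ _

theorem areaForm_smul_left (c : ℝ) : areaForm T (fun t => c • u t) u' = c * areaForm T u u' := by
  simp only [areaForm, prim_smul, map_smul, real_inner_smul_left]
  exact intervalIntegral.integral_const_mul _ _

/-- Integration by parts for `⟨J U, U'⟩`, with the skew-symmetry of `J`. The boundary term vanishes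
as soon as one of the two loops closes up, so the area form is symmetric on closed loops; for
unclosed ones it measures the product of the closing defects. -/
theorem areaForm_sub_areaForm (hu : Integrable u) (hu' : Integrable u') :
    areaForm T u u' - areaForm T u' u = inner ℝ (J (prim u T)) (prim u' T) := by
  have hL : LipschitzWith 1 (J : PhaseSpace n → PhaseSpace n) :=
    LipschitzWith.of_dist_le_mul fun x y => by
      rw [dist_eq_norm, ← map_sub, norm_J, dist_eq_norm]; simp
  have hac : AbsolutelyContinuousOnInterval (fun t => inner ℝ (J (prim u t)) (prim u' t)) 0 T :=
    (hL.comp_absolutelyContinuousOnInterval (absolutelyContinuous_prim hu 0 T)).fun_inner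
      (absolutelyContinuous_prim hu' 0 T)
  have h1 := hac.integral_deriv_eq_sub
  simp only [prim_zero, map_zero, inner_zero_left, sub_zero] at h1
  rw [← h1, areaForm, areaForm, ← intervalIntegral.integral_sub
    (intervalIntegrable_areaForm hu hu' _ _) (intervalIntegrable_areaForm hu' hu _ _)]
  refine intervalIntegral.integral_congr_ae ?_
  filter_upwards [ae_hasDerivAt_prim hu, ae_hasDerivAt_prim hu'] with t h2 h3 _
  have h4 : HasDerivAt (fun t => J (prim u t)) (J (u t)) t :=
    (JL : PhaseSpace n →L[ℝ] PhaseSpace n).hasFDerivAt.comp_hasDerivAt t h2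
  rw [(h4.inner ℝ h3).deriv, inner_J_comm (u t) (prim u' t)]
  ring

theorem areaForm_comm (hu : Integrable u) (hu' : Integrable u') (h0 : prim u T = 0) :
    areaForm T u u' = areaForm T u' u := by
  have := areaForm_sub_areaForm (T := T) hu hu'
  rw [h0, map_zero, inner_zero_left] at this
  linarith

end areaForm

/-! ### Velocities dominated by a density -/

/-- `J u` is the velocity of a curve whose `K`-length has density at most `ρ`: the support function
of `K` at `u t` is at most `ρ t`. -/
structure Admissible (K : Set (PhaseSpace n)) (ρ : ℝ → ℝ) (u : ℝ → PhaseSpace n) : Prop where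
  integrable : Integrable u
  inner_le : ∀ᵐ t, ∀ x ∈ K, inner ℝ (u t) x ≤ ρ t

theorem mul_norm_le_of_inner_le {K : Set (PhaseSpace n)} {r c : ℝ} {u : PhaseSpace n}
    (hr : 0 ≤ r) (hK : Metric.closedBall 0 r ⊆ K) (h : ∀ x ∈ K, inner ℝ u x ≤ c) :
    r * ‖u‖ ≤ c := by
  -- The test vector is the point of the ball in the direction of `u`. When `u = 0` the inverse of
  -- the norm is `0`, and the test yields `0 ≤ c`.
  have h1 := h ((r * ‖u‖⁻¹) • u) (hK (by
    rw [mem_closedBall_zero_iff, norm_smul, Real.norm_of_nonneg (by positivity), mul_assoc]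
    exact mul_le_of_le_one_right hr (inv_mul_le_one)))
  rw [inner_smul_right, real_inner_self_eq_norm_sq] at h1
  by_cases hu : ‖u‖ = 0
  · simpa [hu] using h1
  · calc r * ‖u‖ = r * ‖u‖⁻¹ * ‖u‖ ^ 2 := by field_simp
      _ ≤ c := h1

section Admissible

variable {K : Set (PhaseSpace n)} {ρ : ℝ → ℝ} {u u' : ℝ → PhaseSpace n} {r T : ℝ}

theorem Admissible.ae_norm_le (hu : Admissible K ρ u) (hr : 0 < r)
    (hK : Metric.closedBall 0 r ⊆ K) : ∀ᵐ t, ‖u t‖ ≤ r⁻¹ * ρ t := by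
  filter_upwards [hu.inner_le] with t ht
  rw [le_inv_mul_iff₀ hr]
  exact mul_norm_le_of_inner_le hr.le hK ht

theorem Admissible.convex_comb (hu : Admissible K ρ u) (hu' : Admissible K ρ u') {a b : ℝ}
    (ha : 0 ≤ a) (hb : 0 ≤ b) (hab : a + b = 1) :
    Admissible K ρ (fun t => a • u t + b • u' t) := by
  refine ⟨(hu.integrable.smul a).add (hu'.integrable.smul b), ?_⟩
  filter_upwards [hu.inner_le, hu'.inner_le] with t h1 h2 x hx
  rw [inner_add_left, real_inner_smul_left, real_inner_smul_left]
  calc a * inner ℝ (u t) x + b * inner ℝ (u' t) x ≤ a * ρ t + b * ρ t := by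
        gcongr
        · exact h1 x hx
        · exact h2 x hx
    _ = ρ t := by rw [← add_mul, hab, one_mul]

theorem inner_prim_sub_le (hρ : Integrable ρ) (hu : Admissible K ρ u) {s t : ℝ} (hst : s ≤ t)
    {x : PhaseSpace n} (hx : x ∈ K) :
    inner ℝ (prim u t - prim u s) x ≤ prim ρ t - prim ρ s := by
  rw [prim_sub_prim hu.integrable, prim_sub_prim hρ, real_inner_comm,
    intervalIntegral.integral_of_le hst, ← integral_inner hu.integrable.integrableOn,
    ← intervalIntegral.integral_of_le hst]
  refine intervalIntegral.integral_mono_ae hst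
    (intervalIntegrable_inner continuous_const hu.integrable _ _) hρ.intervalIntegrable ?_
  filter_upwards [hu.inner_le] with t ht
  rw [real_inner_comm]
  exact ht x hx

/-- The continuous curves from `0` to `0` whose increments are dominated by those of `R`. -/
def dominatedLoops (K : Set (PhaseSpace n)) (T : ℝ) (R : ℝ → ℝ) : Set (Icc 0 T → PhaseSpace n) :=
  {U | (∀ t : Icc 0 T, (t : ℝ) = 0 ∨ (t : ℝ) = T → U t = 0) ∧
    ∀ s t : Icc 0 T, s ≤ t → ∀ x ∈ K, inner ℝ (U t - U s) x ≤ R t - R s}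

/-- Each condition is an equality or a weak inequality at one or two times, hence survives pointwise
limits. This is why the constraint is put on increments and not on velocities. -/
theorem isClosed_dominatedLoops (K : Set (PhaseSpace n)) (T : ℝ) (R : ℝ → ℝ) :
    IsClosed (dominatedLoops K T R) := by
  have : dominatedLoops K T R =
      (⋂ (t : Icc 0 T) (_ : (t : ℝ) = 0 ∨ (t : ℝ) = T), {U | U t = 0}) ∩
      ⋂ (s : Icc 0 T) (t : Icc 0 T) (_ : s ≤ t) (x ∈ K), {U | inner ℝ (U t - U s) x ≤ R t - R s} := by
    ext U; simp only [dominatedLoops, mem_ofPred_eq, mem_inter_iff, mem_iInter]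
  rw [this]
  refine IsClosed.inter ?_ ?_
  · exact isClosed_iInter fun t => isClosed_iInter fun _ =>
      isClosed_eq (continuous_apply t) continuous_const
  · refine isClosed_iInter fun s => isClosed_iInter fun t => isClosed_iInter fun _ =>
      isClosed_iInter fun x => isClosed_iInter fun _ => isClosed_le ?_ continuous_const
    exact ((continuous_apply t).sub (continuous_apply s)).inner continuous_const

theorem norm_sub_le_of_mem_dominatedLoops {R : ℝ → ℝ} {U : Icc 0 T → PhaseSpace n}
    (hU : U ∈ dominatedLoops K T R) (hr : 0 < r) (hK : Metric.closedBall 0 r ⊆ K)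
    (s t : Icc 0 T) : ‖U t - U s‖ ≤ r⁻¹ * |R t - R s| := by
  wlog hst : s ≤ t generalizing s t
  · rw [norm_sub_rev, abs_sub_comm]
    exact this t s (le_of_not_ge hst)
  rw [le_inv_mul_iff₀ hr]
  exact (mul_norm_le_of_inner_le hr.le hK (hU.2 s t hst)).trans (le_abs_self _)

/-- The ball inside `K` turns domination into the common modulus of continuity `‖U t - U s‖ ≤ r⁻¹ |R
t - R s|`, and all curves start at `0`, so Arzelà–Ascoli applies. -/
theorem isCompact_dominatedLoops (hT : 0 ≤ T) {R : ℝ → ℝ} (hR : Continuous R) (hr : 0 < r)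
    (hK : Metric.closedBall 0 r ⊆ K) :
    IsCompact {U : C(Icc 0 T, PhaseSpace n) | ⇑U ∈ dominatedLoops K T R} := by
  have hc : ∀ U ∈ dominatedLoops K T R, Continuous U := by
    intro U hU
    refine continuous_iff_continuousAt.2 fun s => ?_
    rw [ContinuousAt, tendsto_iff_norm_sub_tendsto_zero]
    refine squeeze_zero (fun _ => norm_nonneg _)
      (fun t => norm_sub_le_of_mem_dominatedLoops hU hr hK s t) ?_
    have : Continuous fun t : Icc 0 T => r⁻¹ * |R t - R s| := by fun_prop
    simpa using this.tendsto s
  refine ArzelaAscoli.isCompact_of_equicontinuous _ ?_ ?_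
  · have him : ContinuousMap.toFun '' {U : C(Icc 0 T, PhaseSpace n) | ⇑U ∈ dominatedLoops K T R}
        = dominatedLoops K T R := by
      ext U
      constructor
      · rintro ⟨V, hV, rfl⟩; exact hV
      · intro hU; exact ⟨⟨U, hc U hU⟩, hU, rfl⟩
    rw [him]
    refine IsCompact.of_isClosed_subset (isCompact_univ_pi fun t : Icc 0 T =>
      isCompact_closedBall (0 : PhaseSpace n) (r⁻¹ * |R t - R 0|))
      (isClosed_dominatedLoops K T R) fun U hU t _ => ?_
    have := norm_sub_le_of_mem_dominatedLoops hU hr hK ⟨0, le_rfl, hT⟩ t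
    rw [hU.1 ⟨0, le_rfl, hT⟩ (Or.inl rfl), sub_zero] at this
    simpa using this
  · intro s
    rw [Metric.equicontinuousAt_iff_right]
    intro ε hε
    have hcont : Continuous fun t : Icc 0 T => r⁻¹ * |R t - R s| := by fun_prop
    have := (hcont.tendsto s).eventually_lt_const (u := ε) (by simpa using hε)
    filter_upwards [this] with t ht U
    rw [dist_comm, dist_eq_norm]
    exact (norm_sub_le_of_mem_dominatedLoops U.2 hr hK s t).trans_lt ht

theorem prim_mem_dominatedLoops (hρ : Integrable ρ) (hu : Admissible K ρ u) (h0 : prim u T = 0) :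
    (fun t : Icc 0 T => prim u t) ∈ dominatedLoops K T (prim ρ) := by
  refine ⟨?_, fun s t hst x hx => inner_prim_sub_le hρ hu hst hx⟩
  rintro t (h | h)
  · simp only [h, prim_zero]
  · simp only [h, h0]

/-- A dominated curve `V` is absolutely continuous because `prim ρ` is. For each `x ∈ K` the
function `prim ρ - ⟨V, x⟩` is monotone, so its derivative is nonnegative wherever it exists; the
exceptional null set does not depend on `x`. -/
theorem exists_admissible_of_mem_dominatedLoops (hT : 0 ≤ T) (hρ : Integrable ρ)
    (hρ0 : ∀ t, 0 ≤ ρ t) (hr : 0 < r) (hK : Metric.closedBall 0 r ⊆ K)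
    {U : Icc 0 T → PhaseSpace n} (hU : U ∈ dominatedLoops K T (prim ρ)) :
    ∃ u, Admissible K ρ u ∧ ∀ t : Icc 0 T, prim u t = U t := by
  set V := IccExtend hT U with hV
  have hVt : ∀ t (ht : t ∈ Icc 0 T), V t = U ⟨t, ht⟩ := fun t ht => IccExtend_of_mem hT U ht
  have hac : AbsolutelyContinuousOnInterval V 0 T := by
    refine (absolutelyContinuous_prim hρ 0 T).of_dist_le (C := r⁻¹) fun s hs t ht => ?_
    rw [uIcc_of_le hT] at hs ht
    rw [dist_comm, dist_eq_norm, dist_comm, Real.dist_eq, hVt s hs, hVt t ht]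
    exact norm_sub_le_of_mem_dominatedLoops hU hr hK ⟨s, hs⟩ ⟨t, ht⟩
  have hdiff := hac.boundedVariationOn.ae_differentiableAt_of_mem_uIcc
  rw [uIcc_of_le hT] at hdiff
  have hle : ∀ᵐ t, t ∈ Ioo 0 T → ∀ x ∈ K, inner ℝ (deriv V t) x ≤ ρ t := by
    filter_upwards [hdiff, ae_hasDerivAt_prim hρ] with t h1 h2 ht x hx
    have hd : HasDerivAt (fun s => prim ρ s - inner ℝ (V s) x) (ρ t - inner ℝ (deriv V t) x) t := by
      have h3 := (h1 (Ioo_subset_Icc_self ht)).hasDerivAt.inner ℝ (hasDerivAt_const t x)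
      simpa using h2.fun_sub h3
    have hm : MonotoneOn (fun s => prim ρ s - inner ℝ (V s) x) (Icc 0 T) := by
      intro a ha b hb hab
      have := hU.2 ⟨a, ha⟩ ⟨b, hb⟩ hab x hx
      rw [← hVt a ha, ← hVt b hb, inner_sub_left] at this
      simp only at this ⊢
      linarith
    have h4 := hm.derivWithin_nonneg (x := t)
    rw [derivWithin_of_mem_nhds (Icc_mem_nhds ht.1 ht.2), hd.deriv] at h4
    linarith
  set u := (Ioo 0 T).indicator (deriv V) with hu
  have hadm : ∀ᵐ t, ∀ x ∈ K, inner ℝ (u t) x ≤ ρ t := by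
    filter_upwards [hle] with t ht x hx
    by_cases h : t ∈ Ioo 0 T
    · rw [hu, indicator_of_mem h]; exact ht h x hx
    · rw [hu, indicator_of_notMem h, inner_zero_left]; exact hρ0 t
  have hint : Integrable u := by
    refine (hρ.const_mul r⁻¹).mono'
      ((measurable_deriv V).aestronglyMeasurable.indicator measurableSet_Ioo) ?_
    filter_upwards [hadm] with t ht
    rw [le_inv_mul_iff₀ hr]
    exact mul_norm_le_of_inner_le hr.le hK ht
  refine ⟨u, ⟨hint, hadm⟩, fun t => ?_⟩
  have hd : ∀ᵐ t, t ∈ uIcc 0 T → HasDerivAt V (u t) t := by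
    have h1 : ∀ᵐ t : ℝ, t ≠ 0 := by simp [ae_iff]
    have h2 : ∀ᵐ t : ℝ, t ≠ T := by simp [ae_iff]
    filter_upwards [hdiff, h1, h2] with t h3 h4 h5 ht
    rw [uIcc_of_le hT] at ht
    have h6 : t ∈ Ioo 0 T := ⟨lt_of_le_of_ne ht.1 (Ne.symm h4), lt_of_le_of_ne ht.2 h5⟩
    rw [hu, indicator_of_mem h6]
    exact (h3 ht).hasDerivAt
  have h6 := hac.eq_add_integral hint.intervalIntegrable (absolutelyContinuous_prim hint 0 T) hd
    (t := t) (by rw [uIcc_of_le hT]; exact t.2)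
  rw [hVt t t.2, hVt 0 ⟨le_rfl, hT⟩, hU.1 ⟨0, le_rfl, hT⟩ (Or.inl rfl), zero_add] at h6
  exact h6.symm

/-- Since `u` closes up, the difference of the two quadratic values equals `areaForm T (u - u') (u +
u')`. Only the primitive of the first factor enters, so uniform closeness of the curves suffices for
closeness of the areas, with no convergence of velocities. -/
theorem abs_areaForm_sub_le (hT : 0 ≤ T) (hρ : Integrable ρ) (hr : 0 < r)
    (hK : Metric.closedBall 0 r ⊆ K) (hu : Admissible K ρ u) (hu' : Admissible K ρ u')
    (h0 : prim u T = 0) {ε : ℝ}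
    (hε : ∀ t ∈ Icc 0 T, ‖prim u t - prim u' t‖ ≤ ε) :
    |areaForm T u u - areaForm T u' u'| ≤ ε * (2 * r⁻¹ * prim ρ T) := by
  have hi := hu.integrable
  have hi' := hu'.integrable
  have hn : Integrable fun t => (-1 : ℝ) • u' t := hi'.smul (-1 : ℝ)
  have key : areaForm T u u - areaForm T u' u' =
      areaForm T (fun t => u t + (-1 : ℝ) • u' t) (fun t => u t + u' t) := by
    rw [areaForm_add_left hi hn (hi.fun_add hi'), areaForm_smul_left, areaForm_add_right hi hi hi',
      areaForm_add_right hi' hi hi', areaForm_comm hi hi' h0]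
    ring
  rw [key, areaForm, ← Real.norm_eq_abs]
  refine (intervalIntegral.norm_integral_le_of_norm_le hT
    (g := fun t => ε * (2 * r⁻¹ * ρ t)) ?_ ?_).trans (le_of_eq ?_)
  · filter_upwards [hu.ae_norm_le hr hK, hu'.ae_norm_le hr hK] with t h1 h2 ht
    refine (norm_inner_le_norm _ _).trans ?_
    have h3 : ‖J (prim (fun t => u t + (-1 : ℝ) • u' t) t)‖ ≤ ε := by
      rw [norm_J, prim_add hi hn, prim_smul, neg_one_smul, ← sub_eq_add_neg]
      exact hε t (Ioc_subset_Icc_self ht)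
    have h4 : ‖u t + u' t‖ ≤ 2 * r⁻¹ * ρ t := by
      refine (norm_add_le _ _).trans ?_
      linarith
    exact mul_le_mul h3 h4 (norm_nonneg _) ((norm_nonneg _).trans h3)
  · exact ((hρ.const_mul _).const_mul _).intervalIntegrable
  · rw [intervalIntegral.integral_const_mul, intervalIntegral.integral_const_mul]
    rfl

/-- Among the admissible loops of density `ρ` there is one of maximal area. -/
theorem exists_maximal_areaForm (hT : 0 ≤ T) (hρ : Integrable ρ) (hρ0 : ∀ t, 0 ≤ ρ t) (hr : 0 < r)
    (hK : Metric.closedBall 0 r ⊆ K) :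
    ∃ u, Admissible K ρ u ∧ prim u T = 0 ∧
      ∀ u', Admissible K ρ u' → prim u' T = 0 → areaForm T u' u' ≤ areaForm T u u := by
  set S := {U : C(Icc 0 T, PhaseSpace n) | ⇑U ∈ dominatedLoops K T (prim ρ)} with hS
  have hcomp : IsCompact S := isCompact_dominatedLoops hT (continuous_prim hρ) hr hK
  have hex : ∀ U : C(Icc 0 T, PhaseSpace n), ∃ u, U ∈ S →
      Admissible K ρ u ∧ ∀ t : Icc 0 T, prim u t = U t := by
    intro U
    by_cases hU : U ∈ S
    · obtain ⟨u, hu⟩ := exists_admissible_of_mem_dominatedLoops hT hρ hρ0 hr hK hU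
      exact ⟨u, fun _ => hu⟩
    · exact ⟨0, fun h => absurd h hU⟩
  choose f hf using hex
  have hfT : ∀ U ∈ S, prim (f U) T = 0 := fun U hU => by
    rw [(hf U hU).2 ⟨T, hT, le_rfl⟩]
    exact hU.1 ⟨T, hT, le_rfl⟩ (Or.inr rfl)
  have hcont : ContinuousOn (fun U => areaForm T (f U) (f U)) S := by
    have hp : 0 ≤ prim ρ T := intervalIntegral.integral_nonneg hT fun t _ => hρ0 t
    refine LipschitzOnWith.continuousOn (K := Real.toNNReal (2 * r⁻¹ * prim ρ T))
      (LipschitzOnWith.of_dist_le_mul fun U hU V hV => ?_)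
    rw [Real.coe_toNNReal _ (by positivity), Real.dist_eq, mul_comm]
    refine abs_areaForm_sub_le hT hρ hr hK (hf U hU).1 (hf V hV).1 (hfT U hU) fun t ht => ?_
    rw [(hf U hU).2 ⟨t, ht⟩, (hf V hV).2 ⟨t, ht⟩, ← dist_eq_norm]
    exact ContinuousMap.dist_apply_le_dist _
  have hne : S.Nonempty := by
    refine ⟨0, ?_, fun s t hst x hx => ?_⟩
    · intros; rfl
    · simp only [ContinuousMap.coe_zero, Pi.zero_apply, sub_zero, inner_zero_left]
      rw [prim_sub_prim hρ]
      exact intervalIntegral.integral_nonneg hst fun t _ => hρ0 t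
  obtain ⟨U, hU, hmax⟩ := hcomp.exists_isMaxOn hne hcont
  refine ⟨f U, (hf U hU).1, hfT U hU, fun u' hu' h0 => ?_⟩
  set V : C(Icc 0 T, PhaseSpace n) :=
    ⟨fun t => prim u' t, (continuous_prim hu'.integrable).comp continuous_subtype_val⟩ with hVdef
  have hV : V ∈ S := prim_mem_dominatedLoops hρ hu' h0
  -- The chosen velocity `f V` may differ from `u'`, but both have the same primitive on `[0, T]`,
  -- hence the same area.
  have h1 := abs_areaForm_sub_le hT hρ hr hK hu' (hf V hV).1 h0 (ε := 0) fun t ht => by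
    rw [(hf V hV).2 ⟨t, ht⟩]; simp [hVdef]
  rw [zero_mul] at h1
  have h2 := hmax hV
  simp only [mem_ofPred_eq] at h2
  have h3 := abs_nonpos_iff.1 h1
  linarith

/-- First-order optimality of a loop of maximal area. -/
theorem areaForm_le_of_maximal (hu : Admissible K ρ u) (h0 : prim u T = 0)
    (hmax : ∀ u', Admissible K ρ u' → prim u' T = 0 → areaForm T u' u' ≤ areaForm T u u)
    (hu' : Admissible K ρ u') (h0' : prim u' T = 0) : areaForm T u u' ≤ areaForm T u u := by
  by_contra! hlt
  set a := areaForm T u u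
  set b := areaForm T u u'
  set c := areaForm T u' u'
  have hexp : ∀ ε : ℝ, 0 ≤ ε → ε ≤ 1 →
      (1 - ε) ^ 2 * a + 2 * (1 - ε) * ε * b + ε ^ 2 * c ≤ a := by
    intro ε h1 h2
    have hi := hu.integrable
    have hi' := hu'.integrable
    have hs : Integrable fun t => (1 - ε) • u t := hi.smul (1 - ε)
    have hs' : Integrable fun t => ε • u' t := hi'.smul ε
    have := hmax _ (hu.convex_comb hu' (sub_nonneg.2 h2) h1 (by ring)) (by
      rw [prim_add hs hs', prim_smul, prim_smul, h0, h0']; simp)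
    rw [areaForm_add_left hs hs' (hs.fun_add hs'), areaForm_smul_left, areaForm_smul_left,
      areaForm_add_right hi hs hs', areaForm_add_right hi' hs hs', areaForm_smul_right,
      areaForm_smul_right, areaForm_smul_right, areaForm_smul_right,
      ← areaForm_comm hi hi' h0] at this
    linarith
  have hpos : 0 < b - a := sub_pos.2 hlt
  have hD : 0 < 2 * (b - a) + |a - 2 * b + c| := by positivity
  -- Moving by `ε` towards `u'` changes the area by `ε (2 (b - a) + ε (a - 2b + c))`. With this `ε`
  -- the second-order term is at most `b - a` in absolute value, half of the first-order gain.
  set ε := (b - a) / (2 * (b - a) + |a - 2 * b + c|) with hε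
  have hε0 : 0 < ε := div_pos hpos hD
  have hε1 : ε ≤ 1 := by
    rw [hε, div_le_one hD]
    have := abs_nonneg (a - 2 * b + c)
    linarith
  have h3 := hexp ε hε0.le hε1
  have h4 : ε * (2 * (b - a) + ε * (a - 2 * b + c)) ≤ 0 := by nlinarith
  have h5 : 2 * (b - a) + ε * (a - 2 * b + c) ≤ 0 := nonpos_of_mul_nonpos_right h4 hε0
  have h6 : ε * |a - 2 * b + c| ≤ b - a := by
    have : ε * (2 * (b - a) + |a - 2 * b + c|) = b - a := by rw [hε]; field_simp
    nlinarith
  have h7 : -(ε * |a - 2 * b + c|) ≤ ε * (a - 2 * b + c) := by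
    rw [← mul_neg]
    exact mul_le_mul_of_nonneg_left (neg_abs_le _) hε0.le
  linarith

end Admissible

/-! ### The polar body -/

/-- The polar body of `K`. -/
def polarBody (K : Set (PhaseSpace n)) : Set (PhaseSpace n) := {k | ∀ x ∈ K, inner ℝ k x ≤ 1}

/-- The support function of the polar body of `K`, i.e. the gauge of `K`. -/
noncomputable def polarSupport (K : Set (PhaseSpace n)) (x : PhaseSpace n) : ℝ :=
  sSup ((fun k => inner ℝ x k) '' polarBody K)

section polar

variable {K : Set (PhaseSpace n)} {r : ℝ}

theorem isCompact_polarBody (hr : 0 < r) (hK : Metric.closedBall 0 r ⊆ K) :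
    IsCompact (polarBody K) := by
  refine IsCompact.of_isClosed_subset (isCompact_closedBall (0 : PhaseSpace n) r⁻¹) ?_ ?_
  · have : polarBody K = ⋂ x ∈ K, {k | inner ℝ k x ≤ 1} := by ext; simp [polarBody]
    rw [this]
    exact isClosed_biInter fun x _ => isClosed_le (continuous_id.inner continuous_const)
      continuous_const
  · intro k hk
    rw [mem_closedBall_zero_iff, ← mul_one r⁻¹, le_inv_mul_iff₀ hr]
    exact mul_norm_le_of_inner_le hr.le hK hk

theorem zero_mem_polarBody (K : Set (PhaseSpace n)) : 0 ∈ polarBody K := fun x _ => by simp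

theorem inner_le_polarSupport (hr : 0 < r) (hK : Metric.closedBall 0 r ⊆ K) (x : PhaseSpace n)
    {k : PhaseSpace n} (hk : k ∈ polarBody K) : inner ℝ x k ≤ polarSupport K x :=
  le_csSup ((isCompact_polarBody hr hK).image (continuous_const.inner continuous_id)).bddAbove
    (mem_image_of_mem _ hk)

theorem exists_inner_eq_polarSupport (hr : 0 < r) (hK : Metric.closedBall 0 r ⊆ K)
    (x : PhaseSpace n) : ∃ k ∈ polarBody K, inner ℝ x k = polarSupport K x :=
  ((isCompact_polarBody hr hK).image
    (f := fun k => inner ℝ x k) (continuous_const.inner continuous_id)).sSup_mem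
      ⟨_, mem_image_of_mem _ (zero_mem_polarBody K)⟩

theorem lipschitzWith_polarSupport (hr : 0 < r) (hK : Metric.closedBall 0 r ⊆ K) :
    LipschitzWith (Real.toNNReal r⁻¹) (polarSupport K) := by
  have key : ∀ x y, polarSupport K x - polarSupport K y ≤ r⁻¹ * ‖x - y‖ := by
    intro x y
    obtain ⟨k, hk, hkx⟩ := exists_inner_eq_polarSupport hr hK x
    have h1 := inner_le_polarSupport hr hK y hk
    have h2 : ‖k‖ ≤ r⁻¹ := by
      rw [← mul_one r⁻¹, le_inv_mul_iff₀ hr]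
      exact mul_norm_le_of_inner_le hr.le hK hk
    calc polarSupport K x - polarSupport K y ≤ inner ℝ x k - inner ℝ y k := by rw [hkx]; linarith
      _ = inner ℝ (x - y) k := (inner_sub_left _ _ _).symm
      _ ≤ ‖x - y‖ * ‖k‖ := real_inner_le_norm _ _
      _ ≤ r⁻¹ * ‖x - y‖ := by rw [mul_comm]; gcongr
  refine LipschitzWith.of_dist_le_mul fun x y => ?_
  rw [Real.coe_toNNReal _ (by positivity), Real.dist_eq, dist_eq_norm, abs_le]
  refine ⟨?_, key x y⟩
  have := key y x
  rw [norm_sub_rev] at this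
  linarith

/-- For `c > 0` the vector `u / c` is in the polar body; for `c = 0` the ball inside `K` forces `u =
0`. -/
theorem inner_le_mul_polarSupport (hr : 0 < r) (hK : Metric.closedBall 0 r ⊆ K)
    {u : PhaseSpace n} {c : ℝ} (h : ∀ x ∈ K, inner ℝ u x ≤ c) (x : PhaseSpace n) :
    inner ℝ x u ≤ c * polarSupport K x := by
  have h1 := mul_norm_le_of_inner_le hr.le hK h
  have hc : 0 ≤ c := le_trans (by positivity) h1
  rcases hc.eq_or_lt with rfl | hc
  · have : ‖u‖ = 0 := le_antisymm (nonpos_of_mul_nonpos_right h1 hr) (norm_nonneg _)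
    rw [norm_eq_zero.1 this]; simp
  · have : c⁻¹ • u ∈ polarBody K := fun y hy => by
      rw [real_inner_smul_left, inv_mul_le_one₀ hc]
      exact h y hy
    have := inner_le_polarSupport hr hK x this
    rw [inner_smul_right, inv_mul_le_iff₀ hc] at this
    exact this

/-- The bipolar theorem: a functional separating `x` from `K`, normalised by its separating level,
lies in the polar body and exceeds `1` at `x`. -/
theorem mem_of_polarSupport_le_one (hconv : Convex ℝ K) (hclosed : IsClosed K) (hr : 0 < r)
    (hK : Metric.closedBall 0 r ⊆ K) {x : PhaseSpace n} (hx : polarSupport K x ≤ 1) : x ∈ K := by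
  by_contra hxK
  obtain ⟨f, a, hfa, hax⟩ := geometric_hahn_banach_closed_point hconv hclosed hxK
  have ha : 0 < a := by
    have := hfa 0 (hK (by simp [hr.le]))
    simpa using this
  set z := (InnerProductSpace.toDual ℝ (PhaseSpace n)).symm f with hz
  have hzf : ∀ y, inner ℝ z y = f y := fun y => InnerProductSpace.toDual_symm_apply
  have hk : a⁻¹ • z ∈ polarBody K := fun y hy => by
    rw [real_inner_smul_left, inv_mul_le_one₀ ha, hzf]
    exact (hfa y hy).le
  have h1 := (inner_le_polarSupport hr hK x hk).trans hx
  rw [inner_smul_right, inv_mul_le_one₀ ha, real_inner_comm, hzf] at h1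
  linarith

/-- If `x` were interior, some `c • x` with `c > 1` would still lie in `K`, against the polar vector
that attains the value `1` at `x`. -/
theorem mem_frontier_of_polarSupport_eq_one (hconv : Convex ℝ K) (hclosed : IsClosed K) (hr : 0 < r)
    (hK : Metric.closedBall 0 r ⊆ K) {x : PhaseSpace n} (hx : polarSupport K x = 1) :
    x ∈ frontier K := by
  rw [hclosed.frontier_eq]
  refine ⟨mem_of_polarSupport_le_one hconv hclosed hr hK hx.le, fun hint => ?_⟩
  obtain ⟨k, hk, hkx⟩ := exists_inner_eq_polarSupport hr hK x
  have hcont : ContinuousAt (fun c : ℝ => c • x) 1 := by fun_prop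
  have h1 : ∀ᶠ c in 𝓝[>] (1 : ℝ), c • x ∈ K :=
    (hcont.tendsto.mono_left nhdsWithin_le_nhds).eventually
      (by simpa using mem_interior_iff_mem_nhds.1 hint)
  obtain ⟨c, hc, hc1⟩ := (h1.and self_mem_nhdsWithin).exists
  have h2 := hk _ hc
  rw [inner_smul_right, real_inner_comm, hkx, hx, mul_one] at h2
  exact absurd h2 (not_le.2 hc1)

end polar

/-! ### Lagrange multipliers for loops of maximal area -/

section multiplier

variable {K : Set (PhaseSpace n)} {ρ : ℝ → ℝ} {u : ℝ → PhaseSpace n} {T : ℝ}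

theorem Admissible.smul_const (hρ : Integrable ρ) (hρ0 : ∀ t, 0 ≤ ρ t) {k : PhaseSpace n}
    (hk : k ∈ polarBody K) : Admissible K ρ (fun t => ρ t • k) := by
  refine ⟨hρ.smul_const k, ae_of_all _ fun t x hx => ?_⟩
  rw [real_inner_smul_left]
  exact mul_le_of_le_one_right (hρ0 t) (hk x hx)

/-- Here `c` is the Lagrange multiplier of the closing condition. The pairs (closing defect, number
below the linearised area) form a convex set, and optimality keeps `(0, a)` out of its interior. A
supporting hyperplane there is not vertical, because every small closing defect is attained; its
slope is `c` up to sign. -/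
theorem exists_multiplier (hT : 0 ≤ T) (hρ : Integrable ρ) (hρ0 : ∀ t, 0 ≤ ρ t) {R : ℝ}
    (hR : 0 < R) (hKR : K ⊆ Metric.closedBall 0 R) (hL : 0 < prim ρ T) (hu : Admissible K ρ u)
    (hopt : ∀ u', Admissible K ρ u' → prim u' T = 0 → areaForm T u u' ≤ areaForm T u u) :
    ∃ c, ∀ u', Admissible K ρ u' → areaForm T u u' - inner ℝ c (prim u' T) ≤ areaForm T u u := by
  set a := areaForm T u u with ha
  set D : Set (PhaseSpace n × ℝ) :=
    {p | ∃ u', Admissible K ρ u' ∧ p.1 = prim u' T ∧ p.2 ≤ areaForm T u u'} with hD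
  have hconv : Convex ℝ D := by
    rintro ⟨x, s⟩ ⟨v, hv, hx, hs⟩ ⟨y, t⟩ ⟨w, hw, hy, ht⟩ α β hα hβ hαβ
    refine ⟨_, hv.convex_comb hw hα hβ hαβ, ?_, ?_⟩
    · simp only at hx hy
      rw [prim_add (hv.integrable.fun_smul α) (hw.integrable.fun_smul β), prim_smul, prim_smul,
        ← hx, ← hy]
      rfl
    · rw [areaForm_add_right hu.integrable (hv.integrable.fun_smul α) (hw.integrable.fun_smul β),
        areaForm_smul_right, areaForm_smul_right]
      simp only at hs ht
      simp only [Prod.smul_mk, Prod.mk_add_mk, smul_eq_mul]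
      gcongr
  obtain ⟨M, hM⟩ := isCompact_Icc.exists_bound_of_continuousOn (s := Icc 0 T)
    (continuous_prim hu.integrable).continuousOn
  have hM0 : 0 ≤ M := (norm_nonneg _).trans (hM 0 ⟨le_rfl, hT⟩)
  set L := prim ρ T with hLdef
  -- The velocity `ρ • k` with `k = x / L` has closing defect `x`; it is admissible since `‖k‖ ≤ 1 /
  -- R` puts `k` in the polar body. Its linearised area is at least `-(M * R⁻¹ * L)`.
  have hsub : Metric.ball (0 : PhaseSpace n) (L / R) ×ˢ Iio (-(M * R⁻¹ * L)) ⊆ D := by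
    rintro ⟨x, s⟩ ⟨hx, hs⟩
    simp only [Metric.mem_ball, dist_zero_right, mem_Iio] at hx hs
    set k := L⁻¹ • x with hkdef
    have hk1 : ‖k‖ ≤ R⁻¹ := by
      rw [hkdef, norm_smul, Real.norm_of_nonneg (by positivity), inv_mul_le_iff₀ hL]
      exact hx.le
    have hk : k ∈ polarBody K := fun y hy => by
      have hy' : ‖y‖ ≤ R := by simpa using hKR hy
      calc inner ℝ k y ≤ ‖k‖ * ‖y‖ := real_inner_le_norm _ _
        _ ≤ R⁻¹ * R := by gcongr
        _ = 1 := inv_mul_cancel₀ hR.ne'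
    refine ⟨_, Admissible.smul_const hρ hρ0 hk, ?_, ?_⟩
    · have : prim (fun t => ρ t • k) T = L • k := intervalIntegral.integral_smul_const _ _
      rw [this, hkdef, smul_smul, mul_inv_cancel₀ hL.ne', one_smul]
    · have h1 : ‖areaForm T u (fun t => ρ t • k)‖ ≤ M * R⁻¹ * L := by
        refine (intervalIntegral.norm_integral_le_of_norm_le hT (g := fun t => M * R⁻¹ * ρ t)
          (ae_of_all _ fun t ht => ?_) (hρ.const_mul _).intervalIntegrable).trans (le_of_eq ?_)
        · refine (norm_inner_le_norm _ _).trans ?_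
          rw [norm_J, norm_smul, Real.norm_of_nonneg (hρ0 t)]
          have h2 := hM t (Ioc_subset_Icc_self ht)
          have h3 := hρ0 t
          calc ‖prim u t‖ * (ρ t * ‖k‖) ≤ M * (ρ t * R⁻¹) := by gcongr
            _ = _ := by ring
        · rw [intervalIntegral.integral_const_mul]; rfl
      have h2 := (abs_le.1 h1).1
      exact hs.le.trans h2
  have hopen : IsOpen (Metric.ball (0 : PhaseSpace n) (L / R) ×ˢ Iio (-(M * R⁻¹ * L))) :=
    Metric.isOpen_ball.prod isOpen_Iio
  have hLR : 0 < L / R := by positivity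
  have hball : ∀ x : PhaseSpace n, ‖x‖ < L / R → ∀ s < -(M * R⁻¹ * L), (x, s) ∈ D :=
    fun x hx s hs => hsub ⟨by simpa using hx, hs⟩
  have hint : (interior D).Nonempty :=
    ⟨(0, -(M * R⁻¹ * L) - 1), interior_maximal hsub hopen ⟨by simpa using hLR, by simp⟩⟩
  have hnot : ((0 : PhaseSpace n), a) ∉ interior D := by
    intro hmem
    have hcont : ContinuousAt (fun ε : ℝ => ((0 : PhaseSpace n), a + ε)) 0 := by fun_prop
    have h1 : ∀ᶠ ε in 𝓝[>] (0 : ℝ), ((0 : PhaseSpace n), a + ε) ∈ D :=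
      (hcont.tendsto.mono_left nhdsWithin_le_nhds).eventually
        (by simpa using mem_interior_iff_mem_nhds.1 hmem)
    obtain ⟨ε, ⟨u', hu', hx, hs⟩, hε⟩ := (h1.and self_mem_nhdsWithin).exists
    have h2 := hopt u' hu' hx.symm
    simp only at hs hε
    linarith
  obtain ⟨f, hf0, hf⟩ := geometric_hahn_banach_of_nonempty_interior_point hconv hnot hint
  set l := f (0, 1) with hl
  have hsplit : ∀ x s, f (x, s) = f (x, 0) + s * l := by
    intro x s
    have : ((x, s) : PhaseSpace n × ℝ) = (x, 0) + s • (0, 1) := by simp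
    rw [this, map_add, map_smul, smul_eq_mul]
  have hl0 : 0 ≤ l := by
    by_contra! hneg
    set s := min (-(M * R⁻¹ * L) - 1) (a - 1) with hs
    have h1 := hf (0, s) (hball 0 (by simpa using hLR) s
      ((min_le_left _ _).trans_lt (by linarith)))
    rw [hsplit 0 s, hsplit 0 a] at h1
    have h2 : s ≤ a - 1 := min_le_right _ _
    nlinarith
  -- If `l = 0`, the functional would be nonpositive on a full ball of closing defects, hence zero
  -- on all of them, and so zero altogether.
  have hlpos : 0 < l := by
    refine lt_of_le_of_ne hl0 fun hl00 => hf0 ?_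
    have hx0 : ∀ x, f (x, 0) ≤ 0 := by
      intro x
      set c := (L / R) / (‖x‖ + 1) with hc
      have hc0 : 0 < c := by positivity
      have h1 := hf (c • x, -(M * R⁻¹ * L) - 1) (hball _ (by
        rw [norm_smul, Real.norm_of_nonneg hc0.le, hc, div_mul_eq_mul_div, div_lt_iff₀ (by positivity)]
        nlinarith [norm_nonneg x]) _ (by linarith))
      rw [hsplit (c • x), hsplit 0 a, ← hl00] at h1
      have h2 : ((c • x, 0) : PhaseSpace n × ℝ) = c • (x, 0) := by simp
      rw [h2, map_smul, smul_eq_mul] at h1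
      have h3 : f ((0 : PhaseSpace n), (0 : ℝ)) = 0 := map_zero f
      rw [h3] at h1
      simp only [mul_zero, add_zero] at h1
      exact nonpos_of_mul_nonpos_right h1 hc0
    ext x
    · have h1 := hx0 x
      have h2 := hx0 (-x)
      have h3 : ((-x, 0) : PhaseSpace n × ℝ) = -(x, 0) := by simp
      rw [h3, map_neg] at h2
      simp only [ContinuousLinearMap.comp_apply, ContinuousLinearMap.inl_apply,
        zero_apply]
      linarith
    · simp only [ContinuousLinearMap.comp_apply, ContinuousLinearMap.inr_apply,
        zero_apply]
      rw [← hl, ← hl00]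
  set z := (InnerProductSpace.toDual ℝ (PhaseSpace n)).symm
    (f.comp (ContinuousLinearMap.inl ℝ (PhaseSpace n) ℝ)) with hz
  have hzf : ∀ y, inner ℝ z y = f (y, 0) := fun y => by
    rw [hz, InnerProductSpace.toDual_symm_apply]; rfl
  refine ⟨-(l⁻¹ • z), fun u' hu' => ?_⟩
  have h1 := hf (prim u' T, areaForm T u u') ⟨u', hu', rfl, le_rfl⟩
  rw [hsplit (prim u' T), hsplit 0 a] at h1
  have h3 : f ((0 : PhaseSpace n), (0 : ℝ)) = 0 := map_zero f
  rw [h3, ← hzf, zero_add] at h1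
  rw [inner_neg_left, real_inner_smul_left]
  have h4 : l⁻¹ * (inner ℝ z (prim u' T) + areaForm T u u' * l) ≤ l⁻¹ * (a * l) := by gcongr
  have h5 : l⁻¹ * (inner ℝ z (prim u' T) + areaForm T u u' * l)
      = l⁻¹ * inner ℝ z (prim u' T) + areaForm T u u' := by field_simp
  have h6 : l⁻¹ * (a * l) = a := by field_simp
  linarith

/-- Once the closing constraint has been absorbed into the multiplier, competitors may be altered on
arbitrary measurable sets. Replacing `u` by `ρ • k` exactly where this raises the integrand would
raise the integral unless that set is null in `(0, T]`. -/
theorem ae_mul_inner_le (hT : 0 ≤ T) (hρ : Integrable ρ) (hρ0 : ∀ t, 0 ≤ ρ t)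
    (hu : Admissible K ρ u) {w : ℝ → PhaseSpace n} (hw : Continuous w)
    (hopt : ∀ u', Admissible K ρ u' →
      ∫ t in (0 : ℝ)..T, inner ℝ (w t) (u' t) ≤ ∫ t in (0 : ℝ)..T, inner ℝ (w t) (u t))
    {k : PhaseSpace n} (hk : k ∈ polarBody K) :
    ∀ᵐ t, t ∈ Ioc 0 T → ρ t * inner ℝ (w t) k ≤ inner ℝ (w t) (u t) := by
  set g : ℝ → PhaseSpace n := fun t => ρ t • k - u t with hg
  have hgi : Integrable g := (hρ.smul_const k).sub hu.integrable
  set f : ℝ → ℝ := fun t => inner ℝ (w t) (g t) with hf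
  have hfm : AEStronglyMeasurable f := hw.aestronglyMeasurable.inner hgi.1
  set s : Set ℝ := {t | 0 < f t} with hs
  have hsm : NullMeasurableSet s := nullMeasurableSet_lt aemeasurable_const hfm.aemeasurable
  have hgs : Integrable (s.indicator g) := hgi.indicator₀ hsm
  have hadm : Admissible K ρ (fun t => u t + s.indicator g t) := by
    refine ⟨hu.integrable.fun_add hgs, ?_⟩
    filter_upwards [hu.inner_le, (Admissible.smul_const hρ hρ0 hk).inner_le] with t h1 h2 x hx
    by_cases ht : t ∈ s
    · rw [indicator_of_mem ht, hg]
      simpa using h2 x hx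
    · rw [indicator_of_notMem ht, add_zero]
      exact h1 x hx
  have h1 := hopt _ hadm
  simp only [inner_add_right] at h1
  rw [intervalIntegral.integral_add (intervalIntegrable_inner hw hu.integrable _ _)
    (intervalIntegrable_inner hw hgs _ _)] at h1
  have hnn : ∀ t, 0 ≤ inner ℝ (w t) (s.indicator g t) := by
    intro t
    by_cases ht : t ∈ s
    · rw [indicator_of_mem ht]; exact le_of_lt ht
    · rw [indicator_of_notMem ht, inner_zero_right]
  have h2 : ∫ t in (0 : ℝ)..T, inner ℝ (w t) (s.indicator g t) = 0 :=
    le_antisymm (by linarith) (intervalIntegral.integral_nonneg hT fun t _ => hnn t)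
  rw [intervalIntegral.integral_eq_zero_iff_of_le_of_nonneg_ae hT (ae_of_all _ hnn)
    (intervalIntegrable_inner hw hgs _ _)] at h2
  have h3 := (ae_restrict_iff' measurableSet_Ioc).1 h2
  filter_upwards [h3] with t ht htm
  have h4 := ht htm
  by_contra! hlt
  have hts : t ∈ s := by
    simp only [hs, hf, hg, mem_ofPred_eq, inner_sub_right, inner_smul_right]
    linarith
  rw [indicator_of_mem hts] at h4
  exact absurd h4 (ne_of_gt hts)

end multiplier

/-! ### Clarke duality -/

section Clarke

variable {K : Set (PhaseSpace n)} {ρ : ℝ → ℝ} {u : ℝ → PhaseSpace n} {T r : ℝ}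

/-- At almost every time the velocity of a translated loop of maximal area is normal to the level
set of the gauge of `K`. -/
theorem ae_inner_eq_mul_polarSupport (hT : 0 ≤ T) (hρ : Integrable ρ) (hρ0 : ∀ t, 0 ≤ ρ t)
    (hr : 0 < r) (hK : Metric.closedBall 0 r ⊆ K)
    (hu : Admissible K ρ u) {w : ℝ → PhaseSpace n} (hw : Continuous w)
    (hopt : ∀ u', Admissible K ρ u' →
      ∫ t in (0 : ℝ)..T, inner ℝ (w t) (u' t) ≤ ∫ t in (0 : ℝ)..T, inner ℝ (w t) (u t)) :
    ∀ᵐ t, t ∈ Ioc 0 T → inner ℝ (w t) (u t) = ρ t * polarSupport K (w t) := by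
  have : Nonempty (polarBody K) := ⟨⟨0, zero_mem_polarBody K⟩⟩
  -- A countable dense set of polar vectors gives one null set for all of them; the inequality then
  -- passes to the closure.
  have h1 : ∀ᵐ t, ∀ i : ℕ, t ∈ Ioc 0 T →
      ρ t * inner ℝ (w t) (TopologicalSpace.denseSeq (polarBody K) i : PhaseSpace n)
        ≤ inner ℝ (w t) (u t) :=
    ae_all_iff.2 fun i => ae_mul_inner_le hT hρ hρ0 hu hw hopt
      (TopologicalSpace.denseSeq (polarBody K) i).2
  filter_upwards [h1, hu.inner_le] with t h2 h3 ht
  refine le_antisymm (inner_le_mul_polarSupport hr hK h3 (w t)) ?_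
  obtain ⟨k, hk, hkx⟩ := exists_inner_eq_polarSupport hr hK (w t)
  rw [← hkx]
  have hclosed : IsClosed {k : polarBody K |
      ρ t * inner ℝ (w t) (k : PhaseSpace n) ≤ inner ℝ (w t) (u t)} :=
    isClosed_le (continuous_const.mul (continuous_const.inner continuous_subtype_val))
      continuous_const
  have hdense := (TopologicalSpace.denseRange_denseSeq (polarBody K)).closure_eq
  have hsub : closure (range (TopologicalSpace.denseSeq (polarBody K))) ⊆ _ :=
    closure_minimal (by rintro _ ⟨i, rfl⟩; exact h2 i ht) hclosed
  rw [hdense] at hsub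
  exact hsub (mem_univ (⟨k, hk⟩ : polarBody K))

/-- Conservation of energy for a nonsmooth Hamiltonian. With `w = J U - c` and `G` the gauge, the
function `s ↦ ρ(t) G(w s) - ⟨w s, u t⟩` is nonnegative and vanishes at `s = t`, so its derivative
there is zero. The second term contributes `⟨J u, u⟩ = 0`, hence `ρ(t) (G ∘ w)'(t) = 0`. Where `ρ(t)
= 0` the velocity vanishes, and `G` being Lipschitz gives the same conclusion. -/
theorem polarSupport_constant_of_normal (hT : 0 ≤ T) (hr : 0 < r)
    (hK : Metric.closedBall 0 r ⊆ K) (hu : Admissible K ρ u) (c : PhaseSpace n)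
    (hnormal : ∀ᵐ t, t ∈ Ioc 0 T → inner ℝ (J (prim u t) - c) (u t)
      = ρ t * polarSupport K (J (prim u t) - c)) :
    ∃ g, ∀ t ∈ Icc 0 T, polarSupport K (J (prim u t) - c) = g := by
  set w : ℝ → PhaseSpace n := fun t => J (prim u t) - c with hw
  have hL : LipschitzWith 1 (fun x : PhaseSpace n => J x - c) :=
    LipschitzWith.of_dist_le_mul fun x y => by
      rw [dist_sub_right, dist_eq_norm, ← map_sub, norm_J, dist_eq_norm]; simp
  have hLG := lipschitzWith_polarSupport hr hK
  have hac : AbsolutelyContinuousOnInterval w 0 T :=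
    hL.comp_absolutelyContinuousOnInterval (absolutelyContinuous_prim hu.integrable 0 T)
  have hacG : AbsolutelyContinuousOnInterval (fun t => polarSupport K (w t)) 0 T :=
    hLG.comp_absolutelyContinuousOnInterval hac
  rw [← uIcc_of_le hT]
  refine hacG.const_of_ae_hasDerivAt_zero ?_
  have h0 : ∀ᵐ t : ℝ, t ≠ 0 := by simp [ae_iff]
  filter_upwards [hnormal, hacG.ae_differentiableAt, ae_hasDerivAt_prim hu.integrable, hu.inner_le,
    h0] with t h1 h2 h3 h4 h5 ht
  have h6 : HasDerivAt w (J (u t)) t :=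
    ((JL : PhaseSpace n →L[ℝ] PhaseSpace n).hasFDerivAt.comp_hasDerivAt t h3).sub_const c
  have htm : t ∈ Ioc 0 T := by
    rw [uIcc_of_le hT] at ht
    exact ⟨lt_of_le_of_ne ht.1 (Ne.symm h5), ht.2⟩
  have hbound := mul_norm_le_of_inner_le hr.le hK h4
  have hρt : 0 ≤ ρ t := le_trans (by positivity) hbound
  rcases hρt.eq_or_lt with hρz | hρpos
  · have hu0 : u t = 0 := by
      rw [← hρz] at hbound
      exact norm_eq_zero.1 (le_antisymm (nonpos_of_mul_nonpos_right hbound hr) (norm_nonneg _))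
    rw [hu0, map_zero, hasDerivAt_iff_isLittleO] at h6
    rw [hasDerivAt_iff_isLittleO]
    simp only [smul_zero, sub_zero] at h6 ⊢
    refine Asymptotics.IsBigO.trans_isLittleO ?_ h6
    refine Asymptotics.IsBigO.of_bound r⁻¹ (Eventually.of_forall fun s => ?_)
    have := hLG.dist_le_mul (w s) (w t)
    rwa [Real.coe_toNNReal _ (by positivity), dist_eq_norm, dist_eq_norm] at this
  · have h7 := (h2 ht).hasDerivAt
    set d := deriv (fun t => polarSupport K (w t)) t
    have h8 : HasDerivAt (fun s => ρ t * polarSupport K (w s) - inner ℝ (w s) (u t))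
        (ρ t * d) t := by
      have h9 := (h7.const_mul (ρ t)).fun_sub (h6.inner ℝ (hasDerivAt_const t (u t)))
      have h10 : inner ℝ (J (u t)) (u t) = 0 := by
        have := inner_J_comm (u t) (u t)
        linarith
      simpa [h10] using h9
    have hmin : IsLocalMin (fun s => ρ t * polarSupport K (w s) - inner ℝ (w s) (u t)) t := by
      refine Eventually.of_forall fun s => ?_
      simp only
      rw [h1 htm, sub_self, sub_nonneg]
      exact inner_le_mul_polarSupport hr hK h4 (w s)
    have h11 := hmin.hasDerivAt_eq_zero h8
    have h12 : d = 0 := by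
      rcases mul_eq_zero.1 h11 with h | h
      · exact absurd h hρpos.ne'
      · exact h
    rwa [h12] at h7

theorem integral_inner_prim_sub {v : ℝ → PhaseSpace n} (hu : Integrable u)
    (hu' : Integrable v) (c : PhaseSpace n) :
    ∫ t in (0 : ℝ)..T, inner ℝ (J (prim u t) - c) (v t)
      = areaForm T u v - inner ℝ c (prim v T) := by
  simp only [inner_sub_left]
  rw [intervalIntegral.integral_sub (intervalIntegrable_areaForm hu hu' _ _)
    (intervalIntegrable_inner continuous_const hu' _ _)]
  congr 1
  rw [prim, intervalIntegral, intervalIntegral, inner_sub_right,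
    integral_inner hu'.integrableOn, integral_inner hu'.integrableOn]

/-- The closed characteristic obtained from a loop of constant gauge whose velocity is normal. -/
theorem isClosedCharacteristic_of_normal (hconv : Convex ℝ K) (hclosed : IsClosed K) (hT : 0 < T)
    (hρ2 : MemLp ρ 2 (volume.restrict (Icc 0 T)))
    (hr : 0 < r) (hK : Metric.closedBall 0 r ⊆ K) (hu : Admissible K ρ u)
    (h0 : prim u T = 0) (hpos : 0 < areaForm T u u) (c : PhaseSpace n) {g : ℝ} (hg : 0 < g)
    (hnormal : ∀ᵐ t, t ∈ Ioc 0 T → inner ℝ (J (prim u t) - c) (u t) = ρ t * g)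
    (hconst : ∀ t ∈ Icc 0 T, polarSupport K (J (prim u t) - c) = g) :
    IsClosedCharacteristic K T (fun t => g⁻¹ • (J (prim u t) - c)) ∧
      action T (fun t => g⁻¹ • (J (prim u t) - c)) = (1 / 2) * (g⁻¹ ^ 2 * areaForm T u u) := by
  set β : ℝ → PhaseSpace n := fun t => g⁻¹ • (J (prim u t) - c) with hβ
  have hderiv : ∀ᵐ t, HasDerivAt β (g⁻¹ • J (u t)) t := by
    filter_upwards [ae_hasDerivAt_prim hu.integrable] with t ht
    exact (((JL : PhaseSpace n →L[ℝ] PhaseSpace n).hasFDerivAt.comp_hasDerivAt t ht).sub_const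
      c).const_smul g⁻¹
  have hact : action T β = (1 / 2) * (g⁻¹ ^ 2 * areaForm T u u) := by
    have h1 : ∫ t in (0 : ℝ)..T, omega (β t) (deriv β t)
        = ∫ t in (0 : ℝ)..T, g⁻¹ ^ 2 * inner ℝ (J (prim u t) - c) (u t) := by
      refine intervalIntegral.integral_congr_ae ?_
      filter_upwards [hderiv] with t ht _
      rw [ht.deriv, omega_eq_inner, hβ]
      simp only [map_smul]
      rw [real_inner_smul_left, inner_smul_right, inner_J_J]
      ring
    rw [action, h1, intervalIntegral.integral_const_mul,
      integral_inner_prim_sub hu.integrable hu.integrable, h0, inner_zero_right, sub_zero]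
  have hL : LipschitzWith 1 (fun x : PhaseSpace n => J x - c) :=
    LipschitzWith.of_dist_le_mul fun x y => by
      rw [dist_sub_right, dist_eq_norm, ← map_sub, norm_J, dist_eq_norm]; simp
  refine ⟨⟨hT, ?_, ?_, ?_, ?_, ?_, ?_⟩, hact⟩
  · exact (hL.comp_absolutelyContinuousOnInterval
      (absolutelyContinuous_prim hu.integrable 0 T)).const_smul g⁻¹
  · refine hρ2.of_le_mul (c := g⁻¹ * r⁻¹) (measurable_deriv β).aestronglyMeasurable ?_
    refine ae_restrict_of_ae ?_
    filter_upwards [hderiv, hu.ae_norm_le hr hK] with t h1 h2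
    rw [h1.deriv, norm_smul, norm_J, Real.norm_of_nonneg (by positivity), mul_assoc]
    have : ρ t ≤ ‖ρ t‖ := le_abs_self _
    gcongr
    exact h2.trans (by gcongr)
  · simp only [hβ, prim_zero, h0]
  · intro t ht
    refine mem_frontier_of_polarSupport_eq_one hconv hclosed hr hK ?_
    have hsmul : ∀ x : PhaseSpace n, polarSupport K (g⁻¹ • x) = g⁻¹ * polarSupport K x := by
      intro x
      rw [polarSupport, polarSupport, ← smul_eq_mul, ← Real.sSup_smul_of_nonneg (by positivity)]
      congr 1
      ext a
      simp only [mem_image, mem_smul_set, real_inner_smul_left, smul_eq_mul]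
      constructor
      · rintro ⟨k, hk, rfl⟩; exact ⟨_, ⟨k, hk, rfl⟩, rfl⟩
      · rintro ⟨_, ⟨k, hk, rfl⟩, rfl⟩; exact ⟨k, hk, rfl⟩
    rw [hsmul, hconst t ht, inv_mul_cancel₀ hg.ne']
  · rw [← Measure.restrict_congr_set Ioc_ae_eq_Icc]
    refine (ae_restrict_iff' measurableSet_Ioc).2 ?_
    filter_upwards [hderiv, hnormal, hu.inner_le] with t h1 h2 h3 ht y hy
    rw [h1.deriv, map_smul, J_J, smul_neg, neg_neg, real_inner_smul_left, inner_sub_right, hβ]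
    simp only
    rw [inner_smul_right, real_inner_comm, h2 ht]
    have h4 := h3 y hy
    have h5 : g⁻¹ * (ρ t * g) = ρ t := by field_simp
    rw [h5]
    have : 0 ≤ ρ t - inner ℝ (u t) y := by linarith
    positivity
  · by_contra! hcst
    have h1 : action T β = 0 := by
      rw [action]
      have : ∫ t in (0 : ℝ)..T, omega (β t) (deriv β t) = ∫ t in (0 : ℝ)..T, (0 : ℝ) := by
        refine intervalIntegral.integral_congr_ae ?_
        have hT' : ∀ᵐ t : ℝ, t ≠ T := by simp [ae_iff]
        filter_upwards [hT'] with t htT ht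
        rw [uIoc_of_le hT.le] at ht
        have hev : β =ᶠ[𝓝 t] fun _ => β 0 := by
          filter_upwards [Ioo_mem_nhds ht.1 (lt_of_le_of_ne ht.2 htT)] with s hs
          exact hcst s (Ioo_subset_Icc_self hs)
        rw [hev.deriv_eq, deriv_const, omega_eq_inner, inner_zero_right]
      rw [this]; simp
    rw [hact] at h1
    have : 0 < (1 / 2) * (g⁻¹ ^ 2 * areaForm T u u) := by positivity
    linarith

/-- **Clarke duality**: a loop of positive area and of `K`-length density `ρ` yields a closed
characteristic satisfying the isoperimetric bound. -/
theorem exists_isClosedCharacteristic_action_le (hconv : Convex ℝ K) (hcomp : IsCompact K)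
    (hT : 0 < T) (hρ : Integrable ρ) (hρ0 : ∀ t, 0 ≤ ρ t)
    (hρ2 : MemLp ρ 2 (volume.restrict (Icc 0 T))) (hr : 0 < r) (hK : Metric.closedBall 0 r ⊆ K)
    {u₀ : ℝ → PhaseSpace n} (hu₀ : Admissible K ρ u₀) (h0 : prim u₀ T = 0)
    (hpos : 0 < areaForm T u₀ u₀) :
    ∃ β, IsClosedCharacteristic K T β ∧
      action T β * (2 * areaForm T u₀ u₀) ≤ (prim ρ T) ^ 2 := by
  obtain ⟨u, hu, huT, hmax⟩ := exists_maximal_areaForm hT.le hρ hρ0 hr hK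
  have hle := hmax u₀ hu₀ h0
  have hupos := hpos.trans_le hle
  have hL0 : 0 ≤ prim ρ T := intervalIntegral.integral_nonneg hT.le fun t _ => hρ0 t
  -- Comparison with the zero loop: zero length would force zero area.
  have hL : 0 < prim ρ T := by
    refine lt_of_le_of_ne hL0 fun hz => ?_
    obtain ⟨M, hM⟩ := isCompact_Icc.exists_bound_of_continuousOn (s := Icc 0 T)
      (continuous_prim hu.integrable).continuousOn
    have hz0 : Admissible K ρ (fun _ => 0) :=
      ⟨integrable_zero _ _ _, ae_of_all _ fun t x _ => by simpa using hρ0 t⟩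
    have := abs_areaForm_sub_le hT.le hρ hr hK hu hz0 huT (ε := M) fun t ht => by
      simpa [prim] using hM t ht
    rw [← hz, mul_zero, mul_zero] at this
    have h1 := abs_nonpos_iff.1 this
    have h2 : areaForm T (fun _ => (0 : PhaseSpace n)) (fun _ => 0) = 0 := by simp [areaForm]
    linarith
  obtain ⟨R, hR⟩ := hcomp.isBounded.subset_closedBall (0 : PhaseSpace n)
  have hKR : K ⊆ Metric.closedBall 0 (max R 1) :=
    hR.trans (Metric.closedBall_subset_closedBall (le_max_left _ _))
  obtain ⟨c, hc⟩ := exists_multiplier hT.le hρ hρ0 (by positivity) hKR hL hu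
    fun u' hu' h' => areaForm_le_of_maximal hu huT hmax hu' h'
  have hwc : Continuous fun t => J (prim u t) - c :=
    (continuous_J.comp (continuous_prim hu.integrable)).sub continuous_const
  have hopt : ∀ u', Admissible K ρ u' → ∫ t in (0 : ℝ)..T, inner ℝ (J (prim u t) - c) (u' t)
      ≤ ∫ t in (0 : ℝ)..T, inner ℝ (J (prim u t) - c) (u t) := by
    intro u' hu'
    rw [integral_inner_prim_sub hu.integrable hu'.integrable,
      integral_inner_prim_sub hu.integrable hu.integrable, huT, inner_zero_right, sub_zero]
    exact hc u' hu'
  have hnormal := ae_inner_eq_mul_polarSupport hT.le hρ hρ0 hr hK hu hwc hopt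
  obtain ⟨g, hg⟩ := polarSupport_constant_of_normal hT.le hr hK hu c hnormal
  have hnormal' : ∀ᵐ t, t ∈ Ioc 0 T → inner ℝ (J (prim u t) - c) (u t) = ρ t * g := by
    filter_upwards [hnormal] with t h1 h2
    rw [h1 h2, hg t (Ioc_subset_Icc_self h2)]
  -- Integrating the normality relation gives area form = constant gauge × length. Hence `g > 0`,
  -- and the isoperimetric bound is an equality for the maximiser itself.
  have harea : areaForm T u u = g * prim ρ T := by
    have h1 := integral_inner_prim_sub (T := T) hu.integrable hu.integrable c
    rw [huT, inner_zero_right, sub_zero] at h1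
    rw [← h1, prim, ← intervalIntegral.integral_const_mul]
    refine intervalIntegral.integral_congr_ae ?_
    filter_upwards [hnormal'] with t h2 h3
    rw [uIoc_of_le hT.le] at h3
    rw [h2 h3, mul_comm]
  have hgpos : 0 < g := by
    rw [harea] at hupos
    exact pos_of_mul_pos_left hupos hL0
  obtain ⟨hβ, hact⟩ := isClosedCharacteristic_of_normal hconv hcomp.isClosed hT hρ2 hr hK hu huT
    hupos c hgpos hnormal' hg
  refine ⟨_, hβ, ?_⟩
  have h2 : (1 / 2) * (g⁻¹ ^ 2 * areaForm T u u) = (1 / 2) * (g⁻¹ * prim ρ T) := by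
    rw [harea]; field_simp
  rw [hact, h2]
  calc (1 / 2) * (g⁻¹ * prim ρ T) * (2 * areaForm T u₀ u₀)
      = g⁻¹ * prim ρ T * areaForm T u₀ u₀ := by ring
    _ ≤ g⁻¹ * prim ρ T * (g * prim ρ T) := by rw [← harea]; gcongr
    _ = prim ρ T ^ 2 := by field_simp

end Clarke

/-! ### The second variation of an action-minimizing closed characteristic -/

/-- The function `-J γ'` on `[0, T]`, extended by zero. -/
noncomputable def normalVelocity (T : ℝ) (γ : ℝ → PhaseSpace n) : ℝ → PhaseSpace n :=
  (Icc 0 T).indicator fun t => -J (deriv γ t)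

section minimizing

variable {K : Set (PhaseSpace n)} {T r : ℝ} {γ : ℝ → PhaseSpace n}

theorem normalVelocity_of_mem {t : ℝ} (ht : t ∈ Icc 0 T) :
    normalVelocity T γ t = -J (deriv γ t) := indicator_of_mem ht _

theorem normalVelocity_of_notMem {t : ℝ} (ht : t ∉ Icc 0 T) : normalVelocity T γ t = 0 :=
  indicator_of_notMem ht _

theorem measurable_normalVelocity (T : ℝ) (γ : ℝ → PhaseSpace n) :
    Measurable (normalVelocity T γ) :=
  ((continuous_J.measurable.comp (measurable_deriv γ)).neg).indicator measurableSet_Icc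

theorem IsClosedCharacteristic.continuousOn (h : IsClosedCharacteristic K T γ) :
    ContinuousOn γ (Icc 0 T) := by
  have := h.absolutelyContinuous.continuousOn
  rwa [uIcc_of_le h.period_pos.le] at this

theorem IsClosedCharacteristic.memLp_normalVelocity (h : IsClosedCharacteristic K T γ) :
    MemLp (normalVelocity T γ) 2 (volume.restrict (Icc 0 T)) := by
  refine h.deriv_memLp.of_le (measurable_normalVelocity T γ).aestronglyMeasurable ?_
  refine ae_of_all _ fun t => ?_
  by_cases ht : t ∈ Icc 0 T
  · rw [normalVelocity_of_mem ht, norm_neg, norm_J]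
  · rw [normalVelocity_of_notMem ht, norm_zero]; exact norm_nonneg _

theorem integrable_of_memLp_Icc {F : Type*} [NormedAddCommGroup F] {f : ℝ → F}
    (hf : MemLp f 2 (volume.restrict (Icc 0 T))) (h0 : ∀ t, t ∉ Icc 0 T → f t = 0) :
    Integrable f := by
  have h1 : IntegrableOn f (Icc 0 T) := hf.integrable (by norm_num)
  exact h1.integrable_of_forall_notMem_eq_zero h0

theorem IsClosedCharacteristic.integrable_normalVelocity (h : IsClosedCharacteristic K T γ) :
    Integrable (normalVelocity T γ) :=
  integrable_of_memLp_Icc h.memLp_normalVelocity fun _ ht => normalVelocity_of_notMem ht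

theorem IsClosedCharacteristic.J_prim_normalVelocity (h : IsClosedCharacteristic K T γ) {t : ℝ}
    (ht : t ∈ Icc 0 T) : J (prim (normalVelocity T γ) t) = γ t - γ 0 := by
  have hT := h.period_pos.le
  set v := normalVelocity T γ with hvdef
  have hv := h.integrable_normalVelocity
  have hJv : Integrable fun t => J (v t) :=
    (JL : PhaseSpace n →L[ℝ] PhaseSpace n).integrable_comp hv
  have hprim : ∀ t, prim (fun s => J (v s)) t = J (prim v t) := fun t =>
    (JL : PhaseSpace n →L[ℝ] PhaseSpace n).intervalIntegral_comp_comm hv.intervalIntegrable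
  have hd : ∀ᵐ t, t ∈ uIcc 0 T → HasDerivAt γ (J (v t)) t := by
    filter_upwards [h.absolutelyContinuous.boundedVariationOn.ae_differentiableAt_of_mem_uIcc]
      with t h1 h2
    have h3 := (h1 h2).hasDerivAt
    rw [uIcc_of_le hT] at h2
    rw [hvdef, normalVelocity_of_mem h2, map_neg, J_J, neg_neg]
    exact h3
  have := h.absolutelyContinuous.eq_add_integral hJv.intervalIntegrable
    (absolutelyContinuous_prim hJv 0 T) hd (by rwa [uIcc_of_le hT])
  rw [← hprim, eq_sub_iff_add_eq, add_comm]
  exact this.symm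

theorem IsClosedCharacteristic.prim_normalVelocity (h : IsClosedCharacteristic K T γ) :
    prim (normalVelocity T γ) T = 0 := by
  have h1 := h.J_prim_normalVelocity (t := T) ⟨h.period_pos.le, le_rfl⟩
  rw [← h.closed, sub_self] at h1
  rw [← norm_eq_zero, ← norm_J, h1, norm_zero]

theorem IsClosedCharacteristic.integrableOn_inner (h : IsClosedCharacteristic K T γ)
    {δ : ℝ → PhaseSpace n} (hδ : Integrable δ) :
    IntegrableOn (fun t => inner ℝ (γ t) (δ t)) (Icc 0 T) := by
  obtain ⟨C, hC⟩ := isCompact_Icc.exists_bound_of_continuousOn h.continuousOn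
  exact integrable_inner_of_bounded measurableSet_Icc
    (h.continuousOn.aestronglyMeasurable measurableSet_Icc) hC hδ.integrableOn

theorem IsClosedCharacteristic.intervalIntegrable_inner (h : IsClosedCharacteristic K T γ)
    {δ : ℝ → PhaseSpace n} (hδ : Integrable δ) :
    IntervalIntegrable (fun t => inner ℝ (γ t) (δ t)) volume 0 T :=
  (intervalIntegrable_iff_integrableOn_Icc_of_le h.period_pos.le).2 (h.integrableOn_inner hδ)

/-- The primitive of the velocity is `γ - γ 0`; the constant `γ 0` pairs to zero with a `δ` that
closes up. -/
theorem IsClosedCharacteristic.areaForm_normalVelocity (h : IsClosedCharacteristic K T γ)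
    {δ : ℝ → PhaseSpace n} (hδ : Integrable δ) (hδT : prim δ T = 0) :
    areaForm T (normalVelocity T γ) δ = ∫ t in (0 : ℝ)..T, inner ℝ (γ t) (δ t) := by
  have h1 := integral_inner_prim_sub (T := T) h.integrable_normalVelocity hδ (-γ 0)
  rw [hδT, inner_zero_right, sub_zero] at h1
  rw [← h1]
  refine intervalIntegral.integral_congr fun t ht => ?_
  rw [uIcc_of_le h.period_pos.le] at ht
  rw [h.J_prim_normalVelocity ht, sub_neg_eq_add, sub_add_cancel]

theorem IsClosedCharacteristic.two_mul_action (h : IsClosedCharacteristic K T γ) :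
    2 * action T γ = ∫ t in (0 : ℝ)..T, inner ℝ (γ t) (normalVelocity T γ t) := by
  rw [action, ← mul_assoc]
  norm_num
  refine intervalIntegral.integral_congr fun t ht => ?_
  rw [uIcc_of_le h.period_pos.le] at ht
  rw [normalVelocity_of_mem ht, omega_eq_inner, inner_J_left, inner_neg_right]

/-- Twice the action is `∫ ⟨γ, v⟩`, and normality together with the ball inside `K` gives `⟨γ, v⟩ ≥
r ‖v‖`. Zero action would make `γ` constant. -/
theorem IsClosedCharacteristic.action_pos (h : IsClosedCharacteristic K T γ) (hr : 0 < r)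
    (hK : Metric.closedBall 0 r ⊆ K) : 0 < action T γ := by
  set v := normalVelocity T γ with hv
  have hT := h.period_pos.le
  have hvel := (ae_restrict_iff' measurableSet_Icc).1 h.velocity
  have hbd : ∀ᵐ t, t ∈ Ioc 0 T → r * ‖v t‖ ≤ inner ℝ (γ t) (v t) := by
    filter_upwards [hvel] with t h1 h2
    have h2' := Ioc_subset_Icc_self h2
    have h3 := h1 h2'
    rw [hv, normalVelocity_of_mem h2', real_inner_comm]
    refine mul_norm_le_of_inner_le hr.le hK fun x hx => ?_
    have := h3 x hx
    rw [inner_sub_right] at this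
    linarith
  have hnn : 0 ≤ᵐ[volume.restrict (Ioc 0 T)] fun t => inner ℝ (γ t) (v t) := by
    refine (ae_restrict_iff' measurableSet_Ioc).2 ?_
    filter_upwards [hbd] with t h1 h2
    exact le_trans (by positivity) (h1 h2)
  have hint := h.intervalIntegrable_inner h.integrable_normalVelocity
  have h2 := h.two_mul_action
  have h3 : 0 ≤ ∫ t in (0 : ℝ)..T, inner ℝ (γ t) (v t) :=
    intervalIntegral.integral_nonneg_of_ae_restrict hT
      (by rw [← Measure.restrict_congr_set Ioc_ae_eq_Icc]; exact hnn)
  refine lt_of_le_of_ne (by linarith) fun hz => ?_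
  rw [← hz, mul_zero] at h2
  have h4 := (intervalIntegral.integral_eq_zero_iff_of_le_of_nonneg_ae hT hnn hint).1 h2.symm
  have h5 := (ae_restrict_iff' measurableSet_Ioc).1 h4
  obtain ⟨t, ht, hne⟩ := h.nonconstant
  apply hne
  rw [← sub_eq_zero, ← h.J_prim_normalVelocity ht, prim]
  have : ∫ s in (0 : ℝ)..t, v s = ∫ s in (0 : ℝ)..t, (0 : PhaseSpace n) := by
    refine intervalIntegral.integral_congr_ae ?_
    filter_upwards [h5, hbd] with s h6 h7 hs
    rw [uIoc_of_le ht.1] at hs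
    have hs' : s ∈ Ioc 0 T := ⟨hs.1, hs.2.trans ht.2⟩
    have h8 := h7 hs'
    rw [h6 hs'] at h8
    exact norm_eq_zero.1 (le_antisymm (nonpos_of_mul_nonpos_right h8 hr) (norm_nonneg _))
  rw [this]; simp

/-- A variation of the velocity of an action-minimizing closed characteristic within the normal
cones which preserves closedness and length does not increase the area. -/
theorem IsActionMinimizing.areaForm_nonpos (hγ : IsActionMinimizing K T γ) (hconv : Convex ℝ K)
    (hcomp : IsCompact K) (hr : 0 < r) (hK : Metric.closedBall 0 r ⊆ K) {δ : ℝ → PhaseSpace n}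
    (hδ2 : MemLp δ 2 (volume.restrict (Icc 0 T))) (hδ0 : ∀ t, t ∉ Icc 0 T → δ t = 0)
    (hδN : ∀ᵐ t, t ∈ Icc 0 T → normalVelocity T γ t + δ t ∈ normalCone K (γ t))
    (hδT : prim δ T = 0) (hδγ : ∫ t in (0 : ℝ)..T, inner ℝ (γ t) (δ t) = 0) :
    areaForm T δ δ ≤ 0 := by
  have h := hγ.1
  have hT := h.period_pos
  set v := normalVelocity T γ with hv
  have hvi := h.integrable_normalVelocity
  have hδi : Integrable δ := integrable_of_memLp_Icc hδ2 hδ0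
  set a := ∫ t in (0 : ℝ)..T, inner ℝ (γ t) (v t) with ha
  have haction : 2 * action T γ = a := h.two_mul_action
  have hapos : 0 < a := by
    have := h.action_pos hr hK
    linarith
  set u₀ : ℝ → PhaseSpace n := fun t => v t + δ t with hu₀
  have hu₀i : Integrable u₀ := hvi.fun_add hδi
  have hu₀T : prim u₀ T = 0 := by
    rw [hu₀, prim_add hvi hδi, h.prim_normalVelocity, hδT, add_zero]
  -- The cross terms both equal `∫ ⟨γ, δ⟩`, which vanishes by the length constraint.
  have harea : areaForm T u₀ u₀ = a + areaForm T δ δ := by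
    rw [hu₀, areaForm_add_left hvi hδi hu₀i, areaForm_add_right hvi hvi hδi,
      areaForm_add_right hδi hvi hδi, ← areaForm_comm hvi hδi h.prim_normalVelocity,
      h.areaForm_normalVelocity hδi hδT, hδγ, h.areaForm_normalVelocity hvi h.prim_normalVelocity]
    ring
  by_contra! hQ
  -- As `v + δ` is normal to `K` at `γ t`, this is almost everywhere the support function of `K` at
  -- `u₀ t`. The absolute value only ensures nonnegativity at every time.
  set ρ : ℝ → ℝ := (Icc 0 T).indicator fun t => |inner ℝ (γ t) (u₀ t)| with hρ
  have hρ0 : ∀ t, 0 ≤ ρ t := fun t => indicator_nonneg (fun _ _ => abs_nonneg _) t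
  have hu₀2 : MemLp u₀ 2 (volume.restrict (Icc 0 T)) := h.memLp_normalVelocity.add hδ2
  obtain ⟨C, hC⟩ := isCompact_Icc.exists_bound_of_continuousOn h.continuousOn
  have hρ2 : MemLp ρ 2 (volume.restrict (Icc 0 T)) := by
    refine hu₀2.of_le_mul (c := C) ?_ ?_
    · exact ((h.integrableOn_inner hu₀i).1.norm).indicator measurableSet_Icc
    · refine (ae_restrict_iff' measurableSet_Icc).2 (ae_of_all _ fun t ht => ?_)
      rw [hρ, indicator_of_mem ht, Real.norm_eq_abs, abs_abs]
      exact (abs_real_inner_le_norm _ _).trans (by gcongr; exact hC t ht)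
  have hρi : Integrable ρ := integrable_of_memLp_Icc hρ2 fun t ht => indicator_of_notMem ht _
  have hle : ∀ᵐ t, t ∈ Icc 0 T → ∀ x ∈ K, inner ℝ (u₀ t) x ≤ inner ℝ (γ t) (u₀ t) := by
    filter_upwards [hδN] with t h1 h2 x hx
    have := h1 h2 x hx
    rw [inner_sub_right, real_inner_comm] at this
    linarith
  have hadm : Admissible K ρ u₀ := by
    refine ⟨hu₀i, ?_⟩
    filter_upwards [hle] with t h1 x hx
    by_cases ht : t ∈ Icc 0 T
    · rw [hρ, indicator_of_mem ht]
      exact (h1 ht x hx).trans (le_abs_self _)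
    · rw [hu₀]
      simp only
      rw [hδ0 t ht, hv, normalVelocity_of_notMem ht, add_zero, inner_zero_left]
      exact hρ0 t
  have hlen : prim ρ T = a := by
    have h1 : prim ρ T = ∫ t in (0 : ℝ)..T, inner ℝ (γ t) (u₀ t) := by
      refine intervalIntegral.integral_congr_ae ?_
      filter_upwards [hle] with t h1 ht
      rw [uIoc_of_le hT.le] at ht
      have ht' := Ioc_subset_Icc_self ht
      have h2 := h1 ht' 0 (hK (by simp [hr.le]))
      rw [inner_zero_right] at h2
      rw [hρ, indicator_of_mem ht', abs_of_nonneg h2]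
    rw [h1]
    simp only [hu₀, inner_add_right]
    rw [intervalIntegral.integral_add (h.intervalIntegrable_inner hvi)
      (h.intervalIntegrable_inner hδi), hδγ, add_zero]
  obtain ⟨β, hβ, hle2⟩ := exists_isClosedCharacteristic_action_le hconv hcomp hT hρi hρ0 hρ2 hr hK
    hadm hu₀T (by rw [harea]; linarith)
  have hmin := hγ.2 T β hβ
  rw [harea, hlen] at hle2
  -- Since `2 * action T γ = a > 0`, this reads `a (a + Q) ≤ a²`, against `Q > 0`.
  have h1 : action T γ * (2 * (a + areaForm T δ δ)) ≤ a ^ 2 :=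
    le_trans (by gcongr) hle2
  nlinarith

end minimizing

/-! ### Small loops -/

section loops

variable {T τ h : ℝ}

theorem integral_indicator_Ioc {F : Type*} [NormedAddCommGroup F] [NormedSpace ℝ F] {f : ℝ → F}
    {a b c : ℝ} (ha : 0 ≤ a) (hab : a ≤ b) (hbc : b ≤ c) :
    ∫ t in (0 : ℝ)..c, (Ioc a b).indicator f t = ∫ t in a..b, f t := by
  rw [intervalIntegral.integral_of_le (ha.trans (hab.trans hbc)), setIntegral_indicator
    measurableSet_Ioc, inter_eq_right.2 (Ioc_subset_Ioc ha hbc),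
    intervalIntegral.integral_of_le hab]

theorem abs_areaForm_le {x y : ℝ → PhaseSpace n} (hT : 0 ≤ T) (hx : Integrable x)
    (hy : Integrable y) :
    |areaForm T x y| ≤ prim (fun t => ‖x t‖) T * prim (fun t => ‖y t‖) T := by
  rw [areaForm, ← Real.norm_eq_abs]
  refine (intervalIntegral.norm_integral_le_of_norm_le hT
    (g := fun t => prim (fun t => ‖x t‖) T * ‖y t‖) (ae_of_all _ fun t ht => ?_)
    (hy.norm.const_mul _).intervalIntegrable).trans (le_of_eq ?_)
  · refine (norm_inner_le_norm _ _).trans ?_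
    rw [norm_J]
    gcongr
    have h1 := norm_prim_sub_le hx hx.norm ht.1.le (ae_of_all _ fun _ _ => le_rfl)
    rw [prim_zero, prim_zero, sub_zero, sub_zero] at h1
    refine h1.trans ?_
    rw [← sub_nonneg, prim_sub_prim hx.norm]
    exact intervalIntegral.integral_nonneg ht.2 fun _ _ => norm_nonneg _
  · rw [intervalIntegral.integral_const_mul]; rfl

/-- The derivative of the even profile `x (h - x) / h` with `x = t - τ`. -/
noncomputable def evenSpeed (τ h t : ℝ) : ℝ := (h - 2 * (t - τ)) / h

/-- The derivative of the odd profile `x (h - x) (h - 2 x) / h²` with `x = t - τ`. -/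
noncomputable def oddSpeed (τ h t : ℝ) : ℝ := (h ^ 2 - 6 * (t - τ) * h + 6 * (t - τ) ^ 2) / h ^ 2

theorem abs_evenSpeed_le {t : ℝ} (hh : 0 < h) (ht : t ∈ Icc τ (τ + h)) :
    |evenSpeed τ h t| ≤ 1 := by
  rw [evenSpeed, abs_div, abs_of_pos hh, div_le_one hh, abs_le]
  constructor <;> linarith [ht.1, ht.2]

theorem abs_oddSpeed_le {t : ℝ} (hh : 0 < h) (ht : t ∈ Icc τ (τ + h)) :
    |oddSpeed τ h t| ≤ 1 := by
  have h1 : 0 ≤ (t - τ) * (h - (t - τ)) :=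
    mul_nonneg (by linarith [ht.1]) (by linarith [ht.2])
  rw [oddSpeed, abs_div, abs_of_pos (by positivity : (0 : ℝ) < h ^ 2), div_le_one (by positivity),
    abs_le]
  constructor
  · nlinarith [sq_nonneg (h - 2 * (t - τ))]
  · nlinarith

theorem continuous_evenSpeed (τ h : ℝ) : Continuous (evenSpeed τ h) := by
  unfold evenSpeed; fun_prop

theorem continuous_oddSpeed (τ h : ℝ) : Continuous (oddSpeed τ h) := by
  unfold oddSpeed; fun_prop

theorem hasDerivAt_evenProfile (τ h t : ℝ) :
    HasDerivAt (fun t => (t - τ) * (h - (t - τ)) / h) (evenSpeed τ h t) t := by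
  have h1 : HasDerivAt (fun t => t - τ) 1 t := (hasDerivAt_id t).sub_const τ
  have h2 := (h1.fun_mul (h1.const_sub h)).div_const h
  convert! h2 using 1
  rw [evenSpeed]; ring

theorem hasDerivAt_oddProfile (τ h t : ℝ) :
    HasDerivAt (fun t => (t - τ) * (h - (t - τ)) * (h - 2 * (t - τ)) / h ^ 2)
      (oddSpeed τ h t) t := by
  have h1 : HasDerivAt (fun t => t - τ) 1 t := (hasDerivAt_id t).sub_const τ
  have h2 := ((h1.fun_mul (h1.const_sub h)).fun_mul ((h1.const_mul 2).const_sub h)).div_const (h ^ 2)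
  convert! h2 using 1
  rw [oddSpeed]; ring

/-- The velocity of a small loop in the directions `p`, `q` over the interval `(τ, τ + h]`. -/
noncomputable def loopVelocity (τ h : ℝ) (p q : ℝ → PhaseSpace n) : ℝ → PhaseSpace n :=
  (Ioc τ (τ + h)).indicator fun t => evenSpeed τ h t • p t + oddSpeed τ h t • q t

theorem norm_loopVelocity_le (hh : 0 < h) (p q : ℝ → PhaseSpace n) (t : ℝ) :
    ‖loopVelocity τ h p q t‖ ≤ (Ioc τ (τ + h)).indicator (fun t => ‖p t‖ + ‖q t‖) t := by
  by_cases ht : t ∈ Ioc τ (τ + h)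
  · rw [loopVelocity, indicator_of_mem ht, indicator_of_mem ht]
    refine (norm_add_le _ _).trans ?_
    rw [norm_smul, norm_smul]
    have h1 := abs_evenSpeed_le hh (Ioc_subset_Icc_self ht)
    have h2 := abs_oddSpeed_le hh (Ioc_subset_Icc_self ht)
    exact add_le_add (mul_le_of_le_one_left (norm_nonneg _) h1)
      (mul_le_of_le_one_left (norm_nonneg _) h2)
  · rw [loopVelocity, indicator_of_notMem ht, indicator_of_notMem ht, norm_zero]

theorem aestronglyMeasurable_loopVelocity {p q : ℝ → PhaseSpace n} (hp : AEStronglyMeasurable p)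
    (hq : AEStronglyMeasurable q) : AEStronglyMeasurable (loopVelocity τ h p q) :=
  (((continuous_evenSpeed τ h).aestronglyMeasurable.smul hp).add
    ((continuous_oddSpeed τ h).aestronglyMeasurable.smul hq)).indicator measurableSet_Ioc

theorem integrableOn_norm_add_norm {F : Type*} [NormedAddCommGroup F] {p q : ℝ → F}
    (hp : LocallyIntegrable p) (hq : LocallyIntegrable q) (a b : ℝ) :
    IntegrableOn (fun t => ‖p t‖ + ‖q t‖) (Icc a b) :=
  (hp.integrableOn_isCompact isCompact_Icc).norm.add
    (hq.integrableOn_isCompact isCompact_Icc).norm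

theorem integrable_loopVelocity (hh : 0 < h) {p q : ℝ → PhaseSpace n}
    (hp : LocallyIntegrable p) (hq : LocallyIntegrable q) :
    Integrable (loopVelocity τ h p q) := by
  have hi := (integrableOn_norm_add_norm hp hq τ (τ + h)).mono_set Ioc_subset_Icc_self
  exact ((integrable_indicator_iff measurableSet_Ioc).2 hi).mono'
    (aestronglyMeasurable_loopVelocity hp.aestronglyMeasurable hq.aestronglyMeasurable)
    (ae_of_all _ (norm_loopVelocity_le hh p q))

theorem prim_norm_loopVelocity_le (hh : 0 < h) (hτ : 0 ≤ τ) (hτT : τ + h ≤ T)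
    {p q : ℝ → PhaseSpace n} (hp : LocallyIntegrable p) (hq : LocallyIntegrable q) :
    prim (fun t => ‖loopVelocity τ h p q t‖) T ≤ ∫ t in τ..(τ + h), (‖p t‖ + ‖q t‖) := by
  rw [← integral_indicator_Ioc hτ (by linarith) hτT]
  have hi := (integrableOn_norm_add_norm hp hq τ (τ + h)).mono_set Ioc_subset_Icc_self
  exact intervalIntegral.integral_mono (by linarith)
    (integrable_loopVelocity hh hp hq).norm.intervalIntegrable
    ((integrable_indicator_iff measurableSet_Ioc).2 hi).intervalIntegrable
    (norm_loopVelocity_le hh p q)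

theorem loopVelocity_sub (τ h : ℝ) (p q p' q' : ℝ → PhaseSpace n) (t : ℝ) :
    loopVelocity τ h p q t = loopVelocity τ h p' q' t +
      loopVelocity τ h (fun t => p t - p' t) (fun t => q t - q' t) t := by
  by_cases ht : t ∈ Ioc τ (τ + h)
  · simp only [loopVelocity, indicator_of_mem ht]
    rw [smul_sub, smul_sub]; abel
  · simp only [loopVelocity, indicator_of_notMem ht, add_zero]

theorem integral_loopSpeed (τ h : ℝ) (P Q : PhaseSpace n) (t : ℝ) :
    ∫ s in τ..t, (evenSpeed τ h s • P + oddSpeed τ h s • Q) =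
      ((t - τ) * (h - (t - τ)) / h) • P +
        ((t - τ) * (h - (t - τ)) * (h - 2 * (t - τ)) / h ^ 2) • Q := by
  rw [intervalIntegral.integral_eq_sub_of_hasDerivAt (f := fun t =>
      ((t - τ) * (h - (t - τ)) / h) • P +
        ((t - τ) * (h - (t - τ)) * (h - 2 * (t - τ)) / h ^ 2) • Q)
    (fun s _ => ((hasDerivAt_evenProfile τ h s).smul_const P).fun_add
      ((hasDerivAt_oddProfile τ h s).smul_const Q))]
  · simp
  · exact (((continuous_evenSpeed τ h).smul continuous_const).add
      ((continuous_oddSpeed τ h).smul continuous_const)).intervalIntegrable _ _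

theorem prim_loopVelocity_const_of_mem (hτ : 0 ≤ τ) (P Q : PhaseSpace n) {t : ℝ}
    (ht : t ∈ Icc τ (τ + h)) :
    prim (loopVelocity τ h (fun _ => P) fun _ => Q) t =
      ((t - τ) * (h - (t - τ)) / h) • P +
        ((t - τ) * (h - (t - τ)) * (h - 2 * (t - τ)) / h ^ 2) • Q := by
  rw [← integral_loopSpeed, ← integral_indicator_Ioc hτ ht.1 le_rfl]
  refine intervalIntegral.integral_congr fun s hs => ?_
  rw [uIcc_of_le (hτ.trans ht.1)] at hs
  simp only [loopVelocity, indicator, mem_Ioc]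
  have : s ≤ τ + h := hs.2.trans ht.2
  simp [this, hs.2]

theorem prim_loopVelocity_const (hh : 0 < h) (hτ : 0 ≤ τ) (hτT : τ + h ≤ T) (P Q : PhaseSpace n) :
    prim (loopVelocity τ h (fun _ => P) fun _ => Q) T = 0 := by
  rw [prim, loopVelocity, integral_indicator_Ioc hτ (by linarith) hτT, integral_loopSpeed]
  simp

/-- The integrand is `ω(P, Q)` times the Wronskian of the even and odd profiles. As their quotient
is the affine function `(h - 2x) / h`, the Wronskian is `-2 x² (h - x)² / h³`, of constant sign. -/
theorem areaForm_loopVelocity_const (hh : 0 < h) (hτ : 0 ≤ τ) (hτT : τ + h ≤ T)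
    (P Q : PhaseSpace n) :
    areaForm T (loopVelocity τ h (fun _ => P) fun _ => Q) (loopVelocity τ h (fun _ => P) fun _ => Q)
      = -(h ^ 2 / 15) * omega P Q := by
  have h1 : areaForm T (loopVelocity τ h (fun _ => P) fun _ => Q)
      (loopVelocity τ h (fun _ => P) fun _ => Q) =
      ∫ t in (0 : ℝ)..T, (Ioc τ (τ + h)).indicator (fun t =>
        -(2 / h ^ 3) * ((t - τ) ^ 2 * (h - (t - τ)) ^ 2) * omega P Q) t := by
    refine intervalIntegral.integral_congr fun t _ => ?_
    by_cases ht : t ∈ Ioc τ (τ + h)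
    · simp only [prim_loopVelocity_const_of_mem hτ P Q (Ioc_subset_Icc_self ht), indicator_of_mem ht]
      rw [loopVelocity, indicator_of_mem ht]
      have hPP : inner ℝ (J P) P = 0 := by have := inner_J_comm P P; linarith
      have hQQ : inner ℝ (J Q) Q = 0 := by have := inner_J_comm Q Q; linarith
      simp only [map_add, map_smul, inner_add_left, inner_add_right, real_inner_smul_left,
        inner_smul_right, hPP, hQQ, inner_J_comm Q P, omega_eq_inner, evenSpeed, oddSpeed]
      field_simp
      ring
    · simp only [indicator_of_notMem ht]
      rw [loopVelocity, indicator_of_notMem ht, inner_zero_right]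
  rw [h1, integral_indicator_Ioc hτ (by linarith) hτT, intervalIntegral.integral_mul_const,
    intervalIntegral.integral_const_mul]
  have h2 : ∫ t in τ..(τ + h), (t - τ) ^ 2 * (h - (t - τ)) ^ 2 = h ^ 5 / 30 := by
    rw [intervalIntegral.integral_comp_sub_right (fun x => x ^ 2 * (h - x) ^ 2)]
    have : (fun x : ℝ => x ^ 2 * (h - x) ^ 2)
        = fun x => h ^ 2 * x ^ 2 - 2 * h * x ^ 3 + x ^ 4 := by ext x; ring
    rw [this, intervalIntegral.integral_add, intervalIntegral.integral_sub,
      intervalIntegral.integral_const_mul, intervalIntegral.integral_const_mul, integral_pow,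
      integral_pow, integral_pow]
    · norm_num; ring
    all_goals exact Continuous.intervalIntegrable (by fun_prop) _ _
  rw [h2]
  field_simp
  ring

/-- Quantitative closedness and area of a small loop in slowly varying directions. -/
theorem loopVelocity_estimates (hh : 0 < h) (hτ : 0 ≤ τ) (hτT : τ + h ≤ T)
    {p q : ℝ → PhaseSpace n} (hp : LocallyIntegrable p) (hq : LocallyIntegrable q) {C κ : ℝ}
    (hpC : ∀ t, ‖p t‖ ≤ C) (hqC : ∀ t, ‖q t‖ ≤ C)
    (hκ : ∫ t in τ..(τ + h), (‖p t - p τ‖ + ‖q t - q τ‖) ≤ κ * h) :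
    ‖prim (loopVelocity τ h p q) T‖ ≤ κ * h ∧
      -(h ^ 2 / 15) * omega (p τ) (q τ) - 4 * C * κ * h ^ 2 ≤
        areaForm T (loopVelocity τ h p q) (loopVelocity τ h p q) := by
  have hT : 0 ≤ T := by linarith
  set δ := loopVelocity τ h p q with hδ
  set δ₀ := loopVelocity τ h (fun _ => p τ) (fun _ => q τ) with hδ₀
  set e := loopVelocity τ h (fun t => p t - p τ) (fun t => q t - q τ) with he
  have hcp : LocallyIntegrable fun _ : ℝ => p τ := continuous_const.locallyIntegrable
  have hcq : LocallyIntegrable fun _ : ℝ => q τ := continuous_const.locallyIntegrable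
  have hsum : δ = fun t => δ₀ t + e t := funext fun t => loopVelocity_sub τ h p q _ _ t
  have hδi : Integrable δ := integrable_loopVelocity hh hp hq
  have hδ₀i : Integrable δ₀ := integrable_loopVelocity hh hcp hcq
  have hei : Integrable e := integrable_loopVelocity hh (hp.sub hcp) (hq.sub hcq)
  have hNe : prim (fun t => ‖e t‖) T ≤ κ * h :=
    (prim_norm_loopVelocity_le hh hτ hτT (hp.sub hcp) (hq.sub hcq)).trans hκ
  have hN : ∀ {x y : ℝ → PhaseSpace n}, LocallyIntegrable x → LocallyIntegrable y →
      (∀ t, ‖x t‖ ≤ C) → (∀ t, ‖y t‖ ≤ C) →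
      prim (fun t => ‖loopVelocity τ h x y t‖) T ≤ 2 * C * h := by
    intro x y hx hy hxC hyC
    refine (prim_norm_loopVelocity_le hh hτ hτT hx hy).trans ?_
    have h1 : ∫ t in τ..(τ + h), (‖x t‖ + ‖y t‖) ≤ ∫ t in τ..(τ + h), (2 * C) := by
      refine intervalIntegral.integral_mono (by linarith) ?_ (by simp) fun t => ?_
      · exact (intervalIntegrable_iff_integrableOn_Icc_of_le (by linarith)).2
          (integrableOn_norm_add_norm hx hy _ _)
      · have := hxC t; have := hyC t
        simp only; linarith
    refine h1.trans (le_of_eq ?_)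
    simp; ring
  have hNδ : prim (fun t => ‖δ t‖) T ≤ 2 * C * h := hN hp hq hpC hqC
  have hNδ₀ : prim (fun t => ‖δ₀ t‖) T ≤ 2 * C * h :=
    hN hcp hcq (fun _ => hpC τ) (fun _ => hqC τ)
  have hnn : ∀ x : ℝ → PhaseSpace n, 0 ≤ prim (fun t => ‖x t‖) T := fun x =>
    intervalIntegral.integral_nonneg hT fun _ _ => norm_nonneg _
  refine ⟨?_, ?_⟩
  · rw [hsum, prim_add hδ₀i hei, prim_loopVelocity_const hh hτ hτT, zero_add]
    have h1 := norm_prim_sub_le hei hei.norm hT (ae_of_all _ fun _ _ => le_rfl)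
    rw [prim_zero, prim_zero, sub_zero, sub_zero] at h1
    exact h1.trans hNe
  -- `δ₀` is the loop with directions frozen at `τ`. Each error term is at most `2Ch · κh`, the
  -- product of the `L¹` norms.
  · have hexp : areaForm T δ δ = areaForm T δ₀ δ₀ + areaForm T δ₀ e + areaForm T e δ := by
      conv_lhs => rw [show areaForm T δ δ = areaForm T (fun t => δ₀ t + e t) δ by rw [← hsum]]
      rw [areaForm_add_left hδ₀i hei hδi]
      conv_lhs => rw [show areaForm T δ₀ δ = areaForm T δ₀ (fun t => δ₀ t + e t) by rw [← hsum]]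
      rw [areaForm_add_right hδ₀i hδ₀i hei]
    rw [hexp, areaForm_loopVelocity_const hh hτ hτT]
    have h1 := (abs_le.1 ((abs_areaForm_le hT hδ₀i hei).trans
      (mul_le_mul hNδ₀ hNe (hnn e) ((hnn δ₀).trans hNδ₀)))).1
    have h2 := (abs_le.1 ((abs_areaForm_le hT hei hδi).trans
      (mul_le_mul hNe hNδ (hnn δ) ((hnn e).trans hNe)))).1
    nlinarith

/-- Lebesgue differentiation along the one-sided intervals on which the small loops live. -/
theorem ae_eventually_integral_norm_sub_le {F : Type*} [NormedAddCommGroup F] {p : ℝ → F}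
    (hp : LocallyIntegrable p) : ∀ᵐ τ, ∀ κ > 0, ∀ᶠ h in 𝓝[>] (0 : ℝ),
      ∫ t in τ..(τ + h), ‖p t - p τ‖ ≤ κ * h := by
  filter_upwards [(IsUnifLocDoublingMeasure.vitaliFamily volume 1).ae_tendsto_average_norm_sub hp]
    with τ hτ κ hκ
  have h1 := hτ.comp τ.tendsto_Icc_vitaliFamily_right
  have h2 : Tendsto (fun h => τ + h) (𝓝[>] (0 : ℝ)) (𝓝[>] τ) := by
    refine tendsto_nhdsWithin_iff.2 ⟨?_, ?_⟩
    · have : Tendsto (fun h => τ + h) (𝓝 (0 : ℝ)) (𝓝 (τ + 0)) :=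
        (continuous_const.add continuous_id).tendsto 0
      rw [add_zero] at this
      exact this.mono_left nhdsWithin_le_nhds
    · filter_upwards [self_mem_nhdsWithin] with h hh
      simpa using hh
  filter_upwards [(h1.comp h2).eventually_le_const hκ, self_mem_nhdsWithin] with h h3 hh
  have hh' : 0 < h := hh
  simp only [Function.comp_apply, setAverage_eq, measureReal_def, Real.volume_Icc,
    add_sub_cancel_left, ENNReal.toReal_ofReal hh'.le, smul_eq_mul] at h3
  rw [intervalIntegral.integral_of_le (by linarith), ← integral_Icc_eq_integral_Ioc]
  rwa [inv_mul_le_iff₀ hh', mul_comm] at h3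

end loops

/-! ### Isotropy of the faces -/

/-- The off-diagonal part costs at most `η (∑ |c i|)²`, which Cauchy–Schwarz bounds by `card ι * η *
∑ (c i)²`. Symmetry of `A` is not needed, which matters because the loops do not close up exactly.
-/
theorem sum_mul_pos_of_diagonally_dominant {ι : Type*} [Fintype ι] [DecidableEq ι]
    {A : ι → ι → ℝ} {c : ι → ℝ} {q η : ℝ} (hη : 0 ≤ η) (hdiag : ∀ i, q ≤ A i i)
    (hoff : ∀ i j, i ≠ j → |A i j| ≤ η) (hq : Fintype.card ι * η < q) (hc : c ≠ 0) :
    0 < ∑ i, ∑ j, c i * (c j * A i j) := by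
  have h1 : ∀ i j, (if i = j then q * c i ^ 2 else 0) - η * (|c i| * |c j|) ≤
      c i * (c j * A i j) := by
    intro i j
    by_cases hij : i = j
    · subst hij
      rw [if_pos rfl]
      have h2 := mul_le_mul_of_nonneg_left (hdiag i) (sq_nonneg (c i))
      have h3 : 0 ≤ η * (|c i| * |c i|) := by positivity
      nlinarith
    · rw [if_neg hij, zero_sub, ← mul_assoc (c i)]
      have h2 : |c i * c j * A i j| ≤ η * (|c i| * |c j|) := by
        rw [abs_mul, abs_mul, mul_comm]
        gcongr
        exact hoff i j hij
      exact (abs_le.1 h2).1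
  have h2 : q * ∑ i, c i ^ 2 - η * (∑ i, |c i|) ^ 2 ≤ ∑ i, ∑ j, c i * (c j * A i j) := by
    refine le_trans (le_of_eq ?_) (Finset.sum_le_sum fun i _ => Finset.sum_le_sum fun j _ => h1 i j)
    simp only [Finset.sum_sub_distrib, Finset.sum_ite_eq, Finset.mem_univ, if_true]
    rw [Finset.mul_sum, sq, Finset.sum_mul_sum, Finset.mul_sum]
    simp only [Finset.mul_sum]
  have h3 : (∑ i, |c i|) ^ 2 ≤ Fintype.card ι * ∑ i, c i ^ 2 := by
    have := sq_sum_le_card_mul_sum_sq (s := Finset.univ) (f := fun i => |c i|)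
    simpa using this
  have h4 : 0 < ∑ i, c i ^ 2 := by
    obtain ⟨i, hi⟩ := Function.ne_iff.1 hc
    exact Finset.sum_pos' (fun _ _ => sq_nonneg _) ⟨i, Finset.mem_univ i, by
      have : c i ≠ 0 := hi
      positivity⟩
  nlinarith [mul_le_mul_of_nonneg_left h3 hη, mul_pos (sub_pos.2 hq) h4]

/-! ### Bilinearity of the area form over finite sums -/

section sums

variable {ι : Type*} {T : ℝ} {d : ι → ℝ → PhaseSpace n} {w : ℝ → PhaseSpace n}

theorem prim_sum (s : Finset ι) (c : ι → ℝ) (hd : ∀ i, Integrable (d i)) (t : ℝ) :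
    prim (fun t => ∑ i ∈ s, c i • d i t) t = ∑ i ∈ s, c i • prim (d i) t := by
  rw [prim, intervalIntegral.integral_finsetSum fun i _ =>
    ((hd i).fun_smul (c i)).intervalIntegrable]
  exact Finset.sum_congr rfl fun i _ => prim_smul _ _ _

theorem integrable_sum_smul (s : Finset ι) (c : ι → ℝ) (hd : ∀ i, Integrable (d i)) :
    Integrable fun t => ∑ i ∈ s, c i • d i t :=
  integrable_finsetSum s fun i _ => (hd i).fun_smul (c i)

theorem areaForm_sum_left (s : Finset ι) (c : ι → ℝ) (hd : ∀ i, Integrable (d i))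
    (hw : Integrable w) :
    areaForm T (fun t => ∑ i ∈ s, c i • d i t) w = ∑ i ∈ s, c i * areaForm T (d i) w := by
  simp only [areaForm, prim_sum s c hd, map_sum, map_smul, sum_inner, real_inner_smul_left]
  rw [intervalIntegral.integral_finsetSum fun i _ =>
    (intervalIntegrable_areaForm (hd i) hw _ _).const_mul (c i)]
  exact Finset.sum_congr rfl fun i _ => intervalIntegral.integral_const_mul _ _

theorem areaForm_sum_right (s : Finset ι) (c : ι → ℝ) (hd : ∀ i, Integrable (d i))
    (hw : Integrable w) :
    areaForm T w (fun t => ∑ i ∈ s, c i • d i t) = ∑ i ∈ s, c i * areaForm T w (d i) := by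
  simp only [areaForm, inner_sum, inner_smul_right]
  rw [intervalIntegral.integral_finsetSum fun i _ =>
    (intervalIntegrable_areaForm hw (hd i) _ _).const_mul (c i)]
  exact Finset.sum_congr rfl fun i _ => intervalIntegral.integral_const_mul _ _

end sums

/-- While the earlier loop is being run, the primitive of the later one is still zero. -/
theorem areaForm_loopVelocity_eq_zero {T τ τ' h : ℝ} (hT : 0 ≤ T) (hτ : τ' + h ≤ τ)
    (p q : ℝ → PhaseSpace n) :
    areaForm T (loopVelocity τ h p q) (loopVelocity τ' h p q) = 0 := by
  have : ∀ t ∈ uIcc 0 T,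
      inner ℝ (J (prim (loopVelocity τ h p q) t)) (loopVelocity τ' h p q t) = (0 : ℝ) := by
    intro t ht
    rw [uIcc_of_le hT] at ht
    by_cases h1 : t ∈ Ioc τ' (τ' + h)
    · have h2 : prim (loopVelocity τ h p q) t = 0 := by
        have : prim (loopVelocity τ h p q) t = ∫ s in (0 : ℝ)..t, (0 : PhaseSpace n) := by
          refine intervalIntegral.integral_congr fun s hs => ?_
          rw [uIcc_of_le ht.1] at hs
          refine indicator_of_notMem (fun hs' => ?_) _
          have := hs'.1
          have := hs.2
          have := h1.2
          linarith
        rw [this]; simp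
      rw [h2, map_zero, inner_zero_left]
    · rw [loopVelocity, loopVelocity, indicator_of_notMem h1, inner_zero_right]
  rw [areaForm, intervalIntegral.integral_congr this]
  simp

/-- In one order the area form vanishes; in the other, integration by parts reduces it to the
boundary term, a product of two closing defects. The interaction is thus quadratic in these small
defects. -/
theorem abs_areaForm_loopVelocity_le {T τ τ' h κ : ℝ} (hT : 0 ≤ T) {p q : ℝ → PhaseSpace n}
    (hi : Integrable (loopVelocity τ h p q)) (hi' : Integrable (loopVelocity τ' h p q))
    (hsep : τ' + h ≤ τ ∨ τ + h ≤ τ') (hκ : ‖prim (loopVelocity τ h p q) T‖ ≤ κ)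
    (hκ' : ‖prim (loopVelocity τ' h p q) T‖ ≤ κ) :
    |areaForm T (loopVelocity τ h p q) (loopVelocity τ' h p q)| ≤ κ ^ 2 := by
  rcases hsep with hsep | hsep
  · rw [areaForm_loopVelocity_eq_zero hT hsep, abs_zero]; positivity
  · have h1 := areaForm_sub_areaForm (T := T) hi hi'
    rw [areaForm_loopVelocity_eq_zero hT hsep, sub_zero] at h1
    rw [h1]
    refine (abs_real_inner_le_norm _ _).trans ?_
    rw [norm_J, sq]
    exact mul_le_mul hκ hκ' (norm_nonneg _) ((norm_nonneg _).trans hκ)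

/-- The vector is half of `(1/2 + a)(v + p) + (1/2 - a)(v - p) + (1/2 + b)(v + q) + (1/2 - b)(v -
q)`. -/
theorem add_smul_add_smul_mem_normalCone {K : Set (PhaseSpace n)} {x v p q : PhaseSpace n}
    (hp : v + p ∈ normalCone K x) (hp' : v - p ∈ normalCone K x)
    (hq : v + q ∈ normalCone K x) (hq' : v - q ∈ normalCone K x) {a b : ℝ}
    (ha : |a| ≤ 1 / 2) (hb : |b| ≤ 1 / 2) : v + (a • p + b • q) ∈ normalCone K x := by
  intro y hy
  have h1 := hp y hy
  have h2 := hp' y hy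
  have h3 := hq y hy
  have h4 := hq' y hy
  rw [inner_add_left] at h1 h3
  rw [inner_sub_left] at h2 h4
  rw [inner_add_left, inner_add_left, real_inner_smul_left, real_inner_smul_left]
  obtain ⟨ha1, ha2⟩ := abs_le.1 ha
  obtain ⟨hb1, hb2⟩ := abs_le.1 hb
  nlinarith [mul_nonneg (by linarith : (0 : ℝ) ≤ 1 / 2 + a) h1,
    mul_nonneg (by linarith : (0 : ℝ) ≤ 1 / 2 - a) h2,
    mul_nonneg (by linarith : (0 : ℝ) ≤ 1 / 2 + b) h3,
    mul_nonneg (by linarith : (0 : ℝ) ≤ 1 / 2 - b) h4]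

/-! ### Superposition of small loops as an admissible variation -/

section minimizing

variable {K : Set (PhaseSpace n)} {T r : ℝ} {γ : ℝ → PhaseSpace n}

/-- At each time the combination has the form `α p + β q` with `|α|, |β| ≤ 1/2`, because the profile
speeds are at most `1` and `∑ |c i| ≤ 1/2`. Hence it keeps the velocity in the normal cone, and the
second variation inequality applies. -/
theorem IsActionMinimizing.areaForm_sum_loopVelocity_nonpos (hγ : IsActionMinimizing K T γ)
    (hconv : Convex ℝ K) (hcomp : IsCompact K) (hr : 0 < r) (hK : Metric.closedBall 0 r ⊆ K)
    {p q : ℝ → PhaseSpace n} {C : ℝ} (hpC : ∀ t, ‖p t‖ ≤ C) (hqC : ∀ t, ‖q t‖ ≤ C)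
    (hN : ∀ᵐ t, t ∈ Icc 0 T →
      (normalVelocity T γ t + p t ∈ normalCone K (γ t) ∧
        normalVelocity T γ t - p t ∈ normalCone K (γ t)) ∧
      (normalVelocity T γ t + q t ∈ normalCone K (γ t) ∧
        normalVelocity T γ t - q t ∈ normalCone K (γ t)))
    {ι : Type*} [Fintype ι] {τ : ι → ℝ} {h : ℝ} (hh : 0 < h) (hτ0 : ∀ i, 0 ≤ τ i)
    (hτT : ∀ i, τ i + h ≤ T) {c : ι → ℝ} (hc : ∑ i, |c i| ≤ 1 / 2)
    (hcT : ∑ i, c i • prim (loopVelocity (τ i) h p q) T = 0)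
    (hcγ : ∑ i, c i * ∫ t in (0 : ℝ)..T, inner ℝ (γ t) (loopVelocity (τ i) h p q t) = 0)
    (hint : ∀ i, Integrable (loopVelocity (τ i) h p q)) :
    areaForm T (fun t => ∑ i, c i • loopVelocity (τ i) h p q t)
      (fun t => ∑ i, c i • loopVelocity (τ i) h p q t) ≤ 0 := by
  set α : ℝ → ℝ := fun t => ∑ i, c i * (Ioc (τ i) (τ i + h)).indicator (evenSpeed (τ i) h) t
  set β : ℝ → ℝ := fun t => ∑ i, c i * (Ioc (τ i) (τ i + h)).indicator (oddSpeed (τ i) h) t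
  have hbound : ∀ (f : ι → ℝ → ℝ), (∀ i, ∀ t ∈ Icc (τ i) (τ i + h), |f i t| ≤ 1) →
      ∀ t, |∑ i, c i * (Ioc (τ i) (τ i + h)).indicator (f i) t| ≤ 1 / 2 := by
    intro f hf t
    refine (Finset.abs_sum_le_sum_abs _ _).trans (le_trans (Finset.sum_le_sum fun i _ => ?_) hc)
    rw [abs_mul]
    refine mul_le_of_le_one_right (abs_nonneg _) ?_
    by_cases ht : t ∈ Ioc (τ i) (τ i + h)
    · rw [indicator_of_mem ht]; exact hf i t (Ioc_subset_Icc_self ht)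
    · rw [indicator_of_notMem ht, abs_zero]; exact zero_le_one
  have hα : ∀ t, |α t| ≤ 1 / 2 := hbound _ fun i t ht => abs_evenSpeed_le hh ht
  have hβ : ∀ t, |β t| ≤ 1 / 2 := hbound _ fun i t ht => abs_oddSpeed_le hh ht
  have heq : ∀ t, ∑ i, c i • loopVelocity (τ i) h p q t = α t • p t + β t • q t := by
    intro t
    simp only [α, β, Finset.sum_smul, ← Finset.sum_add_distrib]
    refine Finset.sum_congr rfl fun i _ => ?_
    by_cases ht : t ∈ Ioc (τ i) (τ i + h)
    · simp only [loopVelocity, indicator_of_mem ht, smul_add, smul_smul]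
    · simp only [loopVelocity, indicator_of_notMem ht, smul_zero, mul_zero, zero_smul, add_zero]
  have hCT := hγ.1.period_pos
  refine hγ.areaForm_nonpos hconv hcomp hr hK ?_ ?_ ?_ ?_ ?_
  · refine MemLp.of_bound (C := C) (integrable_sum_smul _ _ hint).1.restrict (ae_of_all _ fun t => ?_)
    rw [heq]
    refine (norm_add_le _ _).trans ?_
    rw [norm_smul, norm_smul, Real.norm_eq_abs, Real.norm_eq_abs]
    have h1 : |α t| * ‖p t‖ ≤ 1 / 2 * C := mul_le_mul (hα t) (hpC t) (norm_nonneg _) (by norm_num)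
    have h2 : |β t| * ‖q t‖ ≤ 1 / 2 * C := mul_le_mul (hβ t) (hqC t) (norm_nonneg _) (by norm_num)
    linarith
  · intro t ht
    refine Finset.sum_eq_zero fun i _ => ?_
    rw [loopVelocity, indicator_of_notMem, smul_zero]
    intro ht'
    exact ht ⟨(hτ0 i).trans ht'.1.le, ht'.2.trans (hτT i)⟩
  · filter_upwards [hN] with t h1 ht
    obtain ⟨⟨h2, h3⟩, h4, h5⟩ := h1 ht
    rw [heq]
    exact add_smul_add_smul_mem_normalCone h2 h3 h4 h5 (hα t) (hβ t)
  · rw [prim_sum _ _ hint, hcT]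
  · simp only [inner_sum, inner_smul_right]
    rw [intervalIntegral.integral_finsetSum fun i _ =>
      (hγ.1.intervalIntegrable_inner (hint i)).const_mul (c i)]
    simp only [intervalIntegral.integral_const_mul]
    exact hcγ

/-- A loop at a Lebesgue point with `ω(p, q) < 0` has positive area of order `h²`, but alone it
violates closedness and length by a little. Superposing `2n + 2` of them leaves room to meet all `2n
+ 1` constraints exactly. The closing defects are `o(h)`, so interactions are `o(h²)` and the total
area stays positive. The sign is one-sided only because the order of `p` and `q` is fixed. -/
theorem IsActionMinimizing.ae_omega_nonneg (hγ : IsActionMinimizing K T γ)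
    (hconv : Convex ℝ K) (hcomp : IsCompact K) (hr : 0 < r) (hK : Metric.closedBall 0 r ⊆ K)
    {p q : ℝ → PhaseSpace n} (hp : AEStronglyMeasurable p) (hq : AEStronglyMeasurable q)
    {C : ℝ} (hpC : ∀ t, ‖p t‖ ≤ C) (hqC : ∀ t, ‖q t‖ ≤ C)
    (hN : ∀ᵐ t, t ∈ Icc 0 T →
      (normalVelocity T γ t + p t ∈ normalCone K (γ t) ∧
        normalVelocity T γ t - p t ∈ normalCone K (γ t)) ∧
      (normalVelocity T γ t + q t ∈ normalCone K (γ t) ∧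
        normalVelocity T γ t - q t ∈ normalCone K (γ t))) :
    ∀ᵐ t, t ∈ Icc 0 T → 0 ≤ omega (p t) (q t) := by
  classical
  have hT := hγ.1.period_pos
  have hC0 : 0 ≤ C := (norm_nonneg _).trans (hpC 0)
  have hloc : ∀ {x : ℝ → PhaseSpace n}, AEStronglyMeasurable x → (∀ t, ‖x t‖ ≤ C) →
      LocallyIntegrable x := fun hx hxC =>
    (locallyIntegrable_const C).mono hx (ae_of_all _ fun t => (hxC t).trans (le_abs_self C))
  have hpl := hloc hp hpC
  have hql := hloc hq hqC
  by_contra hcon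
  -- If the assertion fails, `Z` cannot be finite, as a finite set is null. Only infinitude is
  -- needed, so no measurability of `Z` is involved.
  set Z : Set ℝ := {t | t ∈ Ioo 0 T ∧ omega (p t) (q t) < 0 ∧
    (∀ κ > 0, ∀ᶠ h in 𝓝[>] (0 : ℝ), ∫ s in t..(t + h), ‖p s - p t‖ ≤ κ * h) ∧
    ∀ κ > 0, ∀ᶠ h in 𝓝[>] (0 : ℝ), ∫ s in t..(t + h), ‖q s - q t‖ ≤ κ * h} with hZ
  have hZinf : Z.Infinite := by
    intro hfin
    apply hcon
    have h0 : ∀ᵐ t : ℝ, t ≠ 0 := by simp [ae_iff]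
    have h1 : ∀ᵐ t : ℝ, t ≠ T := by simp [ae_iff]
    filter_upwards [hfin.countable.ae_notMem volume, ae_eventually_integral_norm_sub_le hpl,
      ae_eventually_integral_norm_sub_le hql, h0, h1] with t h2 h3 h4 h5 h6 ht
    by_contra! hlt
    exact h2 ⟨⟨lt_of_le_of_ne ht.1 (Ne.symm h5), lt_of_le_of_ne ht.2 h6⟩, hlt, h3, h4⟩
  obtain ⟨s, hsZ, hcard⟩ := hZinf.exists_subset_card_eq (2 * n + 2)
  have hsne : s.Nonempty := Finset.card_pos.1 (by omega)
  obtain ⟨i₀, hi₀, hmin⟩ := s.exists_min_image (fun t => -omega (p t) (q t)) hsne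
  set Q := -omega (p i₀) (q i₀) / 15 with hQ
  have hQpos : 0 < Q := by
    have := (hsZ hi₀).2.1
    rw [hQ]; linarith
  set m : ℝ := 2 * n + 2 with hm
  have hmpos : 0 < m := by positivity
  -- The second entry gives `4Cκ ≤ Q/2`, so each loop retains area `Q/2 * h²`. The first and third
  -- give `m κ² ≤ Q/4 < Q/2`, the diagonal dominance for `m = 2n + 2` loops.
  set κ := min 1 (min (Q / (8 * C + 8)) (Q / (4 * m))) with hκ
  have hκpos : 0 < κ := by positivity
  have hκ1 : κ ≤ 1 := min_le_left _ _
  have hκ2 : κ * (8 * C + 8) ≤ Q := by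
    rw [← le_div_iff₀ (by positivity)]
    exact (min_le_right _ _).trans (min_le_left _ _)
  have hκ3 : κ * (4 * m) ≤ Q := by
    rw [← le_div_iff₀ (by positivity)]
    exact (min_le_right _ _).trans (min_le_right _ _)
  have hev : ∀ᶠ h in 𝓝[>] (0 : ℝ), 0 < h ∧ (∀ i : s,
      (∫ x in (i : ℝ)..(i + h), ‖p x - p i‖ ≤ κ / 2 * h) ∧
      (∫ x in (i : ℝ)..(i + h), ‖q x - q i‖ ≤ κ / 2 * h) ∧ (i : ℝ) + h ≤ T) ∧
      ∀ i j : s, i ≠ j → h ≤ |(i : ℝ) - j| := by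
    have hsmall : ∀ a > (0 : ℝ), ∀ᶠ h in 𝓝[>] (0 : ℝ), h ≤ a := fun a ha =>
      nhdsWithin_le_nhds (eventually_le_nhds ha)
    have hpos : ∀ᶠ h in 𝓝[>] (0 : ℝ), 0 < h := self_mem_nhdsWithin
    refine hpos.and ((eventually_all.2 fun i => ?_).and
      (eventually_all.2 fun i => eventually_all.2 fun j => ?_))
    · have hi := hsZ i.2
      refine (hi.2.2.1 _ (half_pos hκpos)).and ((hi.2.2.2 _ (half_pos hκpos)).and ?_)
      filter_upwards [hsmall (T - i) (by linarith [hi.1.2])] with h hh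
      linarith
    · by_cases hij : i = j
      · exact Eventually.of_forall fun h hne => absurd hij hne
      · filter_upwards [hsmall |(i : ℝ) - j| (abs_pos.2 (sub_ne_zero.2 fun h =>
          hij (Subtype.ext h)))] with h hh _
        exact hh
  obtain ⟨h, hh, hloop, hsep⟩ := hev.exists
  have hτ0 : ∀ i : s, (0 : ℝ) ≤ i := fun i => (hsZ i.2).1.1.le
  have hτT : ∀ i : s, (i : ℝ) + h ≤ T := fun i => (hloop i).2.2
  have hint : ∀ i : s, Integrable (loopVelocity (i : ℝ) h p q) := fun i =>
    integrable_loopVelocity hh hpl hql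
  have hest : ∀ i : s, ‖prim (loopVelocity (i : ℝ) h p q) T‖ ≤ κ * h ∧
      Q / 2 * h ^ 2 ≤ areaForm T (loopVelocity (i : ℝ) h p q) (loopVelocity (i : ℝ) h p q) := by
    intro i
    have hsub : ∀ {x : ℝ → PhaseSpace n}, LocallyIntegrable x →
        IntervalIntegrable (fun t => ‖x t - x i‖) volume (i : ℝ) (i + h) := fun hx =>
      (intervalIntegrable_iff_integrableOn_Icc_of_le (by linarith)).2
        ((hx.sub (locallyIntegrable_const _)).integrableOn_isCompact isCompact_Icc).norm
    have h1 := loopVelocity_estimates (T := T) (κ := κ) hh (hτ0 i) (hτT i) hpl hql hpC hqC (by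
      rw [intervalIntegral.integral_add (hsub hpl) (hsub hql)]
      linarith [(hloop i).1, (hloop i).2.1])
    refine ⟨h1.1, le_trans ?_ h1.2⟩
    have h2 := hmin i i.2
    have h3 : Q ≤ -omega (p i) (q i) / 15 := by
      rw [hQ]; linarith
    have h4 : 4 * C * κ ≤ Q / 2 := by nlinarith
    have h5 : Q / 2 ≤ -omega (p i) (q i) / 15 - 4 * C * κ := by linarith
    nlinarith [mul_le_mul_of_nonneg_right h5 (sq_nonneg h)]
  -- Closing defect and first-order change of length. The target has dimension `2n + 1`, one less
  -- than the number of loops.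
  set Λ : (s → ℝ) →ₗ[ℝ] PhaseSpace n × ℝ :=
    ∑ i : s, (LinearMap.proj i : (s → ℝ) →ₗ[ℝ] ℝ).smulRight
      (prim (loopVelocity (i : ℝ) h p q) T,
        ∫ t in (0 : ℝ)..T, inner ℝ (γ t) (loopVelocity (i : ℝ) h p q t)) with hΛ
  have hΛ_apply : ∀ c, Λ c = ∑ i : s, c i • (prim (loopVelocity (i : ℝ) h p q) T,
      ∫ t in (0 : ℝ)..T, inner ℝ (γ t) (loopVelocity (i : ℝ) h p q t)) := by
    intro c
    simp [hΛ, LinearMap.sum_apply]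
  have hker : LinearMap.ker Λ ≠ ⊥ := by
    refine LinearMap.ker_ne_bot_of_finrank_lt ?_
    rw [Module.finrank_prod, Module.finrank_pi, Fintype.card_coe, hcard]
    simp
    omega
  obtain ⟨c₀, hc₀, hc₀ne⟩ := (Submodule.ne_bot_iff _).1 hker
  set S := ∑ i, |c₀ i| with hS
  have hS0 : 0 ≤ S := Finset.sum_nonneg fun _ _ => abs_nonneg _
  -- Scaling stays in the kernel and brings `∑ |c i|` down to at most `1/2`, as staying in the
  -- normal cones requires.
  set c : s → ℝ := (1 / (2 * S + 2)) • c₀ with hc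
  have hcker : Λ c = 0 := by rw [hc, map_smul, LinearMap.mem_ker.1 hc₀, smul_zero]
  have hcne : c ≠ 0 := smul_ne_zero (by positivity) hc₀ne
  have hcsum : ∑ i, |c i| ≤ 1 / 2 := by
    simp only [hc, Pi.smul_apply, smul_eq_mul, abs_mul]
    rw [← Finset.mul_sum, ← hS, abs_of_pos (by positivity), one_div_mul_eq_div,
      div_le_div_iff₀ (by positivity) (by norm_num)]
    linarith
  rw [hΛ_apply] at hcker
  have hc1 := congrArg Prod.fst hcker
  have hc2 := congrArg Prod.snd hcker
  simp only [Prod.fst_sum, Prod.snd_sum, Prod.smul_fst, Prod.smul_snd, Prod.fst_zero,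
    Prod.snd_zero, smul_eq_mul] at hc1 hc2
  have hnonpos := hγ.areaForm_sum_loopVelocity_nonpos hconv hcomp hr hK hpC hqC hN hh hτ0 hτT
    hcsum hc1 hc2 hint
  rw [areaForm_sum_left _ _ hint (integrable_sum_smul _ _ hint)] at hnonpos
  simp only [areaForm_sum_right _ _ hint (hint _), Finset.mul_sum] at hnonpos
  refine absurd hnonpos (not_le.2 ?_)
  refine sum_mul_pos_of_diagonally_dominant (q := Q / 2 * h ^ 2) (η := (κ * h) ^ 2) (sq_nonneg _)
    (fun i => (hest i).2) (fun i j hij => ?_) ?_ hcne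
  · refine abs_areaForm_loopVelocity_le hT.le (hint i) (hint j) ?_ (hest i).1 (hest j).1
    have := hsep i j hij
    rcases le_abs.1 this with h1 | h1
    · left; linarith
    · right; linarith
  · rw [Fintype.card_coe, hcard]
    push_cast
    rw [← hm, mul_pow, ← mul_assoc]
    have h1 : m * κ ^ 2 < Q / 2 := by nlinarith
    have h2 : 0 < h ^ 2 := by positivity
    nlinarith

end minimizing

/-! ### Measurable selection of nearest points -/

section selection

variable {Y F : Type*} [TopologicalSpace Y]

theorem _root_.IsClosed.exists_infEDist_eq_edist [PseudoMetricSpace F] [ProperSpace F] {s : Set F}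
    (hs : IsClosed s) (hne : s.Nonempty) (a : F) :
    ∃ w ∈ s, Metric.infEDist a s = edist a w := by
  obtain ⟨w, hw, h⟩ := hs.exists_infDist_eq_dist hne a
  refine ⟨w, hw, ?_⟩
  rw [edist_dist, ← h, Metric.infDist, ENNReal.ofReal_toReal (Metric.infEDist_ne_top hne)]

theorem isClosed_setOf_exists_mem [TopologicalSpace F] {Γ : Set (Y × F)} (hΓ : IsClosed Γ)
    {B : Set F} (hB : IsCompact B) : IsClosed {y | ∃ w ∈ B, (y, w) ∈ Γ} := by
  have : CompactSpace B := isCompact_iff_compactSpace.1 hB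
  have h1 : IsClosed ((fun p : Y × B => ((p.1, (p.2 : F)) : Y × F)) ⁻¹' Γ) :=
    hΓ.preimage (by fun_prop)
  have h2 := isClosedMap_fst_of_compactSpace _ h1
  convert! h2 using 1
  ext y
  constructor
  · rintro ⟨w, hw, hy⟩; exact ⟨(y, ⟨w, hw⟩), hy, rfl⟩
  · rintro ⟨⟨y', w⟩, hy, rfl⟩; exact ⟨w, w.2, hy⟩

/-- For finite `R`, the sublevel set is the projection of the part of `Γ` over a compact ball, hence
closed. Empty sections have distance `⊤`. -/
theorem measurable_infEDist_section [MeasurableSpace Y] [OpensMeasurableSpace Y] [PseudoMetricSpace F] [ProperSpace F]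
    {Γ : Set (Y × F)} (hΓ : IsClosed Γ) (a : F) : Measurable fun y => Metric.infEDist a {w | (y, w) ∈ Γ} := by
  refine measurable_of_Iic fun R => ?_
  by_cases hR : R = ⊤
  · simp [hR]
  have : (fun y => Metric.infEDist a {w | (y, w) ∈ Γ}) ⁻¹' Iic R =
      {y | ∃ w ∈ Metric.closedBall a R.toReal, (y, w) ∈ Γ} := by
    ext y
    have hmem : ∀ w, w ∈ Metric.closedBall a R.toReal ↔ edist a w ≤ R := fun w => by
      rw [Metric.mem_closedBall, dist_comm, edist_dist, ENNReal.ofReal_le_iff_le_toReal hR]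
    simp only [mem_preimage, mem_Iic, mem_ofPred_eq, hmem]
    constructor
    · intro h
      have hne : {w | (y, w) ∈ Γ}.Nonempty := by
        by_contra hem
        rw [not_nonempty_iff_eq_empty.1 hem, Metric.infEDist_empty] at h
        exact hR (top_le_iff.1 h)
      obtain ⟨w, hw, he⟩ := (hΓ.preimage (Continuous.prodMk_right y)).exists_infEDist_eq_edist
        hne a
      exact ⟨w, he ▸ h, hw⟩
    · rintro ⟨w, h, hw⟩
      exact (Metric.infEDist_le_edist_of_mem (s := {w | (y, w) ∈ Γ}) hw).trans h
  rw [this]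
  exact (isClosed_setOf_exists_mem hΓ (isCompact_closedBall a _)).measurableSet

/-- Uniqueness of the nearest point: by the parallelogram law, the midpoint of two distinct ones
would be strictly closer. -/
theorem eq_of_norm_sub_le_of_convex [NormedAddCommGroup F] [InnerProductSpace ℝ F] {s : Set F}
    (hs : Convex ℝ s) {a x y : F} (hx : x ∈ s) (hy : y ∈ s)
    (hmin : ∀ w ∈ s, ‖a - x‖ ≤ ‖a - w‖) (hle : ‖a - y‖ ≤ ‖a - x‖) : y = x := by
  have hm := hmin _ (hs hx hy (by norm_num : (0 : ℝ) ≤ 1 / 2) (by norm_num : (0 : ℝ) ≤ 1 / 2)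
    (by norm_num))
  have h1 : (2 : ℝ) • (a - ((1 / 2 : ℝ) • x + (1 / 2 : ℝ) • y)) = (a - x) + (a - y) := by
    rw [smul_sub, smul_add, smul_smul, smul_smul, two_smul]; norm_num; abel
  have h2 : ‖(a - x) + (a - y)‖ = 2 * ‖a - ((1 / 2 : ℝ) • x + (1 / 2 : ℝ) • y)‖ := by
    rw [← h1, norm_smul]; norm_num
  have h3 := parallelogram_law_with_norm ℝ (a - x) (a - y)
  have h4 : (a - x) - (a - y) = y - x := by abel
  rw [h4] at h3
  have h5 : ‖y - x‖ * ‖y - x‖ ≤ 0 := by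
    have := norm_nonneg (a - x)
    have := norm_nonneg (a - y)
    nlinarith
  have h6 : ‖y - x‖ = 0 := by nlinarith [norm_nonneg (y - x)]
  exact sub_eq_zero.1 (norm_eq_zero.1 h6)

/-- Because the nearest point is unique, over a nonempty section `p y` lies in a closed set `C`
exactly when the part of the section inside `C` is no farther from `a` than the whole section. This
compares two measurable distance functions. -/
theorem exists_measurable_nearest [MeasurableSpace Y] [OpensMeasurableSpace Y]
    [NormedAddCommGroup F] [InnerProductSpace ℝ F]
    [FiniteDimensional ℝ F] [MeasurableSpace F] [BorelSpace F] {Γ : Set (Y × F)} (hΓ : IsClosed Γ)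
    (hconv : ∀ y, Convex ℝ {w | (y, w) ∈ Γ}) (a : F) :
    ∃ p : Y → F, Measurable p ∧ (∀ y, (∀ w, (y, w) ∉ Γ) → p y = 0) ∧
      ∀ y w, (y, w) ∈ Γ → (y, p y) ∈ Γ ∧ ‖a - p y‖ ≤ ‖a - w‖ := by
  have : ProperSpace F := FiniteDimensional.proper ℝ F
  have hex : ∀ y, ∃ x : F, ((∀ w, (y, w) ∉ Γ) → x = 0) ∧
      ∀ w, (y, w) ∈ Γ → (y, x) ∈ Γ ∧ ‖a - x‖ ≤ ‖a - w‖ := by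
    intro y
    by_cases hne : {w | (y, w) ∈ Γ}.Nonempty
    · obtain ⟨x, hx, hmin⟩ := (hΓ.preimage (Continuous.prodMk_right y)).exists_infDist_eq_dist
        hne a
      obtain ⟨w₀, hw₀⟩ := hne
      refine ⟨x, fun h => absurd hw₀ (h w₀), fun w hw => ⟨hx, ?_⟩⟩
      rw [← dist_eq_norm, ← dist_eq_norm, ← hmin]
      exact Metric.infDist_le_dist_of_mem hw
    · exact ⟨0, fun _ => rfl, fun w hw => absurd ⟨w, hw⟩ hne⟩
  choose p hp0 hp using hex
  refine ⟨p, measurable_of_isClosed fun C hC => ?_, hp0, hp⟩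
  have hΓC : IsClosed (Γ ∩ {z | z.2 ∈ C}) := hΓ.inter (hC.preimage continuous_snd)
  have hS : MeasurableSet {y | Metric.infEDist a {w | (y, w) ∈ Γ} < ⊤} :=
    measurableSet_lt (measurable_infEDist_section hΓ a) measurable_const
  have hle : MeasurableSet {y | Metric.infEDist a {w | (y, w) ∈ Γ ∩ {z | z.2 ∈ C}} ≤
      Metric.infEDist a {w | (y, w) ∈ Γ}} :=
    measurableSet_le (measurable_infEDist_section hΓC a) (measurable_infEDist_section hΓ a)
  have key : p ⁻¹' C = ({y | Metric.infEDist a {w | (y, w) ∈ Γ} < ⊤} ∩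
      {y | Metric.infEDist a {w | (y, w) ∈ Γ ∩ {z | z.2 ∈ C}} ≤
        Metric.infEDist a {w | (y, w) ∈ Γ}}) ∪
      ({y | Metric.infEDist a {w | (y, w) ∈ Γ} < ⊤}ᶜ ∩ {_y | (0 : F) ∈ C}) := by
    ext y
    by_cases hne : {w | (y, w) ∈ Γ}.Nonempty
    · have hfin : Metric.infEDist a {w | (y, w) ∈ Γ} < ⊤ :=
        (Metric.infEDist_ne_top hne).lt_top
      obtain ⟨w₀, hw₀⟩ := hne
      have hpy := (hp y w₀ hw₀).1
      simp only [mem_preimage, mem_union, mem_inter_iff, mem_ofPred_eq, hfin, true_and,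
        mem_compl_iff, not_true_eq_false, false_and, or_false]
      constructor
      · intro h
        refine (Metric.infEDist_le_edist_of_mem
          (s := {w | (y, w) ∈ Γ ∩ {z | z.2 ∈ C}}) (y := p y) ⟨hpy, h⟩).trans ?_
        rw [Metric.le_infEDist]
        intro w hw
        rw [edist_dist, edist_dist, dist_eq_norm, dist_eq_norm]
        exact ENNReal.ofReal_le_ofReal (hp y w hw).2
      · intro h
        have hne' : {w | (y, w) ∈ Γ ∧ w ∈ C}.Nonempty := by
          by_contra hem
          rw [not_nonempty_iff_eq_empty.1 hem, Metric.infEDist_empty] at h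
          exact absurd (h.trans_lt hfin) (lt_irrefl _)
        obtain ⟨w, hw, he⟩ := (hΓC.preimage
          (Continuous.prodMk_right y)).exists_infEDist_eq_edist hne' a
        have h2 : edist a w ≤ edist a (p y) := by
          rw [← he]
          exact h.trans (Metric.infEDist_le_edist_of_mem (s := {w | (y, w) ∈ Γ}) hpy)
        rw [edist_dist, edist_dist, ENNReal.ofReal_le_ofReal_iff dist_nonneg, dist_eq_norm,
          dist_eq_norm] at h2
        have := eq_of_norm_sub_le_of_convex (hconv y) hpy hw.1 (fun w hw => (hp y w hw).2) h2
        rw [← this]; exact hw.2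
    · have hinf : ¬ Metric.infEDist a {w | (y, w) ∈ Γ} < ⊤ := by
        rw [not_nonempty_iff_eq_empty.1 hne, Metric.infEDist_empty]
        exact lt_irrefl _
      have hpy : p y = 0 := hp0 y fun w hw => hne ⟨w, hw⟩
      simp only [mem_preimage, mem_union, mem_inter_iff, mem_ofPred_eq, hinf, false_and,
        mem_compl_iff, not_false_eq_true, true_and, false_or, hpy]
  rw [key]
  exact (hS.inter hle).union (hS.compl.inter (MeasurableSet.const _))

end selection

/-! ### Directions of the minimal face of the normal velocity -/

theorem isClosed_normalCone_graph (K : Set (PhaseSpace n)) :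
    IsClosed {z : PhaseSpace n × PhaseSpace n | z.2 ∈ normalCone K z.1} := by
  have : {z : PhaseSpace n × PhaseSpace n | z.2 ∈ normalCone K z.1} =
      ⋂ y ∈ K, {z | 0 ≤ inner ℝ z.2 (z.1 - y)} := by
    ext; simp [normalCone]
  rw [this]
  exact isClosed_biInter fun y _ => isClosed_le continuous_const (by fun_prop)

/-- The vectors `w` such that the segment `[v - w, v + w]` lies in the normal cone at `x`. -/
def faceDirections (K : Set (PhaseSpace n)) (x v : PhaseSpace n) : Set (PhaseSpace n) :=
  {w | v + w ∈ normalCone K x ∧ v - w ∈ normalCone K x}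

theorem convex_normalCone (K : Set (PhaseSpace n)) (x : PhaseSpace n) :
    Convex ℝ (normalCone K x) := by
  intro u hu v hv a b ha hb _ y hy
  rw [inner_add_left, real_inner_smul_left, real_inner_smul_left]
  have := hu y hy
  have := hv y hy
  positivity

theorem convex_faceDirections (K : Set (PhaseSpace n)) (x v : PhaseSpace n) :
    Convex ℝ (faceDirections K x v) := by
  intro w hw w' hw' a b ha hb hab
  have hv : v = a • v + b • v := by rw [← add_smul, hab, one_smul]
  constructor
  · have := convex_normalCone K x hw.1 hw'.1 ha hb hab
    convert! this using 1
    rw [smul_add, smul_add]; nth_rw 1 [hv]; abel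
  · have := convex_normalCone K x hw.2 hw'.2 ha hb hab
    convert! this using 1
    rw [smul_sub, smul_sub]; nth_rw 1 [hv]; abel

theorem mem_normalCone_of_mem_faceDirections {K : Set (PhaseSpace n)} {x v w : PhaseSpace n}
    (hw : w ∈ faceDirections K x v) : v ∈ normalCone K x := by
  have := convex_normalCone K x hw.1 hw.2 (by norm_num : (0 : ℝ) ≤ 1 / 2)
    (by norm_num : (0 : ℝ) ≤ 1 / 2) (by norm_num)
  convert! this using 1
  rw [← smul_add, add_add_sub_cancel, ← two_smul ℝ v, smul_smul]; norm_num

theorem zero_mem_faceDirections {K : Set (PhaseSpace n)} {x v : PhaseSpace n}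
    (hv : v ∈ normalCone K x) : 0 ∈ faceDirections K x v := by
  simpa [faceDirections] using hv

section minimizing

variable {K : Set (PhaseSpace n)} {T r : ℝ} {γ : ℝ → PhaseSpace n}

/-- Measurable selections, dense in the set of face directions at almost every time. -/
theorem IsClosedCharacteristic.exists_dense_selections (h : IsClosedCharacteristic K T γ) :
    ∃ p : ℕ → ℝ → PhaseSpace n, (∀ i, Measurable (p i)) ∧ (∀ i, ∃ C, ∀ t, ‖p i t‖ ≤ C) ∧
      ∀ t ∈ Icc 0 T, normalVelocity T γ t ∈ normalCone K (γ t) →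
        (∀ i, p i t ∈ faceDirections K (γ t) (normalVelocity T γ t)) ∧
        faceDirections K (γ t) (normalVelocity T γ t) ⊆ closure (range fun i => p i t) := by
  have hT := h.period_pos.le
  -- Outside `[0, T]` nothing is known about `γ`; the continuous extension makes the selections
  -- measurable on the whole line.
  set β : ℝ → PhaseSpace n := IccExtend hT ((Icc 0 T).domRestrict γ) with hβ
  have hβc : Continuous β := (continuousOn_iff_continuous_domRestrict.1 h.continuousOn).Icc_extend'
  have hβγ : ∀ t ∈ Icc 0 T, β t = γ t := fun t ht => IccExtend_of_mem hT _ ht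
  set Γ : Set ((PhaseSpace n × PhaseSpace n) × PhaseSpace n) :=
    {z | z.2 ∈ faceDirections K z.1.1 z.1.2} with hΓ
  have hΓc : IsClosed Γ := by
    have h1 : Γ = (fun z : (PhaseSpace n × PhaseSpace n) × PhaseSpace n => (z.1.1, z.1.2 + z.2)) ⁻¹'
        {z | z.2 ∈ normalCone K z.1} ∩
        (fun z : (PhaseSpace n × PhaseSpace n) × PhaseSpace n => (z.1.1, z.1.2 - z.2)) ⁻¹'
        {z | z.2 ∈ normalCone K z.1} := rfl
    rw [h1]
    exact ((isClosed_normalCone_graph K).preimage (by fun_prop)).inter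
      ((isClosed_normalCone_graph K).preimage (by fun_prop))
  have hsel := fun a => exists_measurable_nearest hΓc
    (fun y => convex_faceDirections K y.1 y.2) a
  choose P hPm hP0 hP using hsel
  set a := TopologicalSpace.denseSeq (PhaseSpace n) with ha
  -- Whenever the section is nonempty it contains `0`, so the nearest point to `b` is within `‖b‖`
  -- of `b`.
  have hbound : ∀ b y, ‖P b y‖ ≤ 2 * ‖b‖ := by
    intro b y
    by_cases hy : ∀ w, (y, w) ∉ Γ
    · rw [hP0 b y hy, norm_zero]; positivity
    · push Not at hy
      obtain ⟨w, hw⟩ := hy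
      have h1 := (hP b y 0 (zero_mem_faceDirections (mem_normalCone_of_mem_faceDirections hw))).2
      rw [sub_zero] at h1
      have h2 : ‖P b y‖ ≤ ‖b‖ + ‖b - P b y‖ := by
        calc ‖P b y‖ = ‖b - (b - P b y)‖ := by rw [sub_sub_cancel]
          _ ≤ _ := norm_sub_le _ _
      linarith
  refine ⟨fun i t => P (a i) (β t, normalVelocity T γ t), fun i => (hPm (a i)).comp
    (hβc.measurable.prodMk (measurable_normalVelocity T γ)),
    fun i => ⟨2 * ‖a i‖, fun t => hbound _ _⟩, fun t ht hv => ⟨fun i => ?_, fun w hw => ?_⟩⟩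
  · have h1 := (hP (a i) (β t, normalVelocity T γ t) 0
      (zero_mem_faceDirections (by rwa [hβγ t ht]))).1
    simp only [hΓ, mem_ofPred_eq, hβγ t ht] at h1
    simpa only [hβγ t ht] using h1
  · rw [Metric.mem_closure_iff]
    intro ε hε
    obtain ⟨i, hi⟩ := (TopologicalSpace.denseRange_denseSeq (PhaseSpace n)).exists_dist_lt w
      (half_pos hε)
    refine ⟨_, ⟨i, rfl⟩, ?_⟩
    have h1 := (hP (a i) (β t, normalVelocity T γ t) w (by
      simp only [hΓ, mem_ofPred_eq, hβγ t ht]; exact hw)).2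
    rw [← dist_eq_norm, ← dist_eq_norm] at h1
    rw [dist_comm] at hi
    calc dist w _ ≤ dist w (a i) + dist (a i) _ := dist_triangle _ _ _
      _ < ε := by rw [dist_comm w]; linarith

theorem continuous_omega : Continuous fun z : PhaseSpace n × PhaseSpace n => omega z.1 z.2 := by
  simp only [omega_eq_inner]
  exact (continuous_J.comp continuous_fst).inner continuous_snd

theorem omega_comm (u v : PhaseSpace n) : omega u v = -omega v u := by
  rw [omega_eq_inner, omega_eq_inner, inner_J_comm]

/-- The minimal face of the normal velocity of an action-minimizing closed characteristic is
isotropic at almost every time, if `0` is an interior point of `K`. -/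
theorem IsActionMinimizing.ae_isotropic_of_ball (hγ : IsActionMinimizing K T γ)
    (hconv : Convex ℝ K) (hcomp : IsCompact K) (hr : 0 < r) (hK : Metric.closedBall 0 r ⊆ K) :
    ∀ᵐ t, t ∈ Icc 0 T → ∀ w ∈ faceDirections K (γ t) (-J (deriv γ t)),
      ∀ w' ∈ faceDirections K (γ t) (-J (deriv γ t)), omega w w' = 0 := by
  obtain ⟨p, hpm, hpC, hp⟩ := hγ.1.exists_dense_selections
  have hvel := (ae_restrict_iff' measurableSet_Icc).1 hγ.1.velocity
  have hnn : ∀ᵐ t, ∀ i j, t ∈ Icc 0 T → 0 ≤ omega (p i t) (p j t) := by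
    refine ae_all_iff.2 fun i => ae_all_iff.2 fun j => ?_
    obtain ⟨C, hC⟩ := hpC i
    obtain ⟨C', hC'⟩ := hpC j
    refine hγ.ae_omega_nonneg hconv hcomp hr hK (hpm i).aestronglyMeasurable
      (hpm j).aestronglyMeasurable (C := max C C') (fun t => (hC t).trans (le_max_left _ _))
      (fun t => (hC' t).trans (le_max_right _ _)) ?_
    filter_upwards [hvel] with t h1 ht
    have h2 := (hp t ht (by rw [normalVelocity_of_mem ht]; exact h1 ht)).1
    exact ⟨h2 i, h2 j⟩
  filter_upwards [hnn, hvel] with t h1 h2 ht w hw w' hw'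
  have h3 := (hp t ht (by rw [normalVelocity_of_mem ht]; exact h2 ht)).2
  rw [normalVelocity_of_mem ht] at h3
  have h4 : (w, w') ∈ closure ((range fun i => p i t) ×ˢ (range fun i => p i t)) := by
    rw [closure_prod_eq]; exact ⟨h3 hw, h3 hw'⟩
  have h5 : closure ((range fun i => p i t) ×ˢ (range fun i => p i t)) ⊆
      {z | omega z.1 z.2 = 0} := by
    refine closure_minimal ?_ (isClosed_eq continuous_omega continuous_const)
    rintro ⟨_, _⟩ ⟨⟨i, rfl⟩, j, rfl⟩
    have h6 := h1 i j ht
    have h7 := h1 j i ht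
    rw [omega_comm] at h7
    simp only [mem_ofPred_eq]
    linarith
  exact h5 h4

end minimizing

/-! ### Translations -/

section translation

variable {K : Set (PhaseSpace n)} {T : ℝ} {γ : ℝ → PhaseSpace n}

theorem normalCone_preimage_add (K : Set (PhaseSpace n)) (a x : PhaseSpace n) :
    normalCone ((fun y => y + a) ⁻¹' K) (x - a) = normalCone K x := by
  ext v
  constructor
  · intro h y hy
    have := h (y - a) (by simpa using hy)
    rwa [sub_sub_sub_cancel_right] at this
  · intro h y hy
    have := h (y + a) hy
    rwa [← sub_sub, sub_right_comm] at this

theorem IsClosedCharacteristic.sub_const (h : IsClosedCharacteristic K T γ) (a : PhaseSpace n) :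
    IsClosedCharacteristic ((fun y => y + a) ⁻¹' K) T (fun t => γ t - a) := by
  have hd : deriv (fun t => γ t - a) = deriv γ := by
    ext1 t; exact deriv_sub_const a
  refine ⟨h.period_pos, ?_, ?_, ?_, ?_, ?_, ?_⟩
  · exact h.absolutelyContinuous.of_dist_le (C := 1) fun s _ t _ => by simp
  · rw [hd]; exact h.deriv_memLp
  · simp only [h.closed]
  · intro t ht
    have h1 : (fun y => y + a) ⁻¹' frontier K = frontier ((fun y => y + a) ⁻¹' K) :=
      (Homeomorph.addRight a).preimage_frontier K
    rw [← h1, mem_preimage, sub_add_cancel]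
    exact h.mem_boundary t ht
  · rw [hd]
    filter_upwards [h.velocity] with t ht
    rw [normalCone_preimage_add]; exact ht
  · obtain ⟨t, ht, hne⟩ := h.nonconstant
    exact ⟨t, ht, fun h' => hne (sub_left_injective h')⟩

/-- Both doubled actions equal the area form of the common velocity, which does not see the base
point. -/
theorem IsClosedCharacteristic.action_sub_const (h : IsClosedCharacteristic K T γ)
    (a : PhaseSpace n) : action T (fun t => γ t - a) = action T γ := by
  have h1 := h.two_mul_action
  have h2 := (h.sub_const a).two_mul_action
  have h3 : normalVelocity T (fun t => γ t - a) = normalVelocity T γ := by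
    have hd : deriv (fun t => γ t - a) = deriv γ := by
      ext1 t; exact deriv_sub_const a
    rw [normalVelocity, normalVelocity, hd]
  have h4 := (h.sub_const a).areaForm_normalVelocity h.integrable_normalVelocity
    h.prim_normalVelocity
  rw [← h.areaForm_normalVelocity h.integrable_normalVelocity h.prim_normalVelocity] at h1
  rw [h3] at h2 h4
  rw [← h4] at h2
  linarith

theorem IsActionMinimizing.sub_const (h : IsActionMinimizing K T γ) (a : PhaseSpace n) :
    IsActionMinimizing ((fun y => y + a) ⁻¹' K) T (fun t => γ t - a) := by
  refine ⟨h.1.sub_const a, fun T' β hβ => ?_⟩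
  have h1 := hβ.sub_const (-a)
  have h2 : (fun y => y + -a) ⁻¹' ((fun y => y + a) ⁻¹' K) = K := by
    ext y; simp
  rw [h2] at h1
  have h3 := h.2 T' _ h1
  rwa [hβ.action_sub_const, ← h.1.action_sub_const a] at h3

/-- The minimal face of the normal velocity of an action-minimizing closed characteristic is
isotropic at almost every time. -/
theorem IsActionMinimizing.ae_isotropic (h : IsActionMinimizing K T γ) (hconv : Convex ℝ K)
    (hcomp : IsCompact K) (hint : (interior K).Nonempty) :
    ∀ᵐ t, t ∈ Icc 0 T → ∀ w ∈ faceDirections K (γ t) (-J (deriv γ t)),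
      ∀ w' ∈ faceDirections K (γ t) (-J (deriv γ t)), omega w w' = 0 := by
  obtain ⟨a, ha⟩ := hint
  obtain ⟨r, hr, hball⟩ := Metric.nhds_basis_closedBall.mem_iff.1 (mem_interior_iff_mem_nhds.1 ha)
  have hball' : Metric.closedBall 0 r ⊆ (fun y => y + a) ⁻¹' K := fun y hy =>
    hball (by simpa using hy)
  have hcomp' : IsCompact ((fun y => y + a) ⁻¹' K) :=
    (Homeomorph.addRight a).isCompact_preimage.2 hcomp
  have hconv' : Convex ℝ ((fun y => y + a) ⁻¹' K) := hconv.translate_preimage_left a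
  filter_upwards [(h.sub_const a).ae_isotropic_of_ball hconv' hcomp' hr hball'] with t ht
  have hd : deriv (fun t => γ t - a) t = deriv γ t := deriv_sub_const a
  simpa only [faceDirections, normalCone_preimage_add, hd] using ht

end translation

/-! ### Extreme faces of the normal cone -/

section faces

variable {K : Set (PhaseSpace n)} {x v : PhaseSpace n}

/-- The span of the minimal face of the normal cone at `x` containing `v`. -/
def faceSpan (K : Set (PhaseSpace n)) (x v : PhaseSpace n) : Submodule ℝ (PhaseSpace n) where
  carrier := {w | ∃ C : ℝ, ∀ y ∈ K, |inner ℝ w (x - y)| ≤ C * inner ℝ v (x - y)}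
  zero_mem' := ⟨0, fun y _ => by simp⟩
  add_mem' := by
    rintro a b ⟨C, hC⟩ ⟨D, hD⟩
    refine ⟨C + D, fun y hy => ?_⟩
    rw [inner_add_left, add_mul]
    exact (abs_add_le _ _).trans (add_le_add (hC y hy) (hD y hy))
  smul_mem' := by
    rintro c a ⟨C, hC⟩
    refine ⟨|c| * C, fun y hy => ?_⟩
    rw [real_inner_smul_left, abs_mul, mul_assoc]
    exact mul_le_mul_of_nonneg_left (hC y hy) (abs_nonneg c)

/-- This is the case `C = 1` of the condition defining `faceSpan`: the face directions play the role
of a unit ball in the span of the minimal face. -/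
theorem mem_faceDirections_iff {w : PhaseSpace n} :
    w ∈ faceDirections K x v ↔ ∀ y ∈ K, |inner ℝ w (x - y)| ≤ inner ℝ v (x - y) := by
  constructor
  · intro h y hy
    have h1 := h.1 y hy
    have h2 := h.2 y hy
    rw [inner_add_left] at h1
    rw [inner_sub_left] at h2
    exact abs_le.2 ⟨by linarith, by linarith⟩
  · intro h
    constructor
    · intro y hy
      rw [inner_add_left]
      linarith [(abs_le.1 (h y hy)).1]
    · intro y hy
      rw [inner_sub_left]
      linarith [(abs_le.1 (h y hy)).2]

theorem faceDirections_subset_faceSpan : faceDirections K x v ⊆ faceSpan K x v := fun _ hw =>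
  ⟨1, fun y hy => by rw [one_mul]; exact mem_faceDirections_iff.1 hw y hy⟩

theorem smul_mem_faceDirections (hv : v ∈ normalCone K x) {w : PhaseSpace n} {C c : ℝ}
    (hC : ∀ y ∈ K, |inner ℝ w (x - y)| ≤ C * inner ℝ v (x - y)) (hc : 0 ≤ c) (hcC : c * C ≤ 1) :
    c • w ∈ faceDirections K x v := by
  refine mem_faceDirections_iff.2 fun y hy => ?_
  rw [real_inner_smul_left, abs_mul, abs_of_nonneg hc]
  calc c * |inner ℝ w (x - y)| ≤ c * (C * inner ℝ v (x - y)) := by gcongr; exact hC y hy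
    _ = (c * C) * inner ℝ v (x - y) := by ring
    _ ≤ inner ℝ v (x - y) := mul_le_of_le_one_left (hv y hy) hcC

theorem exists_smul_mem_faceDirections (hv : v ∈ normalCone K x) {w : PhaseSpace n}
    (hw : w ∈ faceSpan K x v) : ∃ c : ℝ, 0 < c ∧ c • w ∈ faceDirections K x v := by
  obtain ⟨C, hC⟩ := hw
  refine ⟨1 / (|C| + 1), by positivity, smul_mem_faceDirections hv hC (by positivity) ?_⟩
  rw [one_div_mul_eq_div, div_le_one (by positivity)]
  linarith [le_abs_self C]

theorem self_mem_faceSpan (hv : v ∈ normalCone K x) : v ∈ faceSpan K x v :=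
  ⟨1, fun y hy => by rw [one_mul, abs_of_nonneg (hv y hy)]⟩

/-- The minimal face of the normal cone at `x` containing `v`. -/
def minimalFace (K : Set (PhaseSpace n)) (x v : PhaseSpace n) : Set (PhaseSpace n) :=
  (faceSpan K x v : Set (PhaseSpace n)) ∩ normalCone K x

/-- If `a y + b z` is dominated by `C v` on all `x - k` with `k ∈ K`, so is `a y`, because `z` is
nonnegative there; hence `y` is dominated by `a⁻¹ C v`. -/
theorem isExtremeFace_minimalFace (K : Set (PhaseSpace n)) (x v : PhaseSpace n) :
    IsExtremeFace (normalCone K x) (minimalFace K x v) := by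
  refine ⟨⟨faceSpan K x v, rfl⟩, inter_subset_right, ?_⟩
  rintro y hy z hz _ ⟨⟨C, hC⟩, -⟩ ⟨a, b, ha, hb, -, rfl⟩
  refine ⟨⟨a⁻¹ * C, fun k hk => ?_⟩, hy⟩
  have h1 := (le_abs_self _).trans (hC k hk)
  rw [inner_add_left, real_inner_smul_left, real_inner_smul_left] at h1
  have h2 := mul_nonneg hb.le (hz k hk)
  rw [abs_of_nonneg (hy k hk), mul_assoc, le_inv_mul_iff₀ ha]
  linarith

theorem self_mem_minimalFace (hv : v ∈ normalCone K x) : v ∈ minimalFace K x v :=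
  ⟨self_mem_faceSpan hv, hv⟩

theorem span_minimalFace (hv : v ∈ normalCone K x) :
    Submodule.span ℝ (minimalFace K x v) = faceSpan K x v := by
  refine le_antisymm (Submodule.span_le.2 inter_subset_left) fun w hw => ?_
  obtain ⟨c, hc, hcw⟩ := exists_smul_mem_faceDirections hv hw
  have h1 : v + c • w ∈ minimalFace K x v :=
    ⟨add_mem (self_mem_faceSpan hv) (Submodule.smul_mem _ _ hw), hcw.1⟩
  have h2 : c • w ∈ Submodule.span ℝ (minimalFace K x v) := by
    have := sub_mem (Submodule.subset_span (R := ℝ) h1)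
      (Submodule.subset_span (R := ℝ) (self_mem_minimalFace hv))
    rwa [add_sub_cancel_left] at this
  have h3 := Submodule.smul_mem _ c⁻¹ h2
  rwa [smul_smul, inv_mul_cancel₀ hc.ne', one_smul] at h3

theorem isIsotropic_faceSpan (hv : v ∈ normalCone K x)
    (h : ∀ w ∈ faceDirections K x v, ∀ w' ∈ faceDirections K x v, omega w w' = 0) :
    IsIsotropic (faceSpan K x v) := by
  intro w hw w' hw'
  obtain ⟨c, hc, hcw⟩ := exists_smul_mem_faceDirections hv hw
  obtain ⟨d, hd, hdw⟩ := exists_smul_mem_faceDirections hv hw'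
  have h1 := h _ hcw _ hdw
  rw [omega_eq_inner, map_smul, real_inner_smul_left, inner_smul_right, ← omega_eq_inner] at h1
  simpa [hc.ne', hd.ne'] using h1

/-- Finite dimension makes the domination constants uniform: they are summed over an orthonormal
basis of the span. -/
theorem exists_ball_subset_faceDirections (hv : v ∈ normalCone K x) :
    ∃ ε > 0, ∀ w ∈ faceSpan K x v, ‖w‖ < ε → w ∈ faceDirections K x v := by
  set b := stdOrthonormalBasis ℝ (faceSpan K x v) with hb
  have hex : ∀ i, ∃ C : ℝ, ∀ y ∈ K,
      |inner ℝ (b i : PhaseSpace n) (x - y)| ≤ C * inner ℝ v (x - y) := fun i => (b i).2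
  choose C hC using hex
  set D := ∑ i, |C i| with hD
  have hD0 : 0 ≤ D := Finset.sum_nonneg fun _ _ => abs_nonneg _
  refine ⟨1 / (D + 1), by positivity, fun w hw hlt => mem_faceDirections_iff.2 fun y hy => ?_⟩
  set V := inner ℝ v (x - y) with hV
  have hV0 : 0 ≤ V := hv y hy
  have hrepr : w = ∑ i, inner ℝ (b i) (⟨w, hw⟩ : faceSpan K x v) • (b i : PhaseSpace n) := by
    have h1 := congrArg (Subtype.val : faceSpan K x v → PhaseSpace n)
      (b.sum_repr' (⟨w, hw⟩ : faceSpan K x v))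
    refine h1.symm.trans ?_
    simp
  have h2 : |inner ℝ w (x - y)| ≤ ∑ i, ‖w‖ * (|C i| * V) := by
    have h5 : inner ℝ w (x - y) =
        ∑ i, inner ℝ (inner ℝ (b i) (⟨w, hw⟩ : faceSpan K x v) • (b i : PhaseSpace n)) (x - y) := by
      rw [← sum_inner, ← hrepr]
    rw [h5]
    refine (Finset.abs_sum_le_sum_abs _ _).trans (Finset.sum_le_sum fun i _ => ?_)
    rw [real_inner_smul_left, abs_mul]
    have h3 : |inner ℝ (b i) (⟨w, hw⟩ : faceSpan K x v)| ≤ ‖w‖ := by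
      have := abs_real_inner_le_norm (b i) (⟨w, hw⟩ : faceSpan K x v)
      rwa [b.norm_eq_one, one_mul] at this
    have h4 : |inner ℝ (b i : PhaseSpace n) (x - y)| ≤ |C i| * V :=
      (hC i y hy).trans (by gcongr; exact le_abs_self _)
    gcongr
  rw [← Finset.mul_sum, ← Finset.sum_mul, ← hD, ← mul_assoc] at h2
  refine h2.trans (mul_le_of_le_one_left hV0 ?_)
  rw [lt_div_iff₀ (by positivity)] at hlt
  nlinarith [norm_nonneg w]

theorem self_mem_intrinsicInterior_minimalFace (hv : v ∈ normalCone K x) :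
    v ∈ intrinsicInterior ℝ (minimalFace K x v) := by
  obtain ⟨ε, hε, hball⟩ := exists_ball_subset_faceDirections hv
  rw [mem_intrinsicInterior]
  have hspan : ∀ z ∈ affineSpan ℝ (minimalFace K x v), z ∈ faceSpan K x v := by
    intro z hz
    have h1 : affineSpan ℝ (minimalFace K x v) ≤ (faceSpan K x v).toAffineSubspace :=
      affineSpan_le.2 inter_subset_left
    exact h1 hz
  refine ⟨⟨v, subset_affineSpan ℝ _ (self_mem_minimalFace hv)⟩, ?_, rfl⟩
  rw [mem_interior_iff_mem_nhds, Metric.mem_nhds_iff]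
  refine ⟨ε, hε, fun z hz => ?_⟩
  have hz1 := hspan z z.2
  have hz2 : ‖(z : PhaseSpace n) - v‖ < ε := by
    rw [Metric.mem_ball, Subtype.dist_eq, dist_eq_norm] at hz
    exact hz
  have h3 := (hball _ (sub_mem hz1 (self_mem_faceSpan hv)) hz2).1
  rw [add_sub_cancel] at h3
  exact ⟨hz1, h3⟩

/-- If all face directions are proportional to `v`, then `v` spans an extreme ray. -/
theorem isExtremeRay_minimalFace (hv : v ∈ normalCone K x) (hv0 : v ≠ 0)
    (h : ∀ w ∈ faceDirections K x v, w ∈ Submodule.span ℝ {v}) :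
    IsExtremeRay (normalCone K x) (minimalFace K x v) := by
  refine ⟨isExtremeFace_minimalFace K x v, ?_⟩
  rw [span_minimalFace hv]
  have : faceSpan K x v = Submodule.span ℝ {v} := by
    refine le_antisymm (fun w hw => ?_) (by simpa using self_mem_faceSpan hv)
    obtain ⟨c, hc, hcw⟩ := exists_smul_mem_faceDirections hv hw
    have h3 := Submodule.smul_mem _ c⁻¹ (h _ hcw)
    rwa [smul_smul, inv_mul_cancel₀ hc.ne', one_smul] at h3
  rw [this, finrank_span_singleton hv0]

theorem exists_ne_zero_mem_normalCone (hconv : Convex ℝ K) (hint : (interior K).Nonempty)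
    (hx : x ∈ frontier K) : ∃ u ∈ normalCone K x, u ≠ 0 := by
  obtain ⟨f, hf0, hf⟩ := geometric_hahn_banach_of_nonempty_interior_point hconv
    (x := x) (fun h => hx.2 h) hint
  refine ⟨(InnerProductSpace.toDual ℝ (PhaseSpace n)).symm f, fun y hy => ?_, ?_⟩
  · rw [InnerProductSpace.toDual_symm_apply, map_sub, sub_nonneg]
    exact hf y hy
  · simpa using hf0

/-- The normal cone of a convex body at a boundary point has an extreme ray. -/
theorem exists_isExtremeRay (hconv : Convex ℝ K) (hint : (interior K).Nonempty)
    (hx : x ∈ frontier K) : ∃ R, IsExtremeRay (normalCone K x) R ∧ 0 ∈ R := by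
  obtain ⟨u, hu, hu0⟩ := exists_ne_zero_mem_normalCone hconv hint hx
  obtain ⟨a, ha⟩ := hint
  obtain ⟨r, hr, hball⟩ := Metric.nhds_basis_closedBall.mem_iff.1 (mem_interior_iff_mem_nhds.1 ha)
  have hpos : ∀ w ∈ normalCone K x, r * ‖w‖ ≤ inner ℝ w (x - a) := by
    intro w hw
    refine mul_norm_le_of_inner_le (K := Metric.closedBall 0 r) hr.le le_rfl fun y hy => ?_
    have := hw (a + y) (hball (by simpa using hy))
    rw [← sub_sub, inner_sub_right] at this
    linarith
  -- A base of the cone, compact because `⟨w, x - a⟩ ≥ r ‖w‖` on it. An extreme point of the base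
  -- spans an extreme ray.
  set B : Set (PhaseSpace n) := normalCone K x ∩ {w | inner ℝ w (x - a) = 1} with hB
  have hNc : IsClosed (normalCone K x) :=
    (isClosed_normalCone_graph K).preimage (Continuous.prodMk_right x)
  have hBc : IsCompact B := by
    refine IsCompact.of_isClosed_subset (isCompact_closedBall (0 : PhaseSpace n) r⁻¹)
      (hNc.inter (isClosed_eq (continuous_id.inner continuous_const) continuous_const)) ?_
    intro w hw
    have h1 := hpos w hw.1
    rw [hw.2] at h1
    rwa [mem_closedBall_zero_iff, ← mul_one r⁻¹, le_inv_mul_iff₀ hr]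
  have hscale : ∀ w ∈ normalCone K x, 0 < inner ℝ w (x - a) →
      (inner ℝ w (x - a))⁻¹ • w ∈ B := by
    intro w hw hpos
    refine ⟨fun y hy => ?_, ?_⟩
    · rw [real_inner_smul_left]
      have := hw y hy
      positivity
    · simp only [mem_ofPred_eq]
      rw [real_inner_smul_left, inv_mul_cancel₀ hpos.ne']
  have hBne : B.Nonempty := by
    refine ⟨_, hscale u hu (lt_of_lt_of_le ?_ (hpos u hu))⟩
    have := norm_pos_iff.2 hu0
    positivity
  obtain ⟨e, he⟩ := hBc.extremePoints_nonempty hBne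
  have heB := he.1
  have he0 : e ≠ 0 := by
    rintro rfl
    have := heB.2
    simp at this
  refine ⟨minimalFace K x e, isExtremeRay_minimalFace heB.1 he0 fun w hw => ?_,
    ⟨zero_mem _, fun y _ => by simp⟩⟩
  -- Halving gives `|s| ≤ 1/2`, so `e + w'` and `e - w'` can both be rescaled back into the base.
  set w' := (1 / 2 : ℝ) • w with hw'
  have hmem : w' ∈ faceDirections K x e :=
    smul_mem_faceDirections heB.1 (C := 1)
      (by simpa using mem_faceDirections_iff.1 hw) (by norm_num) (by norm_num)
  set s := inner ℝ w' (x - a) with hs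
  have hs1 : |s| ≤ 1 / 2 := by
    have h1 := mem_faceDirections_iff.1 hw a (hball (by simp [hr.le]))
    have h2 : inner ℝ e (x - a) = 1 := heB.2
    rw [h2] at h1
    rw [hs, hw', real_inner_smul_left, abs_mul, abs_of_pos (by norm_num : (0 : ℝ) < 1 / 2)]
    linarith
  obtain ⟨hs2, hs3⟩ := abs_le.1 hs1
  have he1 : inner ℝ e (x - a) = 1 := heB.2
  have hp : inner ℝ (e + w') (x - a) = 1 + s := by rw [inner_add_left, he1]
  have hm : inner ℝ (e - w') (x - a) = 1 - s := by rw [inner_sub_left, he1]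
  have h1 := hscale _ hmem.1 (by rw [hp]; linarith)
  have h2 := hscale _ hmem.2 (by rw [hm]; linarith)
  rw [hp] at h1
  rw [hm] at h2
  have hp0 : 1 + s ≠ 0 := by linarith
  have hm0 : 1 - s ≠ 0 := by linarith
  -- With weights `(1 ± s) / 2` the rescaled points average to `e`; extremality identifies the first
  -- with `e`, whence `w' = s • e`.
  have h3 := he.2 h1 h2 ⟨(1 + s) / 2, (1 - s) / 2, by linarith, by linarith, by ring, by
    rw [smul_smul, smul_smul]
    have ha1 : (1 + s) / 2 * (1 + s)⁻¹ = 1 / 2 := by field_simp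
    have ha2 : (1 - s) / 2 * (1 - s)⁻¹ = 1 / 2 := by field_simp
    rw [ha1, ha2, ← smul_add, add_add_sub_cancel, ← two_smul ℝ e, smul_smul]
    norm_num⟩
  have h4 : e + w' = (1 + s) • e := by
    rw [← h3, smul_smul, mul_inv_cancel₀ hp0, one_smul, h3]
  have h5 : w' = s • e := by
    rw [add_smul, one_smul] at h4
    exact add_left_cancel h4
  rw [Submodule.mem_span_singleton]
  refine ⟨2 * s, ?_⟩
  rw [mul_smul, ← h5, hw', smul_smul]
  norm_num

end faces

/-! ### The classification -/

section classification

variable {K : Set (PhaseSpace n)} {T : ℝ} {γ : ℝ → PhaseSpace n}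

/-- The interval witnessing the motion at one time witnesses it at all its times. Openness supplies
the measurability of the gliding set. -/
theorem isOpen_setOf_movesAlong (K : Set (PhaseSpace n)) (T : ℝ) (γ : ℝ → PhaseSpace n) :
    IsOpen {t | ∃ E, IsCoisotropicFace K E ∧ MovesAlong K T γ E t} := by
  rw [isOpen_iff_mem_nhds]
  rintro t ⟨E, hE, t₀, t₁, ht, hsub⟩
  filter_upwards [Ioo_mem_nhds ht.1 ht.2] with s hs
  exact ⟨E, hE, t₀, t₁, hs, hsub⟩

/-- Linear independence of `v` and `w`, as strictness in the Cauchy-Schwarz inequality. -/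
theorem mem_span_singleton_of_inner_sq_eq {v w : PhaseSpace n} (hv : v ≠ 0)
    (h : inner ℝ v w ^ 2 = ‖v‖ ^ 2 * ‖w‖ ^ 2) : w ∈ Submodule.span ℝ {v} := by
  have hv' : ‖v‖ ^ 2 ≠ 0 := by simpa using hv
  have h1 : ‖w - (inner ℝ v w / ‖v‖ ^ 2) • v‖ ^ 2 = 0 := by
    rw [norm_sub_sq_real, inner_smul_right, norm_smul, mul_pow, Real.norm_eq_abs, sq_abs,
      real_inner_comm]
    field_simp
    rw [real_inner_comm] at h
    nlinarith
  have h2 : w - (inner ℝ v w / ‖v‖ ^ 2) • v = 0 := by simpa using h1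
  rw [sub_eq_zero.1 h2]
  exact Submodule.smul_mem _ _ (Submodule.mem_span_singleton_self v)

theorem inner_sq_eq_of_mem_span_singleton {v w : PhaseSpace n} (h : w ∈ Submodule.span ℝ {v}) :
    inner ℝ v w ^ 2 = ‖v‖ ^ 2 * ‖w‖ ^ 2 := by
  obtain ⟨c, rfl⟩ := Submodule.mem_span_singleton.1 h
  rw [inner_smul_right, real_inner_self_eq_norm_sq, norm_smul, Real.norm_eq_abs, mul_pow, mul_pow,
    sq_abs]
  ring

theorem one_lt_finrank_faceSpan {x v w : PhaseSpace n} (hv : v ∈ normalCone K x)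
    (hw : w ∈ faceDirections K x v) (hne : inner ℝ v w ^ 2 ≠ ‖v‖ ^ 2 * ‖w‖ ^ 2) :
    1 < Module.finrank ℝ (faceSpan K x v) := by
  have hv0 : v ≠ 0 := by
    rintro rfl; simp at hne
  have hlt : Submodule.span ℝ {v} < faceSpan K x v := by
    refine lt_of_le_of_ne (by simpa using self_mem_faceSpan hv) fun h => hne ?_
    refine inner_sq_eq_of_mem_span_singleton ?_
    rw [h]
    exact faceDirections_subset_faceSpan hw
  have := Submodule.finrank_lt_finrank_of_lt hlt
  rwa [finrank_span_singleton hv0] at this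

/-- Equality in Cauchy–Schwarz is a closed condition on `w`, so it is enough to test it on the
countably many measurable selections dense in the face directions. -/
theorem IsClosedCharacteristic.nullMeasurableSet_setOf_not_ray (h : IsClosedCharacteristic K T γ) :
    NullMeasurableSet {t | t ∈ Ioo 0 T ∧ ∃ w ∈ faceDirections K (γ t) (-J (deriv γ t)),
      inner ℝ (-J (deriv γ t)) w ^ 2 ≠ ‖-J (deriv γ t)‖ ^ 2 * ‖w‖ ^ 2} := by
  obtain ⟨p, hpm, -, hp⟩ := h.exists_dense_selections
  have hvel := (ae_restrict_iff' measurableSet_Icc).1 h.velocity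
  have hvm := measurable_normalVelocity T γ
  have hmeas : MeasurableSet {t | t ∈ Ioo 0 T ∧ ∃ i, inner ℝ (normalVelocity T γ t) (p i t) ^ 2 ≠
      ‖normalVelocity T γ t‖ ^ 2 * ‖p i t‖ ^ 2} := by
    have h1 : {t | t ∈ Ioo 0 T ∧ ∃ i, inner ℝ (normalVelocity T γ t) (p i t) ^ 2 ≠
        ‖normalVelocity T γ t‖ ^ 2 * ‖p i t‖ ^ 2} =
        Ioo 0 T ∩ ⋃ i, {t | inner ℝ (normalVelocity T γ t) (p i t) ^ 2 =
          ‖normalVelocity T γ t‖ ^ 2 * ‖p i t‖ ^ 2}ᶜ := by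
      ext t; simp
    rw [h1]
    refine measurableSet_Ioo.inter (MeasurableSet.iUnion fun i => ?_)
    exact (measurableSet_eq_fun ((hvm.inner (hpm i)).pow_const 2)
      ((hvm.norm.pow_const 2).mul ((hpm i).norm.pow_const 2))).compl
  refine hmeas.nullMeasurableSet.congr ?_
  filter_upwards [hvel] with t ht
  refine propext (and_congr_right fun htm => ?_)
  have htI := Ioo_subset_Icc_self htm
  have hv := normalVelocity_of_mem (γ := γ) htI
  obtain ⟨h1, h2⟩ := hp t htI (by rw [hv]; exact ht htI)
  rw [hv] at h1 h2
  rw [hv]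
  constructor
  · rintro ⟨i, hi⟩
    exact ⟨p i t, h1 i, hi⟩
  · rintro ⟨w, hw, hne⟩
    by_contra! hall
    have hcl : IsClosed {w : PhaseSpace n | inner ℝ (-J (deriv γ t)) w ^ 2 =
        ‖-J (deriv γ t)‖ ^ 2 * ‖w‖ ^ 2} := isClosed_eq (by fun_prop) (by fun_prop)
    exact hne (closure_minimal (by rintro _ ⟨i, rfl⟩; exact hall i) hcl (h2 hw))

end classification

end PhaseSpace

/-! ### Assembly of the trichotomy -/

theorem mainTheorem4 (n : ℕ) (K : Set (PhaseSpace n)) (hconv : Convex ℝ K) (hcomp : IsCompact K)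
    (hint : (interior K).Nonempty) (T : ℝ) (γ : ℝ → PhaseSpace n)
    (hγ : PhaseSpace.IsActionMinimizing K T γ) :
    ∀ᵐ t ∂MeasureTheory.volume.restrict (Set.Icc 0 T),
      (∃ R, PhaseSpace.IsExtremeRay (PhaseSpace.normalCone K (γ t)) R ∧
        -PhaseSpace.J (deriv γ t) ∈ R) ∨
      (∃ E, PhaseSpace.IsCoisotropicFace K E ∧ PhaseSpace.MovesAlong K T γ E t) ∨
      (∃ A, PhaseSpace.IsIsotropicGlidingSet K T γ A ∧ t ∈ A) := by
  open PhaseSpace in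
  have hvel := (ae_restrict_iff' measurableSet_Icc).1 hγ.1.velocity
  have hiso := hγ.ae_isotropic hconv hcomp hint
  set G : Set ℝ := {t | t ∈ Ioo 0 T ∧ ∃ w ∈ faceDirections K (γ t) (-J (deriv γ t)),
      inner ℝ (-J (deriv γ t)) w ^ 2 ≠ ‖-J (deriv γ t)‖ ^ 2 * ‖w‖ ^ 2} with hG
  set M : Set ℝ := {t | ∃ E, IsCoisotropicFace K E ∧ MovesAlong K T γ E t} with hM
  set I : Set ℝ := {t | (t ∈ Icc 0 T → ∀ w ∈ faceDirections K (γ t) (-J (deriv γ t)),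
      ∀ w' ∈ faceDirections K (γ t) (-J (deriv γ t)), omega w w' = 0) ∧
      (t ∈ Icc 0 T → -J (deriv γ t) ∈ normalCone K (γ t))} with hI
  have hIae : ∀ᵐ t, t ∈ I := by
    filter_upwards [hiso, hvel] with t h1 h2 using ⟨h1, h2⟩
  -- One set serves all gliding times: the minimal face is not a ray, no coisotropic face carries
  -- the motion, and the almost-everywhere conclusions hold.
  set A : Set ℝ := (G \ M) ∩ I with hA
  have hAm : NullMeasurableSet A :=
    (hγ.1.nullMeasurableSet_setOf_not_ray.diff
      (isOpen_setOf_movesAlong K T γ).measurableSet.nullMeasurableSet).inter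
      (NullMeasurableSet.of_compl (NullMeasurableSet.of_null hIae))
  have hAglide : 0 < volume A → IsIsotropicGlidingSet K T γ A := by
    intro hpos
    refine ⟨fun t ht => ht.1.1.1, hAm, hpos, ?_, fun t ht E hE hmv => ht.1.2 ⟨E, hE, hmv⟩⟩
    rintro t ⟨⟨⟨htm, w, hw, hne⟩, -⟩, hiso, hv⟩
    have htI := Ioo_subset_Icc_self htm
    have hv := hv htI
    refine ⟨minimalFace K (γ t) (-J (deriv γ t)), isExtremeFace_minimalFace _ _ _, ?_, ?_,
      self_mem_intrinsicInterior_minimalFace hv⟩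
    · rw [span_minimalFace hv]
      exact isIsotropic_faceSpan hv (hiso htI)
    · rw [span_minimalFace hv]
      exact one_lt_finrank_faceSpan hv hw hne
  -- A gliding set must have positive measure; if `A` is null, its times are discarded.
  have hA0 : ∀ᵐ t, t ∈ A → 0 < volume A := by
    by_cases hz : volume A = 0
    · filter_upwards [measure_eq_zero_iff_ae_notMem.1 hz] with t h1 h2
      exact absurd h2 h1
    · exact ae_of_all _ fun t _ => pos_iff_ne_zero.2 hz
  have h0 : ∀ᵐ t : ℝ, t ≠ 0 := by simp [ae_iff]
  have hT' : ∀ᵐ t : ℝ, t ≠ T := by simp [ae_iff]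
  refine (ae_restrict_iff' measurableSet_Icc).2 ?_
  filter_upwards [hIae, hA0, h0, hT'] with t htI htA ht0 htT ht
  have hv := htI.2 ht
  -- A zero velocity is the apex of the cone, which belongs to any extreme ray; one exists at every
  -- boundary point.
  by_cases hv0 : -J (deriv γ t) = 0
  · left
    obtain ⟨R, hR, h0R⟩ := exists_isExtremeRay hconv hint (hγ.1.mem_boundary t ht)
    exact ⟨R, hR, by rwa [hv0]⟩
  by_cases htG : t ∈ G
  · right
    by_cases htM : t ∈ M
    · exact Or.inl htM
    · have htA' : t ∈ A := ⟨⟨htG, htM⟩, htI⟩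
      exact Or.inr ⟨A, hAglide (htA htA'), htA'⟩
  · left
    refine ⟨minimalFace K (γ t) (-J (deriv γ t)), isExtremeRay_minimalFace hv hv0 fun w hw => ?_,
      self_mem_minimalFace hv⟩
    refine mem_span_singleton_of_inner_sq_eq hv0 ?_
    by_contra hne
    exact htG ⟨⟨lt_of_le_of_ne ht.1 (Ne.symm ht0), lt_of_le_of_ne ht.2 htT⟩, w, hw, hne⟩
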